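/- Let $\Sigma_\eta=\mathcal H/h(\pi_1\Sigma)$ be an admissible hyperbolic surface: $\mathcal H\subset\mathbb H^2$ is its universal covering, an open convex set with geodesic boundary, $h:\pi_1(\Sigma)\to PSL_2(\mathbb R)$ is its (faithful and discrete) holonomy, the area of $\Sigma_\eta$ is finite, and each boundary geodesic of its completion is a closed curve. Let $\lambda$ be a measured geodesic lamination on the interior of $\Sigma_\eta$, i.e. a closed union of disjoint complete geodesics with a transverse measure of full support, and let $\tilde\lambda$ be its lift to $\mathcal H$. Let $E:\mathcal H\to\mathbb H^2$ be an equivariant right earthquake with shearing lamination $\tilde\lambda$, and let $h'$ be the representation with $E\circ h(\gamma)=h'(\gamma)\circ E$ for all $\gamma\in\pi_1(\Sigma)$, so that the surface obtained from $\Sigma_\eta$ by the right earthquake along $\lambda$ is $E^r_\lambda(\Sigma_\eta)=E(\mathcal H)/h'$. (On each stratum, that is, each leaf of $\tilde\lambda$ and each component of its complement, $E$ is an orientation preserving isometry; the comparison isometry $A(F)^{-1}A(F')$ of two distinct strata is a hyperbolic translation whose axis weakly separates $F$ from $F'$ and which moves $F'$ to the right as seen from $F$, or is trivial, which is allowed only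 if $F$ and $F'$ lie in the closure of one stratum. The transverse measure is recovered as the infimum, over partitions of a transverse geodesic segment, of the sums of the translation lengths of the comparison isometries.) Let $\lambda'$ be the image of $\lambda$ under the earthquake. Let $c$ be a geodesic boundary component of $\Sigma_\eta$ with its boundary orientation (the surface lies on its left). The lamination $\lambda$ spirals in the positive (resp. negative) way around $c$ if some leaves of $\lambda$ are asymptotic to $c$ in the positive (resp. negative) direction of $c$, and so are all leaves that enter a sufficiently small neighbourhood of $c$. Let $a$ be the length of $c$, let $a'$ be the length of the corresponding boundary component of $E^r_\lambda(\Sigma_\eta)$ (the infimum of the lengths of closed curves in its free homotopy class, hence $0$ for a cusp), and let $m\ge 0$ be the mass of $\lambda$ at $c$: the total mass of the geodesic loop based at $x$ and parallel to $c$, which is the same for all points $x\notin\lambda$ close enough to $c$. Then: 1. If $\lambda$ spirals around $c$ in the positive way then $a'=a+m$; if $\lambda$ spirals around $c$ in the negative way then $a'=|a-m|$. 2. If $\lambda$ spirals around $c$ in the positive way, then $\lambda'$ spirals in the positive way around the corresponding boundary geodesic of $E^r_\lambda(\Sigma_\eta)$. If $\lambda$ spirals in the negative way, then $\lambda'$ spirals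 in the negative way if $m<a$ and in the positive way if $m>a$. 3. $E^r_\lambda(\Sigma_\eta)$ has a cusp at the boundary component corresponding to $c$ if and only if $\lambda$ spirals around $c$ in the negative way and $m=a$. -/

import Mathlib

open scoped UpperHalfPlane MatrixGroups Pointwise Topology
open Set Filter MeasureTheory

noncomputable section

namespace HypEarthquake

/-! ### The hyperbolic plane: isometries, oriented geodesics, half planes -/

/-- `PSL₂(ℝ)`, realised as the group of Möbius transformations of the upper half plane (that is,
the group of its orientation preserving isometries). -/
abbrev PSL2R : Subgroup (Equiv.Perm ℍ) := (MulAction.toPermHom SL(2, ℝ) ℍ).range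

/-- The geodesic segment between two points. -/
def segment (x y : ℍ) : Set ℍ := {z | dist x z + dist z y = dist x y}

/-- Convexity in the hyperbolic plane. -/
def GeodConvex (K : Set ℍ) : Prop := ∀ x ∈ K, ∀ y ∈ K, segment x y ⊆ K

/-- A matrix `C` encodes an oriented complete geodesic with a base point: the image under `C` of
the imaginary axis, oriented upwards. `axisPoint C` is its unit speed parametrisation
`t ↦ C • (i eᵗ)`. -/
def axisPoint (C : SL(2, ℝ)) (t : ℝ) : ℍ :=
  C • (⟨⟨0, Real.exp t⟩, Real.exp_pos t⟩ : ℍ)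

/-- The complete geodesic (as a set) underlying the oriented geodesic `C`. -/
def line (C : SL(2, ℝ)) : Set ℍ := range (axisPoint C)

/-- A set is a complete geodesic. -/
def IsGeodesic (l : Set ℍ) : Prop := ∃ C : SL(2, ℝ), l = line C

/-- The open half plane on the left of an oriented geodesic. -/
def leftSide (C : SL(2, ℝ)) : Set ℍ := {z | (C⁻¹ • z).re < 0}

/-- The closed half plane on the left of an oriented geodesic. -/
def closedLeftSide (C : SL(2, ℝ)) : Set ℍ := {z | (C⁻¹ • z).re ≤ 0}

/-- The closed half plane on the right of an oriented geodesic. -/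
def closedRightSide (C : SL(2, ℝ)) : Set ℍ := {z | 0 ≤ (C⁻¹ • z).re}

/-- `g` is the hyperbolic translation of length `s` along the oriented geodesic `C`
(forward if `s > 0`): in the coordinates of `C` it is `z ↦ eˢ z`. -/
def TranslatesAlong (g : PSL2R) (C : SL(2, ℝ)) (s : ℝ) : Prop :=
  ∀ z : ℍ, ((C⁻¹ • (g • (C • z)) : ℍ) : ℂ) = (Real.exp s : ℂ) * (z : ℂ)

/-- The translation length of an isometry. -/
def translationLength (g : PSL2R) : ℝ := ⨅ z : ℍ, dist z (g • z)

/-! ### Admissible hyperbolic surfaces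

A surface is presented as `H / ρ(G)`, where `H` (its developed universal covering) is an open convex
subset of the hyperbolic plane with geodesic boundary and `ρ` is the holonomy representation of
its fundamental group `G`. -/

/-- `H / ρ(G)` is an admissible hyperbolic surface: its area is finite, its completion has geodesic
boundary, and every boundary geodesic is a closed curve. -/
structure IsAdmissible {G : Type*} [Group G] (ρ : G →* PSL2R) (H : Set ℍ) : Prop where
  nonempty : H.Nonempty
  isOpen : IsOpen H
  convex : GeodConvex H
  invariant : ∀ g, ρ g • H = H
  /-- the action is free (so `ρ` is faithful, and without elliptic elements) -/
  free : ∀ g, g ≠ 1 → ∀ z : ℍ, ρ g • z ≠ z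
  /-- the action is properly discontinuous, that is, the image of `ρ` is discrete -/
  discrete : ∀ K : Set ℍ, IsCompact K → {g : G | ((ρ g • K) ∩ K).Nonempty}.Finite
  /-- the frontier of `H` is a union of complete geodesics -/
  geodesic_boundary : ∀ z ∈ frontier H, ∃ C : SL(2, ℝ), z ∈ line C ∧ line C ⊆ frontier H
  /-- each boundary geodesic covers a closed curve -/
  closed_boundary : ∀ C : SL(2, ℝ), line C ⊆ frontier H → ∃ g, g ≠ 1 ∧ ρ g • line C = line C
  /-- the quotient has finite area -/
  finite_area : ∃ D : Set ℍ, MeasurableSet D ∧ D ⊆ H ∧ H ⊆ (⋃ g : G, ρ g • D) ∧ volume D < ⊤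

/-- The oriented geodesic `C` is a boundary geodesic of `K` with the boundary orientation
(`K` lies on its left), and `g` translates along `C` in the positive direction. -/
def IsBoundaryAxis (K : Set ℍ) (g : PSL2R) (C : SL(2, ℝ)) : Prop :=
  K ⊆ leftSide C ∧ line C ⊆ frontier K ∧ ∃ s : ℝ, 0 < s ∧ TranslatesAlong g C s

/-- `γ` is the positive generator of the fundamental group of a geodesic boundary component of
`H / ρ(G)`: it translates positively along a boundary geodesic of `H` and generates the
stabiliser of that geodesic. -/
def IsGeodesicBoundaryComponent {G : Type*} [Group G] (ρ : G →* PSL2R) (H : Set ℍ) (γ : G) :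
    Prop :=
  ∃ C : SL(2, ℝ), IsBoundaryAxis H (ρ γ) C ∧
    ∀ g : G, ρ g • line C = line C ↔ g ∈ Subgroup.zpowers γ

/-- The length of the boundary component with peripheral element `g` in the surface with universal
covering `K`: the infimum of the lengths of the closed curves in the surface that represent the
(free homotopy) class of `g`. It vanishes when the boundary component is a cusp. -/
def boundaryLength (K : Set ℍ) (g : PSL2R) : ℝ := ⨅ x : K, dist (x : ℍ) (g • (x : ℍ))

/-- The surface with universal covering `K` has a cusp at the puncture with peripheral element `g`:
`g` is parabolic (conjugate to `z ↦ z + b` with `b ≠ 0`) and `K` contains a horoball based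
at its fixed point. -/
def HasCusp (K : Set ℍ) (g : PSL2R) : Prop :=
  ∃ (A : SL(2, ℝ)) (b : ℝ), b ≠ 0 ∧ (∀ z : ℍ, g • (A • z) = A • (b +ᵥ z)) ∧
    ∀ z : ℍ, 1 < z.im → A • z ∈ K

/-! ### Measured geodesic laminations -/

/-- A geodesic lamination of the open convex set `H`, given by its set of leaves: disjoint
complete geodesics in `H` whose union is closed in `H`. -/
structure IsGeodesicLamination (H : Set ℍ) (L : Set (Set ℍ)) : Prop where
  isGeodesic : ∀ l ∈ L, IsGeodesic l
  subset : ∀ l ∈ L, l ⊆ H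
  disjoint : L.PairwiseDisjoint id
  closed : closure (⋃₀ L) ∩ H ⊆ ⋃₀ L

/-- A stratum is a leaf or a connected component of the complement of the leaves. -/
def IsStratum (H : Set ℍ) (L : Set (Set ℍ)) (F : Set ℍ) : Prop :=
  F ∈ L ∨ ∃ x ∈ H \ ⋃₀ L, F = connectedComponentIn (H \ ⋃₀ L) x

/-- A parametrised arc in `H` transverse to the lamination, with end points off the lamination:
a `C¹` embedding of `[0, 1]` that is not tangent to any leaf it meets. (If `l = line A`, then
`z ↦ Re (A⁻¹ z)` is a defining function of `l`.) -/
structure IsTransversePath (H : Set ℍ) (L : Set (Set ℍ)) (c : ℝ → ℍ) : Prop where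
  contDiffOn : ContDiffOn ℝ 1 (fun t => (c t : ℂ)) (Icc 0 1)
  injOn : InjOn c (Icc 0 1)
  mapsTo : MapsTo c (Icc 0 1) H
  source : c 0 ∉ ⋃₀ L
  target : c 1 ∉ ⋃₀ L
  transverse : ∀ t ∈ Icc (0 : ℝ) 1, ∀ A : SL(2, ℝ), line A ∈ L → c t ∈ line A →
    derivWithin (fun u => (A⁻¹ • c u).re) (Icc 0 1) t ≠ 0

/-- A transverse arc, as a set. -/
def IsTransverseArc (H : Set ℍ) (L : Set (Set ℍ)) (k : Set ℍ) : Prop :=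
  ∃ c : ℝ → ℍ, IsTransversePath H L c ∧ k = c '' Icc 0 1

/-- Two arcs are homotopic through a `C¹`-continuous family of transverse arcs. -/
def TransverselyHomotopic (H : Set ℍ) (L : Set (Set ℍ)) (k k' : Set ℍ) : Prop :=
  ∃ Φ : ℝ → ℝ → ℍ,
    (∀ s ∈ Icc (0 : ℝ) 1, IsTransversePath H L (Φ s)) ∧
    ContinuousOn (fun p : ℝ × ℝ => Φ p.1 p.2) (Icc 0 1 ×ˢ Icc 0 1) ∧
    ContinuousOn (fun p : ℝ × ℝ => derivWithin (fun u => (Φ p.1 u : ℂ)) (Icc 0 1) p.2)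
      (Icc 0 1 ×ˢ Icc 0 1) ∧
    k = Φ 0 '' Icc 0 1 ∧ k' = Φ 1 '' Icc 0 1

/-- A transverse measure on a lamination: a finite Borel measure `μ k` on each transverse arc `k`,
with support the intersection of `k` with the lamination, compatible with restriction to
sub-arcs, and with total mass invariant under homotopy through transverse arcs. (The values of
`μ` on other sets carry no meaning.) -/
structure IsTransverseMeasure (H : Set ℍ) (L : Set (Set ℍ)) (μ : Set ℍ → Measure ℍ) : Prop where
  finite : ∀ k, IsTransverseArc H L k → μ k univ < ⊤
  support : ∀ k, IsTransverseArc H L k → (μ k).support = k ∩ ⋃₀ L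
  restrict : ∀ k k', IsTransverseArc H L k → IsTransverseArc H L k' → k' ⊆ k →
    μ k' = (μ k).restrict k'
  homotopy : ∀ k k', TransverselyHomotopic H L k k' → μ k univ = μ k' univ

/-- `(L, μ)` is (the lift to `H` of) a measured geodesic lamination on the surface `H / ρ(G)`:
an invariant geodesic lamination with an invariant transverse measure. -/
structure IsMeasuredLamination {G : Type*} [Group G] (ρ : G →* PSL2R) (H : Set ℍ)
    (L : Set (Set ℍ)) (μ : Set ℍ → Measure ℍ) : Prop where
  lamination : IsGeodesicLamination H L
  measure : IsTransverseMeasure H L μ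
  invariant : ∀ g, ∀ l ∈ L, ρ g • l ∈ L
  measure_invariant : ∀ g k, IsTransverseArc H L k →
    μ (ρ g • k) = (μ k).map (fun z => ρ g • z)

/-- `m` is the mass of the lamination at the boundary component with positive generator `g`: for
every `x` off the lamination and close enough to the boundary geodesic, `m` is the total mass of
the geodesic loop based at `x` parallel to the boundary component (which lifts to the segment
from `x` to `g x`). -/
def HasBoundaryMass (H : Set ℍ) (L : Set (Set ℍ)) (μ : Set ℍ → Measure ℍ) (g : PSL2R) (m : ℝ) :
    Prop :=
  0 ≤ m ∧ ∃ C : SL(2, ℝ), IsBoundaryAxis H g C ∧ ∃ ε > 0, ∀ x ∈ H \ ⋃₀ L,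
    Metric.infDist x (line C) < ε → μ (segment x (g • x)) univ = ENNReal.ofReal m

/-- The lamination `L` of `K` spirals in the positive way around the geodesic boundary component
with positive generator `g`: some leaves are asymptotic to the boundary geodesic in its positive
direction, and so are all leaves that enter a suitable neighbourhood of it. -/
def SpiralsPositively (K : Set ℍ) (L : Set (Set ℍ)) (g : PSL2R) : Prop :=
  ∃ C : SL(2, ℝ), IsBoundaryAxis K g C ∧
    (∃ l ∈ L, Tendsto (fun t => Metric.infDist (axisPoint C t) l) atTop (𝓝 0)) ∧
    ∃ ε > 0, ∀ l ∈ L, (∃ z ∈ l, Metric.infDist z (line C) < ε) →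
      Tendsto (fun t => Metric.infDist (axisPoint C t) l) atTop (𝓝 0)

/-- The lamination `L` of `K` spirals in the negative way around the geodesic boundary component
with positive generator `g`: some leaves are asymptotic to the boundary geodesic in its negative
direction, and so are all leaves that enter a suitable neighbourhood of it. -/
def SpiralsNegatively (K : Set ℍ) (L : Set (Set ℍ)) (g : PSL2R) : Prop :=
  ∃ C : SL(2, ℝ), IsBoundaryAxis K g C ∧
    (∃ l ∈ L, Tendsto (fun t => Metric.infDist (axisPoint C t) l) atBot (𝓝 0)) ∧
    ∃ ε > 0, ∀ l ∈ L, (∃ z ∈ l, Metric.infDist z (line C) < ε) →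
      Tendsto (fun t => Metric.infDist (axisPoint C t) l) atBot (𝓝 0)

/-! ### Right earthquakes -/

/-- `g` is a hyperbolic transformation whose axis weakly separates `F` from `F'` and which
translates `F'` to the right as seen from `F`. (Facing from `F` to `F'`, moving to the right means
moving along the axis with `F` on the right and `F'` on the left.) -/
def TranslatesRight (g : PSL2R) (F F' : Set ℍ) : Prop :=
  ∃ (C : SL(2, ℝ)) (s : ℝ), 0 < s ∧ TranslatesAlong g C s ∧
    F ⊆ closedRightSide C ∧ F' ⊆ closedLeftSide C

/-- `E` is a right earthquake on `H` with fault locus `L`, equal to the isometry `A F` on each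
stratum `F`. The comparison isometry of two distinct strata may be trivial only if both are
contained in the closure of one stratum. -/
structure IsRightEarthquake (H : Set ℍ) (L : Set (Set ℍ)) (E : ℍ → ℍ) (A : Set ℍ → PSL2R) :
    Prop where
  eqOn : ∀ F, IsStratum H L F → ∀ x ∈ F, E x = A F • x
  comparison : ∀ F F', IsStratum H L F → IsStratum H L F' → F ≠ F' →
    TranslatesRight ((A F)⁻¹ * A F') F F' ∨
      (A F = A F' ∧ ∃ F'', IsStratum H L F'' ∧ F ⊆ closure F'' ∧ F' ⊆ closure F'')

/-- The sums of the translation lengths of the comparison isometries along the partitions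
`x = p 0, p 1, …, p k = y` of the geodesic segment from `x` to `y`. -/
def shearSums (H : Set ℍ) (L : Set (Set ℍ)) (A : Set ℍ → PSL2R) (x y : ℍ) : Set ℝ :=
  {S | ∃ (k : ℕ) (p : ℕ → ℍ) (F : ℕ → Set ℍ), p 0 = x ∧ p k = y ∧
    (∀ i ≤ k, p i ∈ segment x y ∧ IsStratum H L (F i) ∧ p i ∈ F i) ∧
    (∀ i < k, dist x (p i) ≤ dist x (p (i + 1))) ∧
    S = ∑ i ∈ Finset.range k, translationLength ((A (F i))⁻¹ * A (F (i + 1)))}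

/-- `E` is a right earthquake on `H` with shearing lamination `(L, μ)`: its fault locus is `L`, and
the amount of shearing along a transverse geodesic segment (the infimum over all partitions of the
sum of the translation lengths of the comparison isometries) is the measure of the segment. -/
def IsRightEarthquakeAlong (H : Set ℍ) (L : Set (Set ℍ)) (μ : Set ℍ → Measure ℍ) (E : ℍ → ℍ) :
    Prop :=
  ∃ A : Set ℍ → PSL2R, IsRightEarthquake H L E A ∧
    ∀ x ∈ H \ ⋃₀ L, ∀ y ∈ H \ ⋃₀ L, x ≠ y →
      μ (segment x y) univ = ENNReal.ofReal (sInf (shearSums H L A x y))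

/-- The leaves of the image of a lamination under an earthquake. -/
def imageLeaves (E : ℍ → ℍ) (L : Set (Set ℍ)) : Set (Set ℍ) := (fun l => E '' l) '' L

end HypEarthquake

end

open HypEarthquake

noncomputable section

namespace HypEarthquake

/-! Put the boundary geodesic on the imaginary axis, so that its holonomy becomes `z ↦ κ z` with
`|log κ| = a`. A leaf that comes close to the axis must end at `∞` or at `0`: otherwise it would
cross its image under the holonomy (`asymptotic_of_disjoint`). The two kinds cannot both occur,
since translates of a leaf ending at one end would cross a leaf ending at the other
(`verticalNear_dichotomy`). Reversing the axis replaces `κ` by `κ⁻¹`, so the leaves near the axis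
may be taken vertical. Then `κ > 1` is the positive case (or the case of no leaves near the axis)
and `κ < 1` the negative one.

Every stratum meeting the collar now contains a vertical ray. An axis weakly separating two such
strata ends at `∞`, and moving right as seen from the left stratum means moving down. So the
comparison isometry is affine with factor `exp (-s)` (`TranslatesRight.isAffine`). Affine factors
multiply, hence the shears along a partition from `x` to `g x` have the same sum `m` for every
partition (`sum_translationLength`). In the coordinates of a stratum, the new holonomy is the
comparison with its translate composed with `z ↦ κ z`, so it is affine with factor `k = κ exp m`
(`exists_conj_affine`).

Everything is read off from `k`. The image contains vertical rays, so the new boundary length is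
`|log k| = |log κ + m|`. The earthquake preserves the order of vertical leaves, so if such leaves
exist and `k ≠ 1`, the image lies on one side of the new axis, vertical leaves stay vertical, and
the direction of spiralling is the sign of `log k` (`BasedModel.spirals`). If `k = 1`, the holonomy
is a horizontal translation and the images of the rays over one period fill a horoball (`hasCusp`).
-/

theorem det_eq_one (A : SL(2, ℝ)) : A 0 0 * A 1 1 - A 0 1 * A 1 0 = 1 := by
  have := A.det_coe
  rwa [Matrix.det_fin_two] at this

/-! ### Möbius action and geodesics in the coordinates `(re, nsq)` -/

/-- The squared Euclidean norm. -/
def nsq (z : ℍ) : ℝ := z.re ^ 2 + z.im ^ 2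

/-- The squared norm of the denominator of the Möbius transformation `A` at `z`. -/
def den (A : SL(2, ℝ)) (z : ℍ) : ℝ := A 1 0 ^ 2 * nsq z + 2 * A 1 0 * A 1 1 * z.re + A 1 1 ^ 2

theorem den_pos (A : SL(2, ℝ)) (z : ℍ) : 0 < den A z := by
  have h := det_eq_one A
  have hz := z.im_pos
  have : den A z = (A 1 0 * z.re + A 1 1) ^ 2 + (A 1 0 * z.im) ^ 2 := by
    unfold den nsq; ring
  rw [this]
  rcases eq_or_ne (A 1 0) 0 with hc | hc
  · have : A 1 1 ≠ 0 := by rintro h'; simp [hc, h'] at h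
    rw [hc, zero_mul, zero_add, zero_mul, zero_pow two_ne_zero, add_zero]
    exact sq_pos_iff.2 this
  · exact add_pos_of_nonneg_of_pos (sq_nonneg _) (sq_pos_iff.2 (mul_ne_zero hc hz.ne'))

/-- The triple `(nsq, re, 1)` transforms linearly, by the symmetric square of `A`, up to the common
factor `den`. In these coordinates isometries are projective maps and geodesics are straight lines.
-/
theorem smul_coords (A : SL(2, ℝ)) (z : ℍ) :
    (A • z).re * den A z
      = A 0 0 * A 1 0 * nsq z + (A 0 0 * A 1 1 + A 0 1 * A 1 0) * z.re + A 0 1 * A 1 1 ∧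
    (A • z).im * den A z = z.im ∧
    nsq (A • z) * den A z = A 0 0 ^ 2 * nsq z + 2 * A 0 0 * A 0 1 * z.re + A 0 1 ^ 2 := by
  have h := det_eq_one A
  have hd := den_pos A z
  have e := UpperHalfPlane.coe_specialLinearGroup_apply A z
  have hden : Complex.normSq ((A 1 0 : ℂ) * z + (A 1 1 : ℂ)) = den A z := by
    simp [Complex.normSq_apply, den, nsq]; ring
  have hre : (A • z).re = (A 0 0 * A 1 0 * nsq z + (A 0 0 * A 1 1 + A 0 1 * A 1 0) * z.re
      + A 0 1 * A 1 1) / den A z := by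
    have := congrArg Complex.re e
    rw [UpperHalfPlane.coe_re] at this
    rw [this, Complex.div_re]
    simp only [Algebra.algebraMap_self, RingHom.id_apply]
    rw [hden, ← add_div]
    congr 1
    simp [nsq]; ring
  have him : (A • z).im = z.im / den A z := by
    have := congrArg Complex.im e
    rw [UpperHalfPlane.coe_im] at this
    rw [this, Complex.div_im]
    simp only [Algebra.algebraMap_self, RingHom.id_apply]
    rw [hden, ← sub_div]
    congr 1
    simp
    linear_combination z.im * h
  refine ⟨by rw [hre]; field_simp, by rw [him]; field_simp, ?_⟩
  rw [nsq, hre, him]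
  field_simp
  unfold den nsq
  linear_combination (exp := 1) (-z.im ^ 2 * (1 + (A 0 0 * A 1 1 - A 0 1 * A 1 0))) * h

/-- The affine function (in `re` and `nsq`) defining the geodesic `A`. -/
def side (A : SL(2, ℝ)) (z : ℍ) : ℝ :=
  (A 0 0 * A 1 1 + A 0 1 * A 1 0) * z.re - A 1 0 * A 1 1 * nsq z - A 0 0 * A 0 1

theorem re_inv_smul (A : SL(2, ℝ)) (z : ℍ) : (A⁻¹ • z).re * den A⁻¹ z = side A z := by
  rw [(smul_coords A⁻¹ z).1]
  simp [Matrix.SpecialLinearGroup.SL2_inv_expl, side]; ring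

theorem mem_leftSide {A : SL(2, ℝ)} {z : ℍ} : z ∈ leftSide A ↔ side A z < 0 := by
  rw [← re_inv_smul]
  have hd := den_pos A⁻¹ z
  exact ⟨fun h => mul_neg_of_neg_of_pos h hd,
    fun h => not_le.1 fun h' => h.not_ge (mul_nonneg h' hd.le)⟩

theorem mem_closedLeftSide {A : SL(2, ℝ)} {z : ℍ} : z ∈ closedLeftSide A ↔ side A z ≤ 0 := by
  rw [← re_inv_smul]
  have hd := den_pos A⁻¹ z
  exact ⟨fun h => mul_nonpos_of_nonpos_of_nonneg h hd.le,
    fun h => not_lt.1 fun h' => h.not_gt (mul_pos h' hd)⟩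

theorem mem_closedRightSide {A : SL(2, ℝ)} {z : ℍ} : z ∈ closedRightSide A ↔ 0 ≤ side A z := by
  rw [← re_inv_smul]
  exact (mul_nonneg_iff_of_pos_right (den_pos _ _)).symm

theorem mem_line {A : SL(2, ℝ)} {z : ℍ} : z ∈ line A ↔ side A z = 0 := by
  rw [← re_inv_smul, mul_eq_zero_iff_right (den_pos _ _).ne']
  constructor
  · rintro ⟨t, rfl⟩
    simp [axisPoint]
  · intro h
    refine ⟨Real.log (A⁻¹ • z).im, ?_⟩
    rw [axisPoint, ← eq_inv_smul_iff]
    apply UpperHalfPlane.ext_re_im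
    · simp [h]
    · simp [Real.exp_log (UpperHalfPlane.im_pos _)]

theorem ext_re_nsq {z w : ℍ} (h : z.re = w.re) (h' : nsq z = nsq w) : z = w := by
  apply UpperHalfPlane.ext_re_im h
  have := z.im_pos
  have := w.im_pos
  unfold nsq at h'
  rw [h] at h'
  exact (sq_eq_sq₀ (by positivity) (by positivity)).1 (by linarith)

/-- A point on a vertical geodesic. -/
def vpt (x y : ℝ) (hy : 0 < y) : ℍ := ⟨⟨x, y⟩, hy⟩

@[simp] theorem vpt_re (x y : ℝ) (hy : 0 < y) : (vpt x y hy).re = x := rfl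
@[simp] theorem vpt_im (x y : ℝ) (hy : 0 < y) : (vpt x y hy).im = y := rfl
@[simp] theorem vpt_nsq (x y : ℝ) (hy : 0 < y) : nsq (vpt x y hy) = x ^ 2 + y ^ 2 := rfl

theorem exists_re_nsq {x Y : ℝ} (h : x ^ 2 < Y) : ∃ z : ℍ, z.re = x ∧ nsq z = Y := by
  refine ⟨vpt x (√(Y - x ^ 2)) (Real.sqrt_pos.2 (by linarith)), rfl, ?_⟩
  rw [vpt_nsq, Real.sq_sqrt (by linarith)]; ring

theorem re_sq_lt_nsq (z : ℍ) : z.re ^ 2 < nsq z := by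
  have := z.im_pos
  unfold nsq
  nlinarith

/-! ### Geodesic segments as Euclidean segments -/

theorem dist_vertical {y w : ℝ} (hy : 0 < y) (hw : 0 < w) :
    dist (vpt 0 y hy) (vpt 0 w hw) = |Real.log y - Real.log w| := by
  rw [UpperHalfPlane.dist_of_re_eq (show (vpt 0 y hy).re = (vpt 0 w hw).re from rfl),
    Real.dist_eq]
  rfl

/-- The vertical displacement alone already accounts for the distance, and in the formula for `cosh`
of the distance the only other term is the square of the horizontal displacement. -/
theorem re_eq_of_dist_eq_log {z w : ℍ} (h : dist z w = |Real.log z.im - Real.log w.im|) :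
    z.re = w.re := by
  have hz := z.im_pos
  have hw := w.im_pos
  have h1 : dist (vpt w.re z.im hz) w = |Real.log z.im - Real.log w.im| := by
    rw [UpperHalfPlane.dist_of_re_eq (show (vpt w.re z.im hz).re = w.re from rfl), Real.dist_eq]
    rfl
  have h2 := UpperHalfPlane.cosh_dist' z w
  have h3 := UpperHalfPlane.cosh_dist' (vpt w.re z.im hz) w
  rw [h1, ← h, h2] at h3
  simp only [vpt_re, vpt_im] at h3
  have h4 : 2 * z.im * w.im ≠ 0 := by positivity
  rw [div_left_inj' h4] at h3
  have : (z.re - w.re) ^ 2 = 0 := by linarith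
  linarith [pow_eq_zero_iff (two_ne_zero) |>.1 this]

theorem abs_sub_add_abs_sub_eq_iff {a b c : ℝ} :
    |a - b| + |b - c| = |a - c| ↔ b ∈ uIcc a c := by
  rw [mem_uIcc]
  constructor
  · intro h
    by_contra! h'
    rcases abs_cases (a - b) with h1 | h1 <;> rcases abs_cases (b - c) with h2 | h2 <;>
      rcases abs_cases (a - c) with h3 | h3 <;>
      rcases le_or_gt a b with h4 | h4 <;> rcases le_or_gt c b with h5 | h5 <;>
      first
      | linarith [h'.1 (by linarith), h'.2 (by linarith)]
      | linarith [h'.1 (by linarith)]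
      | linarith [h'.2 (by linarith)]
  · rintro (h | h)
    · rw [abs_of_nonpos, abs_of_nonpos, abs_of_nonpos] <;> linarith
    · rw [abs_of_nonneg, abs_of_nonneg, abs_of_nonneg] <;> linarith

theorem log_mem_uIcc {a b c : ℝ} (ha : 0 < a) (hb : 0 < b) (hc : 0 < c) :
    Real.log b ∈ uIcc (Real.log a) (Real.log c) ↔ b ∈ uIcc a c := by
  rw [mem_uIcc, mem_uIcc, Real.log_le_log_iff ha hb, Real.log_le_log_iff hb hc,
    Real.log_le_log_iff hc hb, Real.log_le_log_iff hb ha]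

/-- Since `log im` is 1-Lipschitz, equality in the triangle inequality between two points of the
axis forces both legs to be vertical. -/
theorem mem_segment_vertical {y w : ℝ} (hy : 0 < y) (hw : 0 < w) {z : ℍ} :
    z ∈ segment (vpt 0 y hy) (vpt 0 w hw) ↔ z.re = 0 ∧ z.im ∈ uIcc y w := by
  have hz := z.im_pos
  rw [← log_mem_uIcc hy hz hw, ← abs_sub_add_abs_sub_eq_iff]
  show dist _ _ + dist _ _ = dist _ _ ↔ _
  rw [dist_vertical]
  constructor
  · intro h
    have h1 := UpperHalfPlane.dist_log_im_le (vpt 0 y hy) z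
    have h2 := UpperHalfPlane.dist_log_im_le z (vpt 0 w hw)
    rw [Real.dist_eq] at h1 h2
    simp only [vpt_im] at h1 h2
    have h3 := abs_sub_le (Real.log y) (Real.log z.im) (Real.log w)
    refine ⟨(re_eq_of_dist_eq_log (w := vpt 0 w hw) ?_), ?_⟩
    · simp only [vpt_im]; linarith
    · linarith
  · rintro ⟨h, h'⟩
    have : z = vpt 0 z.im hz := UpperHalfPlane.ext_re_im h rfl
    rw [this, dist_vertical, dist_vertical]
    simpa using h'

theorem smul_mem_segment {A : SL(2, ℝ)} {x y z : ℍ} :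
    A • z ∈ segment (A • x) (A • y) ↔ z ∈ segment x y := by
  show dist _ _ + dist _ _ = dist _ _ ↔ dist _ _ + dist _ _ = dist _ _
  simp only [dist_smul]

/-- Any two points lie on a geodesic. -/
theorem exists_line (x y : ℍ) : ∃ A : SL(2, ℝ), side A x = 0 ∧ side A y = 0 := by
  by_cases h : x.re = y.re
  · refine ⟨⟨!![1, x.re; 0, 1], by simp⟩, ?_, ?_⟩ <;> simp [side, h]
  · set c := (nsq y - nsq x) / (2 * (y.re - x.re)) with hc
    have hne : y.re - x.re ≠ 0 := sub_ne_zero.2 (Ne.symm h)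
    have hc' : 2 * c * (y.re - x.re) = nsq y - nsq x := by rw [hc]; field_simp
    set q := nsq x - 2 * c * x.re + c ^ 2 with hq
    have hq0 : 0 < q := by
      have := re_sq_lt_nsq x
      nlinarith [sq_nonneg (x.re - c)]
    have hs : √(2 * √q) ^ 2 = 2 * √q := Real.sq_sqrt (by positivity)
    have hs' : √q ^ 2 = q := Real.sq_sqrt hq0.le
    have hs0 : √(2 * √q) ≠ 0 := by positivity
    have hs1 : √q ≠ 0 := by positivity
    generalize √(2 * √q) = r at *
    generalize √q = p at *
    -- The geodesic is the semicircle with centre `c` and radius `p`; the matrix sends `∞` and `0`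
    -- to its ends `c + p` and `c - p`, and `r² = 2p` normalises the determinant.
    refine ⟨⟨!![(c + p) / r, (c - p) / r; 1 / r, 1 / r], ?_⟩, ?_, ?_⟩
    · rw [Matrix.det_fin_two_of]; field_simp; rw [hs]; ring
    all_goals
      simp only [side, Matrix.of_apply, Matrix.cons_val', Matrix.cons_val_zero,
        Matrix.cons_val_one, Matrix.cons_val_fin_one]
      field_simp
      nlinarith

theorem exists_vertical (x y : ℍ) :
    ∃ (A : SL(2, ℝ)) (s t : ℝ) (hs : 0 < s) (ht : 0 < t),
      A • vpt 0 s hs = x ∧ A • vpt 0 t ht = y := by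
  obtain ⟨A, hx, hy⟩ := exists_line x y
  rw [← mem_line] at hx hy
  obtain ⟨s, rfl⟩ := hx
  obtain ⟨t, rfl⟩ := hy
  exact ⟨A, _, _, Real.exp_pos s, Real.exp_pos t, rfl, rfl⟩

/-- A projective map with denominators `d`, `e` at the ends of a segment reparametrises it by `τ ↦ τ
e / ((1 - τ) d + τ e)`; this inverts the reparametrisation. -/
theorem exists_weight {d e θ : ℝ} (hd : 0 < d) (he : 0 < e) (h0 : 0 ≤ θ) (h1 : θ ≤ 1) :
    ∃ τ : ℝ, 0 ≤ τ ∧ τ ≤ 1 ∧ (1 - τ) * d = (1 - θ) * ((1 - τ) * d + τ * e) ∧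
      τ * e = θ * ((1 - τ) * d + τ * e) := by
  have hq : 0 < (1 - θ) * e + θ * d := by
    rcases h0.eq_or_lt with rfl | h
    · linarith
    · have := mul_pos h hd
      have := mul_nonneg (sub_nonneg.2 h1) he.le
      linarith
  have h2 : θ * d / ((1 - θ) * e + θ * d) * ((1 - θ) * e + θ * d) = θ * d :=
    div_mul_cancel₀ _ hq.ne'
  refine ⟨θ * d / ((1 - θ) * e + θ * d), by positivity, ?_, ?_, ?_⟩
  · rw [div_le_one hq]
    have := mul_nonneg (sub_nonneg.2 h1) he.le
    linarith
  · linear_combination -h2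
  · linear_combination h2

theorem exists_sq_eq {s t τ : ℝ} (hs : 0 < s) (ht : 0 < t) (h0 : 0 ≤ τ) (h1 : τ ≤ 1) :
    ∃ y : ℝ, 0 < y ∧ y ∈ uIcc s t ∧ y ^ 2 = (1 - τ) * s ^ 2 + τ * t ^ 2 := by
  have hc : Continuous fun y : ℝ => y ^ 2 := by fun_prop
  have hm : (1 - τ) * s ^ 2 + τ * t ^ 2 ∈ uIcc (s ^ 2) (t ^ 2) := by
    rw [← segment_eq_uIcc, segment_eq_image]
    exact ⟨τ, ⟨h0, h1⟩, by simp⟩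
  obtain ⟨y, hy, e⟩ := intermediate_value_uIcc hc.continuousOn hm
  refine ⟨y, ?_, hy, e⟩
  rcases mem_uIcc.1 hy with h | h <;> linarith [h.1]

/-- In the coordinates `(re, nsq)` geodesic segments are Euclidean segments. -/
theorem mem_segment_iff {x y z : ℍ} :
    z ∈ segment x y ↔ ∃ θ : ℝ, 0 ≤ θ ∧ θ ≤ 1 ∧ z.re = (1 - θ) * x.re + θ * y.re ∧
      nsq z = (1 - θ) * nsq x + θ * nsq y := by
  obtain ⟨A, s, t, hs, ht, rfl, rfl⟩ := exists_vertical x y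
  obtain ⟨z, rfl⟩ : ∃ w, z = A • w := ⟨A⁻¹ • z, by simp⟩
  rw [smul_mem_segment, mem_segment_vertical]
  obtain ⟨r1, -, n1⟩ := smul_coords A (vpt 0 s hs)
  obtain ⟨r2, -, n2⟩ := smul_coords A (vpt 0 t ht)
  have p1 := den_pos A (vpt 0 s hs)
  have p2 := den_pos A (vpt 0 t ht)
  set d1 := den A (vpt 0 s hs) with hd1
  set d2 := den A (vpt 0 t ht) with hd2
  -- On the imaginary axis the numerators and `den` are affine in `im ^ 2`, so `A` carries a convex
  -- combination there to one with weights rescaled by the denominators.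
  have key : ∀ w : ℍ, ∀ τ : ℝ, 0 ≤ τ → τ ≤ 1 → w.re = 0 →
      w.im ^ 2 = (1 - τ) * s ^ 2 + τ * t ^ 2 → 0 < (1 - τ) * d1 + τ * d2 ∧
      (A • w).re * ((1 - τ) * d1 + τ * d2) = (1 - τ) * d1 * (A • vpt 0 s hs).re
          + τ * d2 * (A • vpt 0 t ht).re ∧
      nsq (A • w) * ((1 - τ) * d1 + τ * d2) = (1 - τ) * d1 * nsq (A • vpt 0 s hs)
          + τ * d2 * nsq (A • vpt 0 t ht) := by
    intro w τ h0 h1 hw hw'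
    obtain ⟨r, -, n⟩ := smul_coords A w
    have e : den A w = (1 - τ) * d1 + τ * d2 := by
      simp only [hd1, hd2, den, vpt_im, vpt_re, nsq, hw, hw']; ring
    rw [e] at r n
    refine ⟨e ▸ den_pos A w, ?_, ?_⟩
    · rw [r]
      simp only [vpt_re, vpt_nsq] at r1 r2
      simp only [nsq, hw, hw']
      linear_combination (-(1 - τ)) * r1 - τ * r2
    · rw [n]
      simp only [vpt_re, vpt_nsq] at n1 n2
      simp only [nsq, hw, hw'] at *
      linear_combination (-(1 - τ)) * n1 - τ * n2
  constructor
  · rintro ⟨hre, him⟩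
    obtain ⟨τ, h0, h1, hτ⟩ : ∃ τ : ℝ, 0 ≤ τ ∧ τ ≤ 1 ∧
        z.im ^ 2 = (1 - τ) * s ^ 2 + τ * t ^ 2 := by
      have hz := z.im_pos
      have : z.im ^ 2 ∈ uIcc (s ^ 2) (t ^ 2) := by
        rw [mem_uIcc] at him ⊢
        rcases him with h | h
        · left; constructor <;> nlinarith
        · right; constructor <;> nlinarith
      rw [← segment_eq_uIcc, segment_eq_image] at this
      obtain ⟨τ, hτ, e⟩ := this
      exact ⟨τ, hτ.1, hτ.2, by simp only [smul_eq_mul] at e; linarith⟩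
    obtain ⟨hpos, e1, e2⟩ := key z τ h0 h1 hre hτ
    refine ⟨τ * d2 / ((1 - τ) * d1 + τ * d2), by positivity, ?_, ?_, ?_⟩
    · rw [div_le_one hpos]
      nlinarith
    · field_simp; linarith
    · field_simp; linarith
  · rintro ⟨θ, h0, h1, e1, e2⟩
    obtain ⟨τ, hτ0, hτ1, c1, c2⟩ := exists_weight p1 p2 h0 h1
    obtain ⟨y, hy, hyuIcc, hw2⟩ := exists_sq_eq hs ht hτ0 hτ1
    obtain ⟨hpos, f1, f2⟩ := key (vpt 0 y hy) τ hτ0 hτ1 rfl hw2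
    have hzw : A • z = A • vpt 0 y hy := by
      apply ext_re_nsq
      · apply mul_right_cancel₀ hpos.ne'
        rw [f1, e1]
        linear_combination (-(A • vpt 0 s hs).re) * c1 - ((A • vpt 0 t ht).re) * c2
      · apply mul_right_cancel₀ hpos.ne'
        rw [f2, e2]
        linear_combination (-nsq (A • vpt 0 s hs)) * c1 - (nsq (A • vpt 0 t ht)) * c2
    rw [smul_left_cancel A hzw]
    exact ⟨rfl, hyuIcc⟩

theorem mem_uIcc_of_abs_sub_le {a b c d : ℝ} (hb : b ∈ uIcc a d) (hc : c ∈ uIcc a d)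
    (h : |a - b| ≤ |a - c|) : b ∈ uIcc a c := by
  rw [mem_uIcc] at *
  rcases hb with hb | hb <;> rcases hc with hc | hc
  · rw [abs_of_nonpos (by linarith), abs_of_nonpos (by linarith)] at h
    left; constructor <;> linarith
  · rw [abs_of_nonpos (by linarith), abs_of_nonneg (by linarith)] at h
    left; constructor <;> linarith
  · rw [abs_of_nonneg (by linarith), abs_of_nonpos (by linarith)] at h
    right; constructor <;> linarith
  · rw [abs_of_nonneg (by linarith), abs_of_nonneg (by linarith)] at h
    right; constructor <;> linarith

/-- Turns the ordering of partition points by distance, as in `shearSums`, into an ordering along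
the segment. -/
theorem mem_segment_of_dist_le {x y z w : ℍ} (hz : z ∈ segment x y) (hw : w ∈ segment x y)
    (h : dist x z ≤ dist x w) : z ∈ segment x w := by
  obtain ⟨A, s, t, hs, ht, rfl, rfl⟩ := exists_vertical x y
  obtain ⟨z, rfl⟩ : ∃ v, z = A • v := ⟨A⁻¹ • z, by simp⟩
  obtain ⟨w, rfl⟩ : ∃ v, w = A • v := ⟨A⁻¹ • w, by simp⟩
  rw [smul_mem_segment, mem_segment_vertical] at hz hw
  rw [smul_mem_segment]
  have hz0 := z.im_pos
  have hw0 := w.im_pos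
  obtain ⟨ez, hz⟩ := hz
  obtain ⟨ew, hw⟩ := hw
  replace ez : z = vpt 0 z.im hz0 := UpperHalfPlane.ext_re_im ez rfl
  replace ew : w = vpt 0 w.im hw0 := UpperHalfPlane.ext_re_im ew rfl
  generalize z.im = y at *
  generalize w.im = v at *
  subst ez ew
  rw [dist_smul, dist_smul, dist_vertical, dist_vertical] at h
  rw [mem_segment_vertical]
  rw [← log_mem_uIcc hs hz0 ht] at hz
  rw [← log_mem_uIcc hs hw0 ht] at hw
  exact ⟨rfl, (log_mem_uIcc hs hz0 hw0).1 (mem_uIcc_of_abs_sub_le hz hw h)⟩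

/-! ### Affine isometries and their displacement -/

/-- A matrix, as an isometry of the hyperbolic plane. -/
def toPSL (P : SL(2, ℝ)) : PSL2R := ⟨MulAction.toPermHom SL(2, ℝ) ℍ P, P, rfl⟩

@[simp] theorem toPSL_smul (P : SL(2, ℝ)) (z : ℍ) : toPSL P • z = P • z := rfl

theorem exists_eq_toPSL (g : PSL2R) : ∃ P, g = toPSL P := by
  obtain ⟨g, P, rfl⟩ := g
  exact ⟨P, rfl⟩

theorem psl_ext {g h : PSL2R} (e : ∀ z : ℍ, g • z = h • z) : g = h :=
  Subtype.ext (Equiv.ext e)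

theorem toPSL_inv (P : SL(2, ℝ)) : toPSL P⁻¹ = (toPSL P)⁻¹ := by
  apply psl_ext
  intro z
  rw [eq_inv_smul_iff, toPSL_smul, toPSL_smul, smul_inv_smul]

theorem psl_dist (g : PSL2R) (z w : ℍ) : dist (g • z) (g • w) = dist z w := by
  obtain ⟨P, rfl⟩ := exists_eq_toPSL g
  simp only [toPSL_smul, dist_smul]

/-- The isometry `g` is the affine map `z ↦ k z + b`. -/
def IsAffine (g : PSL2R) (k b : ℝ) : Prop :=
  ∀ z : ℍ, (g • z).re = k * z.re + b ∧ (g • z).im = k * z.im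

namespace IsAffine

variable {g g' : PSL2R} {k k' b b' : ℝ}

theorem pos (h : IsAffine g k b) : 0 < k := by
  have := (h UpperHalfPlane.I).2
  rw [UpperHalfPlane.I_im, mul_one] at this
  exact this ▸ UpperHalfPlane.im_pos _

theorem nsq_smul (h : IsAffine g k 0) (z : ℍ) : nsq (g • z) = k ^ 2 * nsq z := by
  simp only [nsq, (h z).1, (h z).2]; ring

theorem one : IsAffine 1 1 0 := fun z => by simp

theorem mul (h : IsAffine g k b) (h' : IsAffine g' k' b') :
    IsAffine (g * g') (k * k') (k * b' + b) := fun z => by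
  rw [mul_smul, (h _).1, (h _).2, (h' z).1, (h' z).2]
  constructor <;> ring

theorem inv (h : IsAffine g k b) : IsAffine g⁻¹ k⁻¹ (-(b / k)) := fun z => by
  have hk := h.pos.ne'
  obtain ⟨w, rfl⟩ : ∃ w, z = g • w := ⟨g⁻¹ • z, by simp⟩
  rw [inv_smul_smul, (h w).1, (h w).2]
  constructor <;> field_simp
  ring

theorem uniq (h : IsAffine g k b) (h' : IsAffine g k' b') : k = k' ∧ b = b' := by
  have h1 := (h UpperHalfPlane.I)
  have h2 := (h' UpperHalfPlane.I)
  simp only [UpperHalfPlane.I_im, UpperHalfPlane.I_re] at h1 h2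
  constructor <;> linarith

theorem congr (h : IsAffine g k b) (hg : g = g') (hk : k = k') (hb : b = b') :
    IsAffine g' k' b' := by
  subst hg hk hb; exact h

theorem pow (h : IsAffine g k 0) (n : ℕ) : IsAffine (g ^ n) (k ^ n) 0 := by
  induction n with
  | zero => simpa using one
  | succ n ih => rw [pow_succ, pow_succ]; exact (ih.mul h).congr rfl rfl (by ring)

theorem zpow (h : IsAffine g k 0) (n : ℤ) : IsAffine (g ^ n) (k ^ n) 0 := by
  cases n with
  | ofNat n => simpa using h.pow n
  | negSucc n =>
    rw [zpow_negSucc, zpow_negSucc]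
    exact (h.pow _).inv.congr rfl rfl (by simp)

theorem abs_log_le_dist (h : IsAffine g k b) (z : ℍ) : |Real.log k| ≤ dist z (g • z) := by
  refine le_trans (le_of_eq ?_) (UpperHalfPlane.dist_log_im_le z (g • z))
  rw [(h z).2, Real.log_mul h.pos.ne' z.im_ne_zero, Real.dist_eq, abs_sub_comm]
  congr 1; ring

theorem dist_le (h : IsAffine g k b) (z : ℍ) :
    dist z (g • z) ≤ |Real.log k| + |(k - 1) * z.re + b| / (k * z.im) := by
  have hk := h.pos
  have hz := z.im_pos
  have hkz : 0 < k * z.im := by positivity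
  refine (dist_triangle z (vpt z.re (k * z.im) hkz) _).trans (add_le_add ?_ ?_)
  · rw [UpperHalfPlane.dist_of_re_eq (show z.re = (vpt z.re (k * z.im) hkz).re from rfl),
      vpt_im, Real.log_mul hk.ne' hz.ne', Real.dist_eq, abs_sub_comm]
    apply le_of_eq; congr 1; ring
  · refine (UpperHalfPlane.dist_le_dist_coe_div_sqrt _ _).trans (le_of_eq ?_)
    rw [vpt_im, (h z).2, Real.sqrt_mul_self hkz.le, Complex.dist_eq_re_im]
    simp only [UpperHalfPlane.coe_re, UpperHalfPlane.coe_im, vpt_re, vpt_im, (h z).1, (h z).2,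
      sub_self]
    rw [zero_pow two_ne_zero, add_zero, Real.sqrt_sq_eq_abs, abs_sub_comm]
    congr 2; ring

/-- The infimum of the displacement of `k z + b` over a set containing a vertical ray. -/
theorem iInf_dist {ι : Sort*} (h : IsAffine g k b) (f : ι → ℍ) {x y₀ : ℝ}
    (hf : ∀ y (hy : 0 < y), y₀ ≤ y → ∃ i, f i = vpt x y hy) :
    ⨅ i, dist (f i) (g • f i) = |Real.log k| := by
  have hk := h.pos
  have : Nonempty ι := by
    obtain ⟨i, -⟩ := hf (max 1 y₀) (by positivity) (le_max_right _ _)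
    exact ⟨i⟩
  refine ciInf_eq_of_forall_ge_of_forall_gt_exists_lt (fun i => h.abs_log_le_dist _) ?_
  intro w hw
  obtain ⟨ε, hε, rfl⟩ : ∃ ε > 0, w = |Real.log k| + ε := ⟨w - |Real.log k|, by linarith, by ring⟩
  set D := |(k - 1) * x + b| with hD
  have hD0 : 0 ≤ D := abs_nonneg _
  have hy : 0 < max y₀ ((D + 1) / (k * ε)) := lt_max_of_lt_right (by positivity)
  obtain ⟨i, hi⟩ := hf _ hy (le_max_left _ _)
  refine ⟨i, ?_⟩
  rw [hi]
  refine (h.dist_le _).trans_lt ?_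
  simp only [vpt_re, vpt_im]
  rw [add_lt_add_iff_left, div_lt_iff₀ (by positivity)]
  have h1 : (D + 1) / (k * ε) ≤ max y₀ ((D + 1) / (k * ε)) := le_max_right _ _
  rw [div_le_iff₀ (by positivity)] at h1
  linarith

/-- The displacement of an affine map tends to `|log k|` up any vertical ray, so a ray inside `K` is
enough, whether or not an axis exists or meets `K`. -/
theorem boundaryLength_eq {h Q : PSL2R} (H : IsAffine (Q⁻¹ * h * Q) k b) {K : Set ℍ} {x y₀ : ℝ}
    (hK : ∀ y (hy : 0 < y), y₀ ≤ y → Q • vpt x y hy ∈ K) :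
    boundaryLength K h = |Real.log k| := by
  rw [← H.iInf_dist (fun z : K => Q⁻¹ • (z : ℍ)) (x := x) (y₀ := y₀)]
  · refine iInf_congr fun z => ?_
    rw [mul_smul, mul_smul, smul_inv_smul, psl_dist]
  · intro y hy hy0
    exact ⟨⟨_, hK y hy hy0⟩, by simp⟩

theorem translationLength_eq {h Q : PSL2R} (H : IsAffine (Q⁻¹ * h * Q) k b) :
    translationLength h = |Real.log k| := by
  rw [← H.iInf_dist (fun z : ℍ => Q⁻¹ • z) (x := 0) (y₀ := 0)]
  · refine iInf_congr fun z => ?_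
    rw [mul_smul, mul_smul, smul_inv_smul, psl_dist]
  · intro y hy hy0
    exact ⟨Q • vpt 0 y hy, by simp⟩

end IsAffine

/-! ### Convex sets in the projective model and collars -/

/-- The image of a set in the coordinates `(re, nsq)`. -/
def kleinSet (H : Set ℍ) : Set (ℝ × ℝ) := (fun z : ℍ => (z.re, nsq z)) '' H

theorem continuous_nsq : Continuous nsq := by
  have h1 := UpperHalfPlane.continuous_re
  have h2 := UpperHalfPlane.continuous_im
  unfold nsq
  fun_prop

/-- The half plane becomes the convex region `x ^ 2 < Y`, in which geodesic segments are straight.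
-/
theorem convex_kleinSet {H : Set ℍ} (hH : GeodConvex H) : Convex ℝ (kleinSet H) := by
  rw [convex_iff_segment_subset]
  rintro _ ⟨x, hx, rfl⟩ _ ⟨y, hy, rfl⟩ p hp
  rw [segment_eq_image] at hp
  obtain ⟨θ, ⟨h0, h1⟩, rfl⟩ := hp
  obtain ⟨z, hz, hz'⟩ : ∃ z : ℍ, z.re = (1 - θ) * x.re + θ * y.re ∧
      nsq z = (1 - θ) * nsq x + θ * nsq y := by
    apply exists_re_nsq
    have hx := re_sq_lt_nsq x
    have hy := re_sq_lt_nsq y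
    have h2 : ((1 - θ) * x.re + θ * y.re) ^ 2 ≤ (1 - θ) * x.re ^ 2 + θ * y.re ^ 2 := by
      nlinarith [mul_nonneg (mul_nonneg h0 (sub_nonneg.2 h1)) (sq_nonneg (x.re - y.re))]
    rcases h0.eq_or_lt with rfl | h
    · nlinarith
    · have := mul_lt_mul_of_pos_left hy h
      have := mul_le_mul_of_nonneg_left hx.le (sub_nonneg.2 h1)
      linarith
  refine ⟨z, hH x hx y hy (mem_segment_iff.2 ⟨θ, h0, h1, hz, hz'⟩), ?_⟩
  simp [hz, hz']

theorem isOpen_kleinSet {H : Set ℍ} (hH : IsOpen H) : IsOpen (kleinSet H) := by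
  set U : Set (ℝ × ℝ) := {p | p.1 ^ 2 < p.2} with hU
  have hUo : IsOpen U := isOpen_lt (by fun_prop) (by fun_prop)
  let f : ℝ × ℝ → ℍ := fun p => UpperHalfPlane.ofComplex (p.1 + Complex.I * √(p.2 - p.1 ^ 2))
  have him : ∀ p ∈ U, 0 < (p.1 + Complex.I * √(p.2 - p.1 ^ 2) : ℂ).im := by
    intro p hp
    have hp' : p.1 ^ 2 < p.2 := hp
    simpa using hp'
  have hf : ContinuousOn f U := by
    intro p hp
    apply ContinuousAt.continuousWithinAt
    have h1 : ContinuousAt UpperHalfPlane.ofComplex (p.1 + Complex.I * √(p.2 - p.1 ^ 2)) := by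
      apply UpperHalfPlane.ofComplex.continuousAt
      exact ⟨⟨_, him p hp⟩, trivial, rfl⟩
    exact ContinuousAt.comp (f := fun p : ℝ × ℝ => (p.1 + Complex.I * √(p.2 - p.1 ^ 2) : ℂ)) h1
      (by fun_prop)
  have hfU : ∀ p (hp : p ∈ U), (f p).re = p.1 ∧ nsq (f p) = p.2 := by
    intro p hp
    have e : f p = ⟨_, him p hp⟩ := UpperHalfPlane.ofComplex_apply_of_im_pos _
    have hp' : 0 ≤ p.2 - p.1 ^ 2 := by
      have : p.1 ^ 2 < p.2 := hp
      linarith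
    rw [e]
    simp [nsq, UpperHalfPlane.re, UpperHalfPlane.im, Real.sq_sqrt hp']
  have : kleinSet H = U ∩ f ⁻¹' H := by
    ext p
    constructor
    · rintro ⟨z, hz, rfl⟩
      have hzU : (z.re, nsq z) ∈ U := re_sq_lt_nsq z
      have : f (z.re, nsq z) = z := ext_re_nsq (hfU _ hzU).1 (hfU _ hzU).2
      exact ⟨hzU, by rw [mem_preimage, this]; exact hz⟩
    · rintro ⟨hp, hp'⟩
      exact ⟨f p, hp', Prod.ext (hfU p hp).1 (hfU p hp).2⟩
  rw [this]
  exact hf.isOpen_inter_preimage hUo hH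

/-- An open convex set bounded by a geodesic and invariant under a translation along it contains
a collar of the geodesic. -/
theorem exists_collar {H : Set ℍ} (hne : H.Nonempty) (ho : IsOpen H) (hc : GeodConvex H)
    {σ l : ℝ} (hl : 1 < l) {g : PSL2R} (hg : IsAffine g l 0) (hgH : ∀ z, g • z ∈ H ↔ z ∈ H)
    (hside : ∀ z ∈ H, 0 < σ * z.re) (hcl : ∀ y (hy : 0 < y), vpt 0 y hy ∈ closure H) :
    ∃ δ > 0, ∀ z : ℍ, 0 < σ * z.re → z.re ^ 2 < δ * nsq z → z ∈ H := by
  obtain ⟨x, hx⟩ := hne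
  have hnx : 0 < nsq x := (sq_nonneg _).trans_lt (re_sq_lt_nsq x)
  have hxre : x.re ≠ 0 := fun h => by simpa [h] using hside x hx
  have hl0 : 0 < l := by linarith
  -- The ratio `re ^ 2 / nsq` is constant on the orbit of `x`, and consecutive orbit points have
  -- `nsq` in ratio `l ^ 2`. So a chord between two of them meets every level of `nsq` at a point
  -- whose ratio is at least this constant.
  refine ⟨x.re ^ 2 / (l ^ 2 * nsq x), by positivity, fun z hz hzδ => ?_⟩
  have hnz : 0 < nsq z := (sq_nonneg _).trans_lt (re_sq_lt_nsq z)
  obtain ⟨n, hn1, hn2⟩ := exists_mem_Ico_zpow (x := nsq z / nsq x) (y := l ^ 2) (by positivity)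
    (by nlinarith)
  have hgn : ∀ n : ℤ, g ^ n • x ∈ H := by
    have hz : ∀ (n : ℕ), ∀ w ∈ H, g ^ n • w ∈ H := by
      intro n
      induction n with
      | zero => intro w hw; simpa using hw
      | succ n ih => intro w hw; rw [pow_succ, mul_smul]; exact ih _ ((hgH w).2 hw)
    have hz' : ∀ (n : ℕ), ∀ w, g ^ n • w ∈ H → w ∈ H := by
      intro n
      induction n with
      | zero => intro w hw; simpa using hw
      | succ n ih => intro w hw; rw [pow_succ, mul_smul] at hw; exact (hgH w).1 (ih _ hw)
    intro n
    cases n with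
    | ofNat n => simpa using hz n x hx
    | negSucc n =>
      rw [zpow_negSucc]
      exact hz' (n + 1) _ (by simpa using hx)
  have hw : ∃ w ∈ H, nsq w = nsq z ∧ x.re ^ 2 / (l ^ 2 * nsq x) * nsq z ≤ w.re ^ 2 := by
    have hp : 0 < l ^ n := zpow_pos hl0 n
    have e1 := (hg.zpow n).nsq_smul x
    have e2 := ((hg.zpow n) x).1
    have hx' := hgn n
    set x' := g ^ n • x with hxdef
    rw [add_zero] at e2
    have hsq : (l ^ 2) ^ n = (l ^ n) ^ 2 := by
      rw [← zpow_natCast, ← zpow_mul, mul_comm, zpow_mul, zpow_natCast]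
    rw [zpow_add_one₀ (by positivity), hsq] at hn2
    rw [hsq] at hn1
    rw [le_div_iff₀ hnx, ← e1] at hn1
    rw [div_lt_iff₀ hnx] at hn2
    have hn2' : nsq z < l ^ 2 * nsq x' := by rw [e1]; linarith
    have hm : nsq z ∈ _root_.segment ℝ (nsq x') (nsq (g • x')) := by
      rw [hg.nsq_smul, segment_eq_Icc (hn1.trans hn2'.le)]
      exact ⟨hn1, hn2'.le⟩
    rw [segment_eq_image] at hm
    obtain ⟨θ, ⟨h0, h1⟩, hθ⟩ := hm
    have hk := convex_kleinSet hc (x := (x'.re, nsq x')) ⟨x', hx', rfl⟩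
      (y := ((g • x').re, nsq (g • x'))) ⟨_, (hgH _).2 hx', rfl⟩
      (a := 1 - θ) (b := θ) (by linarith) h0 (by ring)
    obtain ⟨w, hwH, hwe⟩ := hk
    simp only [Prod.smul_mk, Prod.mk_add_mk, Prod.mk.injEq, smul_eq_mul] at hwe hθ
    refine ⟨w, hwH, hwe.2.trans hθ, ?_⟩
    rw [hwe.1, (hg x').1]
    have hz' : nsq z ≤ l ^ 2 * (l ^ n) ^ 2 * nsq x := by linarith
    have : x.re ^ 2 / (l ^ 2 * nsq x) * nsq z ≤ x'.re ^ 2 := by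
      rw [div_mul_eq_mul_div, div_le_iff₀ (by positivity), e2]
      nlinarith [mul_le_mul_of_nonneg_left hz' (sq_nonneg x.re)]
    refine this.trans ?_
    have : (1 - θ) * x'.re + θ * (l * x'.re + 0) = (1 + θ * (l - 1)) * x'.re := by ring
    rw [this, mul_pow]
    have h3 : 1 ≤ 1 + θ * (l - 1) := by nlinarith
    nlinarith [sq_nonneg x'.re, one_le_pow₀ h3 (n := 2)]
  obtain ⟨w, hwH, hwn, hwre⟩ := hw
  have hw0 : w.re ≠ 0 := fun h => by simpa [h] using hside w hwH
  have hσw := hside w hwH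
  have hσ : σ ≠ 0 := by rintro rfl; simp at hσw
  set t := z.re / w.re with ht
  have htw : t * w.re = z.re := by rw [ht]; field_simp
  have ht0 : 0 < t := by
    have : 0 < t * (σ * w.re) := by rw [mul_left_comm, htw]; exact hz
    exact (mul_pos_iff_of_pos_right hσw).1 this
  have ht1 : t < 1 := by
    have h1 : z.re ^ 2 < w.re ^ 2 := hzδ.trans_le hwre
    rw [← htw, mul_pow] at h1
    have h2 : 0 < w.re ^ 2 := by positivity
    by_contra! h3
    nlinarith [one_le_pow₀ h3 (n := 2)]
  have hp : ((0 : ℝ), nsq z) ∈ closure (kleinSet H) := by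
    have h1 := hcl (√(nsq z)) (Real.sqrt_pos.2 hnz)
    have h2 := image_closure_subset_closure_image (f := fun z : ℍ => (z.re, nsq z))
      (s := H) (UpperHalfPlane.continuous_re.prodMk continuous_nsq) (mem_image_of_mem _ h1)
    simpa [Real.sq_sqrt hnz.le, kleinSet] using h2
  have hq : (w.re, nsq z) ∈ interior (kleinSet H) := by
    rw [(isOpen_kleinSet ho).interior_eq]
    exact ⟨w, hwH, Prod.ext rfl hwn⟩
  -- At the level `nsq z`, the point `z` lies strictly between a point of the axis, in the closure,
  -- and the interior point `w`.
  have := (convex_kleinSet hc).combo_closure_interior_mem_interior hp hq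
    (a := 1 - t) (b := t) (by linarith) ht0 (by ring)
  have := interior_subset this
  obtain ⟨v, hv, hve⟩ := this
  simp only [Prod.smul_mk, Prod.mk_add_mk, Prod.mk.injEq, smul_eq_mul] at hve
  have : z = v := ext_re_nsq (by rw [hve.1, ← htw]; ring) (by rw [hve.2]; ring)
  rwa [this]

/-! ### Translations comparing sets that contain vertical rays -/

theorem translatesAlong_iff {g : PSL2R} {C : SL(2, ℝ)} {s : ℝ} :
    TranslatesAlong g C s ↔ IsAffine ((toPSL C)⁻¹ * g * toPSL C) (Real.exp s) 0 := by
  have e : ∀ z : ℍ, ((toPSL C)⁻¹ * g * toPSL C) • z = C⁻¹ • (g • (C • z)) := fun z => by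
    rw [mul_smul, mul_smul, ← toPSL_inv]; rfl
  refine forall_congr' fun z => ?_
  rw [e, Complex.ext_iff]
  simp [Complex.exp_ofReal_re]

/-- Two isometries that agree on a vertical ray are equal. -/
theorem psl_eq_of_ray {p q : PSL2R} {x y₀ : ℝ}
    (h : ∀ y (hy : 0 < y), y₀ ≤ y → p • vpt x y hy = q • vpt x y hy) : p = q := by
  obtain ⟨M, hM⟩ := exists_eq_toPSL (q⁻¹ * p)
  have hfix : ∀ y (hy : 0 < y), y₀ ≤ y → M • vpt x y hy = vpt x y hy := by
    intro y hy hy0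
    rw [← toPSL_smul, ← hM, mul_smul, h y hy hy0, inv_smul_smul]
  set Y := max 1 y₀ with hY
  have hY1 : 1 ≤ Y := le_max_left _ _
  have hY0 : y₀ ≤ Y := le_max_right _ _
  have a1 : 0 < Y := by linarith
  have a2 : 0 < Y + 1 := by linarith
  have e1 := hfix Y a1 hY0
  have e2 := hfix (Y + 1) a2 (by linarith)
  obtain ⟨r1, i1, -⟩ := smul_coords M (vpt x Y a1)
  obtain ⟨r2, i2, -⟩ := smul_coords M (vpt x (Y + 1) a2)
  have hd := det_eq_one M
  rw [e1] at r1 i1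
  rw [e2] at r2 i2
  have d1 : den M (vpt x Y a1) = 1 := by
    simp only [vpt_im] at i1
    exact mul_left_cancel₀ a1.ne' (by rw [i1, mul_one])
  have d2 : den M (vpt x (Y + 1) a2) = 1 := by
    simp only [vpt_im] at i2
    exact mul_left_cancel₀ a2.ne' (by rw [i2, mul_one])
  rw [d1] at r1
  rw [d2] at r2
  simp only [den, vpt_nsq, vpt_re] at r1 r2 d1 d2
  have hc : M 1 0 = 0 := by
    have : M 1 0 ^ 2 * (2 * Y + 1) = 0 := by linear_combination d2 - d1
    rcases mul_eq_zero.1 this with h | h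
    · exact pow_eq_zero_iff two_ne_zero |>.1 h
    · linarith
  have hone : q⁻¹ * p = 1 := by
    apply psl_ext
    intro z
    rw [hM, toPSL_smul, one_smul]
    obtain ⟨r, i, -⟩ := smul_coords M z
    rw [hc] at hd r1 d1
    have hdz : den M z = 1 := by
      unfold den; rw [hc]; linear_combination d1
    rw [hdz, hc] at r
    rw [hdz] at i
    have hb : M 0 1 * M 1 1 = 0 := by linear_combination (-1 : ℝ) * r1 - x * hd
    apply UpperHalfPlane.ext_re_im
    · linear_combination r + z.re * hd + hb
    · linarith
  rw [← mul_one q, ← hone, mul_inv_cancel_left]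

theorem nonpos_of_forall_le_sub {p q y₀ : ℝ} (h : ∀ y, 0 < y → y₀ ≤ y → 0 ≤ p - q * y ^ 2) :
    q ≤ 0 := by
  by_contra! hq
  set y := max y₀ (|p| / q + 1) with hy
  have h1 : |p| / q + 1 ≤ y := le_max_right _ _
  have h2 : 0 ≤ |p| / q := by positivity
  have h3 := h y (by linarith) (le_max_left _ _)
  have h4 : |p| < q * y := by
    have : |p| / q < y := by linarith
    rwa [div_lt_iff₀ hq, mul_comm] at this
  have h5 : q * y ≤ q * y ^ 2 := by
    apply mul_le_mul_of_nonneg_left _ hq.le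
    nlinarith
  linarith [le_abs_self p]

/-- The defining function of a geodesic has the form `β re - α nsq - c`, whose end points are the
roots of `α x² - β x + c`; the discriminant is normalised to `1`. In particular `β ≠ 0` when an end
is at `∞` (`α = 0`) or at `0` (`c = 0`). -/
theorem side_discr (A : SL(2, ℝ)) :
    (A 0 0 * A 1 1 + A 0 1 * A 1 0) ^ 2 = 1 + 4 * (A 1 0 * A 1 1) * (A 0 0 * A 0 1) := by
  have := det_eq_one A
  linear_combination (A 0 0 * A 1 1 - A 0 1 * A 1 0 + 1) * this

/-- A translation to the right between two sets containing vertical rays has a vertical axis. -/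
theorem TranslatesRight.isAffine {q : PSL2R} {F F' : Set ℍ} (h : TranslatesRight q F F')
    {t t' y₀ y₀' : ℝ} (ht : t < t') (hF : ∀ y (hy : 0 < y), y₀ ≤ y → vpt t y hy ∈ F)
    (hF' : ∀ y (hy : 0 < y), y₀' ≤ y → vpt t' y hy ∈ F') :
    ∃ s d : ℝ, 0 ≤ s ∧ t ≤ d ∧ d ≤ t' ∧
      IsAffine q (Real.exp (-s)) (d * (1 - Real.exp (-s))) := by
  obtain ⟨C, s, hs, hq, h1, h2⟩ := h
  have e1 : ∀ y, 0 < y → y₀ ≤ y → 0 ≤ ((C 0 0 * C 1 1 + C 0 1 * C 1 0) * t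
      - C 1 0 * C 1 1 * t ^ 2 - C 0 0 * C 0 1) - C 1 0 * C 1 1 * y ^ 2 := by
    intro y hy hy0
    have := mem_closedRightSide.1 (h1 (hF y hy hy0))
    simp only [side, vpt_re, vpt_nsq] at this
    linarith
  have e2 : ∀ y, 0 < y → y₀' ≤ y → 0 ≤ -((C 0 0 * C 1 1 + C 0 1 * C 1 0) * t'
      - C 1 0 * C 1 1 * t' ^ 2 - C 0 0 * C 0 1) - -(C 1 0 * C 1 1) * y ^ 2 := by
    intro y hy hy0
    have := mem_closedLeftSide.1 (h2 (hF' y hy hy0))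
    simp only [side, vpt_re, vpt_nsq] at this
    linarith
  -- The sign of the defining function high up the first ray gives `≤ 0`, and on the second ray `≥
  -- 0`: a geodesic weakly separating two rays to `∞` ends at `∞`.
  have hcd : C 1 0 * C 1 1 = 0 := by
    have := nonpos_of_forall_le_sub e1
    have := nonpos_of_forall_le_sub e2
    linarith
  have hdet := det_eq_one C
  have f1 := e1 (max 1 y₀) (by positivity) (le_max_right _ _)
  have f2 := e2 (max 1 y₀') (by positivity) (le_max_right _ _)
  rw [hcd] at f1 f2
  simp only [zero_mul, sub_zero, neg_zero] at f1 f2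
  -- If `C 1 0 = 0` the axis points upwards and has `t` on its right and `t'` on its left, against
  -- `t < t'`. So it points downwards.
  have hd : C 1 1 = 0 := by
    rcases mul_eq_zero.1 hcd with hc | hd
    · rw [hc] at f1 f2 hdet
      simp only [mul_zero, add_zero, sub_zero] at f1 f2 hdet
      rw [hdet] at f1 f2
      linarith
    · exact hd
  have hbc : C 0 1 * C 1 0 = -1 := by rw [hd] at hdet; linarith
  have hc0 : C 1 0 ≠ 0 := by rintro h; simp [h] at hbc
  rw [hd, hbc] at f1 f2
  have hb : C 0 1 = -1 / C 1 0 := by field_simp; linarith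
  -- The foot of the axis is `C 0 0 / C 1 0`, which is this product because `C 0 1 * C 1 0 = -1`.
  refine ⟨s, -(C 0 0 * C 0 1), hs.le, by linarith, by linarith, fun w => ?_⟩
  rw [translatesAlong_iff] at hq
  obtain ⟨z, rfl⟩ : ∃ z, w = C • z := ⟨C⁻¹ • w, by simp⟩
  obtain ⟨r, i⟩ := hq z
  set z' := ((toPSL C)⁻¹ * q * toPSL C) • z with hz'
  have ez' : q • (C • z) = C • z' := by
    rw [hz', mul_smul, mul_smul, ← toPSL_smul, ← toPSL_smul, smul_inv_smul]
  rw [ez']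
  obtain ⟨r1, i1, -⟩ := smul_coords C z
  obtain ⟨r2, i2, -⟩ := smul_coords C z'
  have hn : 0 < nsq z := (sq_nonneg _).trans_lt (re_sq_lt_nsq z)
  have hexp : Real.exp (-s) * Real.exp s = 1 := by rw [← Real.exp_add]; simp
  have hE := Real.exp_pos s
  have hn' : nsq z' = Real.exp s ^ 2 * nsq z := by simp only [nsq, r, i]; ring
  have dz : den C z = C 1 0 ^ 2 * nsq z := by simp [den, hd]
  have dz' : den C z' = C 1 0 ^ 2 * (Real.exp s ^ 2 * nsq z) := by simp [den, hd, hn']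
  rw [dz] at r1 i1
  rw [dz'] at r2 i2
  rw [hn', r, hd, hbc] at r2
  rw [i] at i2
  rw [hd, hbc] at r1
  have hne : C 1 0 ^ 2 * (Real.exp s ^ 2 * nsq z) ≠ 0 := by positivity
  constructor
  · apply mul_right_cancel₀ hne
    rw [r2]
    linear_combination (-(Real.exp (-s) * Real.exp s ^ 2)) * r1 + Real.exp s * z.re * hexp
      + (C 0 0 * C 1 0 * Real.exp s ^ 2 * nsq z * (1 - Real.exp (-s))) * hbc
  · apply mul_right_cancel₀ hne
    rw [i2]
    linear_combination (-(Real.exp (-s) * Real.exp s ^ 2)) * i1 - Real.exp s * z.im * hexp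

/-! ### Strata and holonomy in a collar with vertical leaves -/

/-- A collar of the imaginary axis, on the side where `z ↦ κ z` decreases the real part. -/
def collar (κ δ : ℝ) : Set ℍ := {z | κ * z.re < z.re ∧ z.re ^ 2 < δ * nsq z}

/-- The strata of an earthquake near a boundary geodesic, in coordinates in which that geodesic
is the imaginary axis, its holonomy is `z ↦ κ z` and the leaves near it are vertical. -/
structure CollarModel (κ δ : ℝ) (H : Set ℍ) (St : Set (Set ℍ)) (A : Set ℍ → PSL2R)
    (g h : PSL2R) : Prop where
  ne_one : κ ≠ 1
  δ_pos : 0 < δ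
  isAffine : IsAffine g κ 0
  side : ∀ z ∈ H, κ * z.re < z.re
  collar_subset : collar κ δ ⊆ H
  cover : ∀ z ∈ H, ∃ F ∈ St, z ∈ F
  disjoint : ∀ F ∈ St, ∀ F' ∈ St, ∀ z ∈ F, z ∈ F' → F = F'
  subset : ∀ F ∈ St, F ⊆ H
  ray : ∀ F ∈ St, ∀ z ∈ F, z ∈ collar κ δ → ∀ w : ℍ, w.re = z.re → z.im ≤ w.im → w ∈ F
  smul_mem : ∀ F ∈ St, g • F ∈ St
  inv_smul_mem : ∀ F ∈ St, g⁻¹ • F ∈ St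
  comparison : ∀ F ∈ St, ∀ F' ∈ St, F ≠ F' →
    TranslatesRight ((A F)⁻¹ * A F') F F' ∨ A F = A F'
  equivariant : ∀ F ∈ St, ∀ x ∈ F, A (g • F) • (g • x) = h • (A F • x)

namespace CollarModel

variable {κ δ : ℝ} {H : Set ℍ} {St : Set (Set ℍ)} {A : Set ℍ → PSL2R} {g h : PSL2R}

theorem ray_vpt (M : CollarModel κ δ H St A g h) {F : Set ℍ} (hF : F ∈ St) {z : ℍ} (hz : z ∈ F)
    (hzN : z ∈ collar κ δ) (y : ℝ) (hy : 0 < y) (h : z.im ≤ y) : vpt z.re y hy ∈ F :=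
  M.ray F hF z hz hzN _ rfl h

theorem smul_mem_collar (M : CollarModel κ δ H St A g h) {z : ℍ} (hz : z ∈ collar κ δ) :
    g • z ∈ collar κ δ := by
  have hκ := M.isAffine.pos
  refine ⟨?_, ?_⟩
  · rw [(M.isAffine z).1, add_zero]
    exact mul_lt_mul_of_pos_left hz.1 hκ
  · rw [(M.isAffine z).1, M.isAffine.nsq_smul, add_zero, mul_pow, mul_left_comm]
    exact mul_lt_mul_of_pos_left hz.2 (by positivity)

/-- The upward rays make the axis vertical, and rightward motion seen from the left stratum is
downward, so the factor is at most `1`. Strata at the same abscissa share a ray and coincide. -/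
theorem comparison_affine (M : CollarModel κ δ H St A g h) {F F' : Set ℍ} (hF : F ∈ St)
    (hF' : F' ∈ St) {z z' : ℍ} (hz : z ∈ F) (hzN : z ∈ collar κ δ) (hz' : z' ∈ F')
    (hzN' : z' ∈ collar κ δ) (hre : z.re ≤ z'.re) :
    ∃ s d : ℝ, 0 ≤ s ∧ z.re ≤ d ∧ d ≤ z'.re ∧
      IsAffine ((A F)⁻¹ * A F') (Real.exp (-s)) (d * (1 - Real.exp (-s))) := by
  by_cases hA : A F = A F'
  · refine ⟨0, z.re, le_rfl, le_rfl, hre, ?_⟩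
    rw [hA, inv_mul_cancel]
    exact IsAffine.one.congr rfl (by simp) (by simp)
  have hne : F ≠ F' := fun e => hA (by rw [e])
  rcases hre.eq_or_lt with e | hlt
  · exfalso
    have hp : 0 < max z.im z'.im := lt_max_of_lt_left z.im_pos
    have h1 := M.ray_vpt hF hz hzN _ hp (le_max_left _ _)
    have h2 := M.ray_vpt hF' hz' hzN' _ hp (le_max_right _ _)
    rw [← e] at h2
    exact hne (M.disjoint F hF F' hF' _ h1 h2)
  · rcases M.comparison F hF F' hF' hne with hT | hT
    · exact hT.isAffine hlt (M.ray_vpt hF hz hzN) (M.ray_vpt hF' hz' hzN')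
    · exact absurd hT hA

theorem exists_affine (M : CollarModel κ δ H St A g h) {F F' : Set ℍ} (hF : F ∈ St)
    (hF' : F' ∈ St) {z z' : ℍ} (hz : z ∈ F) (hzN : z ∈ collar κ δ) (hz' : z' ∈ F')
    (hzN' : z' ∈ collar κ δ) : ∃ k b, IsAffine ((A F)⁻¹ * A F') k b := by
  rcases le_total z.re z'.re with e | e
  · obtain ⟨s, d, -, -, -, h⟩ := M.comparison_affine hF hF' hz hzN hz' hzN' e
    exact ⟨_, _, h⟩
  · obtain ⟨s, d, -, -, -, h⟩ := M.comparison_affine hF' hF hz' hzN' hz hzN e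
    exact ⟨_, _, h.inv.congr (by group) rfl rfl⟩

/-- Equivariance is known only on points of `F`, but a stratum in the collar contains a ray, which
determines an isometry. -/
theorem smul_mul (M : CollarModel κ δ H St A g h) {F : Set ℍ} (hF : F ∈ St) {z : ℍ} (hz : z ∈ F)
    (hzN : z ∈ collar κ δ) : A (g • F) * g = h * A F := by
  apply psl_eq_of_ray (x := z.re) (y₀ := z.im)
  intro y hy hy0
  rw [mul_smul, mul_smul]
  exact M.equivariant F hF _ (M.ray_vpt hF hz hzN y hy hy0)

theorem conj_eq (M : CollarModel κ δ H St A g h) {F : Set ℍ} (hF : F ∈ St) {z : ℍ} (hz : z ∈ F)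
    (hzN : z ∈ collar κ δ) : (A F)⁻¹ * h * A F = (A F)⁻¹ * A (g • F) * g := by
  rw [mul_assoc, mul_assoc, M.smul_mul hF hz hzN]

/-- As `g` moves the collar to the left, the contraction goes from `g • F` to `F`. Its inverse
appears in `conj_eq`, and so the shear enlarges the factor of the holonomy. -/
theorem exists_conj_affine (M : CollarModel κ δ H St A g h) {F : Set ℍ} (hF : F ∈ St) {z : ℍ}
    (hz : z ∈ F) (hzN : z ∈ collar κ δ) :
    ∃ m b, 0 ≤ m ∧ IsAffine ((A F)⁻¹ * h * A F) (κ * Real.exp m) b := by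
  have hgz : g • z ∈ g • F := smul_mem_smul_set hz
  obtain ⟨s, d, hs, -, -, ha⟩ := M.comparison_affine (M.smul_mem F hF) hF hgz
    (M.smul_mem_collar hzN) hz hzN (by rw [(M.isAffine z).1, add_zero]; exact hzN.1.le)
  rw [M.conj_eq hF hz hzN]
  refine ⟨s, _, hs, (ha.inv.mul M.isAffine).congr (by group) ?_ rfl⟩
  rw [Real.exp_neg, inv_inv, mul_comm]

theorem exists_mem_collar (M : CollarModel κ δ H St A g h) : ∃ z, z ∈ collar κ δ := by
  have hδ := M.δ_pos
  have h1 : 1 - κ ≠ 0 := sub_ne_zero.2 (Ne.symm M.ne_one)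
  have h2 : 0 < (1 - κ) ^ 2 := by positivity
  refine ⟨vpt (1 - κ) (√((1 - κ) ^ 2 / δ)) (Real.sqrt_pos.2 (by positivity)), ?_, ?_⟩
  · rw [vpt_re]; nlinarith
  · rw [vpt_re, vpt_nsq, Real.sq_sqrt (by positivity), mul_add, mul_div_cancel₀ _ hδ.ne']
    nlinarith

/-- The shear around the boundary component. -/
theorem exists_mass (M : CollarModel κ δ H St A g h) :
    ∃ m, 0 ≤ m ∧ ∀ F ∈ St, ∀ z ∈ F, z ∈ collar κ δ →
      ∃ b, IsAffine ((A F)⁻¹ * h * A F) (κ * Real.exp m) b := by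
  obtain ⟨z₀, hz₀⟩ := M.exists_mem_collar
  obtain ⟨F₀, hF₀, hzF₀⟩ := M.cover _ (M.collar_subset hz₀)
  obtain ⟨m, b, hm, ha⟩ := M.exists_conj_affine hF₀ hzF₀ hz₀
  refine ⟨m, hm, fun F hF z hz hzN => ?_⟩
  -- Strata in the collar differ by affine maps, and conjugation by an affine map preserves the
  -- dilation factor.
  obtain ⟨k, c, hk⟩ := M.exists_affine hF₀ hF hzF₀ hz₀ hz hzN
  refine ⟨_, ((hk.inv.mul ha).mul hk).congr (by group) ?_ rfl⟩
  have := hk.pos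
  field_simp

/-- Along the segment `re` scales by the mean of `1` and `κ`, while `nsq` scales by the mean of
their squares, which is at least the square of the mean. -/
theorem segment_subset_collar (M : CollarModel κ δ H St A g h) {x z : ℍ} (hx : x ∈ collar κ δ)
    (hz : z ∈ segment x (g • x)) : z ∈ collar κ δ ∧ z.re ≤ x.re := by
  obtain ⟨θ, h0, h1, e1, e2⟩ := mem_segment_iff.1 hz
  have hκ := M.isAffine.pos
  rw [(M.isAffine x).1, add_zero] at e1
  rw [M.isAffine.nsq_smul] at e2
  have hp : 0 < 1 - θ + θ * κ := by
    rcases h0.eq_or_lt with rfl | h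
    · linarith
    · have := mul_pos h hκ
      linarith
  have e1' : z.re = (1 - θ + θ * κ) * x.re := by rw [e1]; ring
  have e2' : nsq z = (1 - θ + θ * κ ^ 2) * nsq x := by rw [e2]; ring
  refine ⟨⟨?_, ?_⟩, ?_⟩
  · rw [e1', mul_left_comm]
    exact mul_lt_mul_of_pos_left hx.1 hp
  · rw [e1', e2', mul_pow]
    have h2 : (1 - θ + θ * κ) ^ 2 ≤ 1 - θ + θ * κ ^ 2 := by
      nlinarith [mul_nonneg (mul_nonneg h0 (sub_nonneg.2 h1)) (sq_nonneg (1 - κ))]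
    have h3 : 0 < (1 - θ + θ * κ) ^ 2 := by positivity
    calc (1 - θ + θ * κ) ^ 2 * x.re ^ 2 < (1 - θ + θ * κ) ^ 2 * (δ * nsq x) :=
          mul_lt_mul_of_pos_left hx.2 h3
      _ ≤ (1 - θ + θ * κ ^ 2) * (δ * nsq x) :=
          mul_le_mul_of_nonneg_right h2 ((sq_nonneg _).trans hx.2.le)
      _ = _ := by ring
  · rw [e1]
    nlinarith [hx.1]

/-- The sum of the translation lengths of the comparison isometries along any partition of the
segment from `x` to `g x`. -/
theorem sum_translationLength (M : CollarModel κ δ H St A g h) {m : ℝ}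
    (hm : ∀ F ∈ St, ∀ z ∈ F, z ∈ collar κ δ →
      ∃ b, IsAffine ((A F)⁻¹ * h * A F) (κ * Real.exp m) b)
    {x : ℍ} (hx : x ∈ collar κ δ) {k : ℕ} {p : ℕ → ℍ} {F : ℕ → Set ℍ} (hp0 : p 0 = x)
    (hpk : p k = g • x) (hp : ∀ i ≤ k, p i ∈ segment x (g • x) ∧ F i ∈ St ∧ p i ∈ F i)
    (hd : ∀ i < k, dist x (p i) ≤ dist x (p (i + 1))) :
    ∑ i ∈ Finset.range k, translationLength ((A (F i))⁻¹ * A (F (i + 1))) = m := by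
  have hN : ∀ i ≤ k, p i ∈ collar κ δ := fun i hi => (M.segment_subset_collar hx (hp i hi).1).1
  have hmono : ∀ i < k, (p (i + 1)).re ≤ (p i).re := by
    intro i hi
    obtain ⟨θ, h0, h1, e, -⟩ := mem_segment_iff.1
      (mem_segment_of_dist_le (hp i hi.le).1 (hp (i + 1) hi).1 (hd i hi))
    have := (M.segment_subset_collar hx (hp (i + 1) hi).1).2
    rw [e]
    nlinarith
  have hstep : ∀ i < k, ∃ b, IsAffine ((A (F i))⁻¹ * A (F (i + 1)))
      (Real.exp (translationLength ((A (F i))⁻¹ * A (F (i + 1))))) b := by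
    intro i hi
    obtain ⟨s, d, hs, -, -, ha⟩ := M.comparison_affine (hp (i + 1) hi).2.1 (hp i hi.le).2.1
      (hp (i + 1) hi).2.2 (hN _ hi) (hp i hi.le).2.2 (hN _ hi.le) (hmono i hi)
    have hb := ha.inv
    rw [Real.exp_neg, inv_inv, mul_inv_rev, inv_inv] at hb
    have : translationLength ((A (F i))⁻¹ * A (F (i + 1))) = s := by
      rw [IsAffine.translationLength_eq (Q := 1) (hb.congr (by group) rfl rfl), Real.log_exp,
        abs_of_nonneg hs]
    rw [this]
    exact ⟨_, hb⟩
  -- The partition runs leftwards, so every step has factor `exp` of its translation length. The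
  -- product telescopes to the comparison of the end strata, which does not depend on the partition.
  have hsum : ∀ j ≤ k, ∃ b, IsAffine ((A (F 0))⁻¹ * A (F j))
      (Real.exp (∑ i ∈ Finset.range j, translationLength ((A (F i))⁻¹ * A (F (i + 1))))) b := by
    intro j
    induction j with
    | zero => intro _; exact ⟨0, IsAffine.one.congr (by group) (by simp) rfl⟩
    | succ j ih =>
      intro hj
      obtain ⟨b, hb⟩ := ih (by omega)
      obtain ⟨c, hc⟩ := hstep j hj
      refine ⟨_, (hb.mul hc).congr (by group) ?_ rfl⟩
      rw [Finset.sum_range_succ, Real.exp_add]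
  obtain ⟨b, hb⟩ := hsum k le_rfl
  have h0 := hp 0 (Nat.zero_le k)
  have hk := hp k le_rfl
  rw [hp0] at h0
  rw [hpk] at hk
  have hFk : F k = g • F 0 :=
    M.disjoint _ hk.2.1 _ (M.smul_mem _ h0.2.1) _ hk.2.2 (smul_mem_smul_set h0.2.2)
  obtain ⟨c, hc⟩ := hm _ h0.2.1 _ h0.2.2 hx
  rw [M.conj_eq h0.2.1 h0.2.2 hx, ← hFk] at hc
  have := ((hb.mul M.isAffine).uniq hc).1
  rw [mul_comm] at this
  exact Real.exp_injective (mul_left_cancel₀ M.isAffine.pos.ne' this)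

end CollarModel

/-! ### Vertical leaves as barriers -/

/-- The vertical geodesic with abscissa `v`. -/
def vline (v : ℝ) : Set ℍ := {z | z.re = v}

@[simp] theorem mem_vline {v : ℝ} {z : ℍ} : z ∈ vline v ↔ z.re = v := Iff.rfl

theorem IsAffine.smul_vline {g : PSL2R} {k b : ℝ} (h : IsAffine g k b) (v : ℝ) :
    g • vline v = vline (k * v + b) := by
  have hk := h.pos.ne'
  ext z
  rw [mem_smul_set_iff_inv_smul_mem, mem_vline, mem_vline, (h.inv z).1]
  constructor
  · intro e
    rw [← e]; field_simp; ring
  · intro e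
    rw [e]; field_simp; ring

theorem TranslatesAlong.smul_mem_closedLeftSide {q : PSL2R} {C : SL(2, ℝ)} {s : ℝ}
    (h : TranslatesAlong q C s) {z : ℍ} (hz : z ∈ closedLeftSide C) :
    q • z ∈ closedLeftSide C := by
  rw [translatesAlong_iff] at h
  have := (h (C⁻¹ • z)).1
  rw [mul_smul, mul_smul, ← toPSL_inv, toPSL_smul, toPSL_smul, smul_inv_smul, add_zero] at this
  show (C⁻¹ • (q • z)).re ≤ 0
  rw [this]
  exact mul_nonpos_of_nonneg_of_nonpos (Real.exp_pos s).le hz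

/-- A translation to the right as seen from a vertical geodesic does not move points across that
geodesic. -/
theorem TranslatesRight.mul_nonneg {q : PSL2R} {v : ℝ} {F : Set ℍ}
    (h : TranslatesRight q (vline v) F) {z : ℍ} (hz : z ∈ F) (hzv : z.re ≠ v) :
    0 ≤ (z.re - v) * ((q • z).re - v) := by
  obtain ⟨D, s, -, hq, h1, h2⟩ := h
  -- Otherwise the segment from `z` to `q • z`, inside the closed left side of the axis, would cross
  -- the vertical geodesic, which is in the closed right side. The axis would then touch the
  -- vertical geodesic without crossing it, hence equal it, and `z` would lie on it.
  by_contra! hneg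
  have hw := mem_closedLeftSide.1 (hq.smul_mem_closedLeftSide (h2 hz))
  replace hz := mem_closedLeftSide.1 (h2 hz)
  set w := q • z
  obtain ⟨θ, h0, h1', hθ⟩ : ∃ θ : ℝ, 0 < θ ∧ θ < 1 ∧ v = (1 - θ) * z.re + θ * w.re := by
    have hne : w.re - z.re ≠ 0 := by
      intro e
      have : w.re = z.re := by linarith
      rw [this] at hneg
      nlinarith [sq_nonneg (z.re - v)]
    have h4 : 0 < (w.re - z.re) ^ 2 := by positivity
    refine ⟨(v - z.re) / (w.re - z.re), ?_, ?_, by field_simp; ring⟩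
    · rw [← mul_div_mul_right _ _ hne, ← sq]
      apply div_pos _ h4
      nlinarith [sq_nonneg (z.re - v)]
    · rw [← mul_div_mul_right _ _ hne, ← sq, div_lt_one h4]
      nlinarith [sq_nonneg (w.re - v)]
  set Y := (1 - θ) * nsq z + θ * nsq w with hY
  have hvY : v ^ 2 < Y := by
    have hz := re_sq_lt_nsq z
    have hw := re_sq_lt_nsq w
    have h3 : v ^ 2 ≤ (1 - θ) * z.re ^ 2 + θ * w.re ^ 2 := by
      rw [hθ]
      nlinarith [_root_.mul_nonneg (_root_.mul_nonneg h0.le (sub_nonneg.2 h1'.le))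
        (sq_nonneg (z.re - w.re))]
    have := mul_lt_mul_of_pos_left hw h0
    have := mul_lt_mul_of_pos_left hz (sub_pos.2 h1')
    linarith
  have hside : ∀ Y', v ^ 2 < Y' → 0 ≤ (D 0 0 * D 1 1 + D 0 1 * D 1 0) * v
      - D 1 0 * D 1 1 * Y' - D 0 0 * D 0 1 := by
    intro Y' hY'
    obtain ⟨u, hu, hu'⟩ := exists_re_nsq hY'
    have := mem_closedRightSide.1 (h1 (show u ∈ vline v from hu))
    rwa [side, hu, hu'] at this
  have hzero := hside Y hvY
  have hlin : (D 0 0 * D 1 1 + D 0 1 * D 1 0) * v - D 1 0 * D 1 1 * Y - D 0 0 * D 0 1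
      = (1 - θ) * side D z + θ * side D w := by
    rw [hθ, hY]; unfold side; ring
  have hz0 : side D z = 0 := by nlinarith
  have hw0 : side D w = 0 := by nlinarith
  rw [hz0, hw0, mul_zero, mul_zero, add_zero] at hlin
  have hα : D 1 0 * D 1 1 = 0 := by
    have h5 := hside ((v ^ 2 + Y) / 2) (by linarith)
    have h6 := hside (Y + 1) (by linarith)
    have h7 : 0 < Y - v ^ 2 := by linarith
    have h8 : D 1 0 * D 1 1 ≤ 0 := by linarith
    have h9 : 0 ≤ D 1 0 * D 1 1 * (Y - v ^ 2) := by linarith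
    have h10 : 0 ≤ D 1 0 * D 1 1 := (mul_nonneg_iff_of_pos_right h7).1 h9
    linarith
  have hβ := side_discr D
  unfold side at hz0
  rw [hα] at hβ hlin hz0
  have hβ0 : D 0 0 * D 1 1 + D 0 1 * D 1 0 ≠ 0 := by
    intro e; rw [e] at hβ; norm_num at hβ
  apply hzv
  apply mul_left_cancel₀ hβ0
  linarith

/-- The translates of a vertical leaf by the holonomy cut the half plane into strips, uniformly in
the two cases `κ < 1` and `κ > 1`. -/
theorem exists_zpow_strip {κ v x : ℝ} (hκ : 0 < κ) (hκ1 : κ ≠ 1) (hv : κ * v < v)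
    (hx : κ * x < x) : ∃ n : ℤ, κ ^ (n + 1) * v ≤ x ∧ x < κ ^ n * v := by
  rcases lt_or_gt_of_ne hκ1 with h | h
  · have hv0 : 0 < v := by nlinarith
    have hx0 : 0 < x := by nlinarith
    obtain ⟨j, hj1, hj2⟩ := exists_mem_Ico_zpow (x := x / v) (y := κ⁻¹) (by positivity)
      (one_lt_inv_iff₀.2 ⟨hκ, h⟩)
    rw [le_div_iff₀ hv0, inv_zpow'] at hj1
    rw [div_lt_iff₀ hv0, inv_zpow'] at hj2
    -- With base `κ⁻¹ > 1` the powers increase in the opposite order, so the upper end of the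
    -- interval becomes the `n`-th translate.
    refine ⟨-(j + 1), ?_, hj2⟩
    rwa [show -(j + 1) + 1 = -j by ring]
  · have hv0 : v < 0 := by nlinarith
    have hx0 : x < 0 := by nlinarith
    obtain ⟨j, hj1, hj2⟩ := exists_mem_Ioc_zpow (x := x / v) (y := κ)
      (div_pos_of_neg_of_neg hx0 hv0) h
    rw [lt_div_iff_of_neg hv0] at hj1
    rw [div_le_iff_of_neg hv0] at hj2
    exact ⟨j, hj2, hj1⟩

theorem exists_vpt_mem_collar {κ δ v : ℝ} (hδ : 0 < δ) (hv : κ * v < v) :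
    ∃ y₀ > 0, ∀ y (hy : 0 < y), y₀ ≤ y → vpt v y hy ∈ collar κ δ := by
  refine ⟨|v| / √δ + 1, by positivity, fun y hy hy0 => ⟨hv, ?_⟩⟩
  have hs := Real.sqrt_pos.2 hδ
  have h1 : |v| / √δ < y := by linarith
  rw [div_lt_iff₀ hs] at h1
  rw [vpt_re, vpt_nsq, ← sq_abs]
  have h2 : |v| ^ 2 < (y * √δ) ^ 2 := pow_lt_pow_left₀ h1 (abs_nonneg v) two_ne_zero
  rw [mul_pow, Real.sq_sqrt hδ.le] at h2
  nlinarith [sq_nonneg |v|]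

theorem inv_mul_zpow_mul {G : Type*} [Group G] (q h : G) (n : ℤ) :
    q⁻¹ * h ^ n * q = (q⁻¹ * h * q) ^ n := by
  have := conj_zpow (a := q⁻¹) (b := h) (i := n)
  rw [inv_inv] at this
  exact this.symm

/-! ### The earthquake in the coordinates of a base stratum -/

/-- A collar model with its earthquake map `E`, and a base stratum `F₀` in the coordinates of which
the new holonomy `h` is `z ↦ k z + b`. -/
structure BasedModel (κ δ : ℝ) (H : Set ℍ) (St : Set (Set ℍ)) (A : Set ℍ → PSL2R)
    (g h : PSL2R) (E : ℍ → ℍ) (F₀ : Set ℍ) (z₀ : ℍ) (k b : ℝ) : Prop where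
  model : CollarModel κ δ H St A g h
  E_eq : ∀ F ∈ St, ∀ x ∈ F, E x = A F • x
  mem_strata : F₀ ∈ St
  mem : z₀ ∈ F₀
  mem_collar : z₀ ∈ collar κ δ
  conj : IsAffine ((A F₀)⁻¹ * h * A F₀) k b

namespace BasedModel

variable {κ δ : ℝ} {H : Set ℍ} {St : Set (Set ℍ)} {A : Set ℍ → PSL2R} {g h : PSL2R}
  {E : ℍ → ℍ} {F₀ : Set ℍ} {z₀ : ℍ} {k b : ℝ}

theorem E_smul (B : BasedModel κ δ H St A g h E F₀ z₀ k b) {z : ℍ} (hz : z ∈ H) :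
    g • z ∈ H ∧ E (g • z) = h • E z := by
  obtain ⟨F, hF, hzF⟩ := B.model.cover z hz
  have hg : g • z ∈ g • F := smul_mem_smul_set hzF
  have hgF := B.model.smul_mem F hF
  exact ⟨B.model.subset _ hgF hg, by
    rw [B.E_eq _ hgF _ hg, B.E_eq F hF z hzF, B.model.equivariant F hF z hzF]⟩

theorem inv_smul_mem (B : BasedModel κ δ H St A g h E F₀ z₀ k b) {z : ℍ} (hz : z ∈ H) :
    g⁻¹ • z ∈ H := by
  obtain ⟨F, hF, hzF⟩ := B.model.cover z hz
  exact B.model.subset _ (B.model.inv_smul_mem F hF) (smul_mem_smul_set hzF)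

theorem zpow_smul_mem_image (B : BasedModel κ δ H St A g h E F₀ z₀ k b) (n : ℤ) {w : ℍ}
    (hw : w ∈ E '' H) : h ^ n • w ∈ E '' H := by
  have h1 : ∀ w ∈ E '' H, h • w ∈ E '' H := by
    rintro _ ⟨z, hz, rfl⟩
    obtain ⟨h1, h2⟩ := B.E_smul hz
    exact ⟨_, h1, h2⟩
  have h2 : ∀ w ∈ E '' H, h⁻¹ • w ∈ E '' H := by
    rintro _ ⟨z, hz, rfl⟩
    have h3 := B.inv_smul_mem hz
    refine ⟨_, h3, ?_⟩
    rw [eq_inv_smul_iff, ← (B.E_smul h3).2, smul_inv_smul]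
  induction n using Int.induction_on with
  | zero => simpa using hw
  | succ n ih => rw [add_comm, zpow_add, zpow_one, mul_smul]; exact h1 _ ih
  | pred n ih => rw [sub_eq_add_neg, add_comm, zpow_add, zpow_neg_one, mul_smul]; exact h2 _ ih

/-- The isometry of a stratum that meets the collar, in the coordinates of the base stratum. -/
theorem exists_affine (B : BasedModel κ δ H St A g h E F₀ z₀ k b) {F : Set ℍ} (hF : F ∈ St)
    {z : ℍ} (hz : z ∈ F) (hzN : z ∈ collar κ δ) :
    ∃ β c, 0 < β ∧ IsAffine ((A F₀)⁻¹ * A F) β c ∧ ∀ w ∈ F,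
      ((A F₀)⁻¹ • E w).re = β * w.re + c ∧ ((A F₀)⁻¹ • E w).im = β * w.im := by
  obtain ⟨β, c, hβ⟩ := B.model.exists_affine B.mem_strata hF B.mem B.mem_collar hz hzN
  refine ⟨β, c, hβ.pos, hβ, fun w hw => ?_⟩
  rw [B.E_eq F hF w hw, ← mul_smul]
  exact hβ w

theorem re_smul (B : BasedModel κ δ H St A g h E F₀ z₀ k b) {z : ℍ} (hz : z ∈ H) :
    ((A F₀)⁻¹ • E (g • z)).re = k * ((A F₀)⁻¹ • E z).re + b := by
  rw [(B.E_smul hz).2, ← (B.conj _).1, mul_smul, mul_smul, smul_inv_smul]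

/-- The earthquake preserves the order of the vertical rays in the collar. -/
theorem re_lt_re (B : BasedModel κ δ H St A g h E F₀ z₀ k b) {F : Set ℍ} (hF : F ∈ St)
    {z z' : ℍ} (hz : z ∈ F) (hzN : z ∈ collar κ δ) (hzN' : z' ∈ collar κ δ)
    (hlt : z.re < z'.re) {β c : ℝ} (hβ : IsAffine ((A F₀)⁻¹ * A F) β c) :
    ((A F₀)⁻¹ • E z).re < ((A F₀)⁻¹ • E z').re ∧
      ((A F₀)⁻¹ • E z').re - ((A F₀)⁻¹ • E z).re ≤ β * (z'.re - z.re) ∧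
      ∀ F' ∈ St, z' ∈ F' → ∀ β' c', IsAffine ((A F₀)⁻¹ * A F') β' c' → β' ≤ β := by
  obtain ⟨F', hF', hz'⟩ := B.model.cover _ (B.model.collar_subset hzN')
  -- Relative to `F`, the point `z'` is contracted towards an abscissa `d` between the two points.
  -- It stays to the right of `z`, does not move away from it, and its stratum has a smaller or
  -- equal factor.
  obtain ⟨s, d, hs, h1, h2, ha⟩ := B.model.comparison_affine hF hF' hz hzN hz' hzN' hlt.le
  have e : (A F₀)⁻¹ • E z' = ((A F₀)⁻¹ * A F) • (((A F)⁻¹ * A F') • z') := by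
    rw [B.E_eq F' hF' z' hz', smul_smul, smul_smul]; congr 1; group
  have e' : (A F₀)⁻¹ • E z = ((A F₀)⁻¹ * A F) • z := by
    rw [B.E_eq F hF z hz, smul_smul]
  have hβ0 := hβ.pos
  have he0 := Real.exp_pos (-s)
  have he1 : Real.exp (-s) ≤ 1 := Real.exp_le_one_iff.2 (by linarith)
  rw [e, e', (hβ _).1, (hβ _).1, (ha _).1]
  set r := Real.exp (-s)
  have h3 : z.re < r * z'.re + d * (1 - r) := by
    rcases h1.eq_or_lt with h | h
    · nlinarith
    · nlinarith
  have h4 : r * z'.re + d * (1 - r) ≤ z'.re := by nlinarith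
  refine ⟨?_, ?_, ?_⟩
  · have := mul_lt_mul_of_pos_left h3 hβ0
    linarith
  · have := mul_le_mul_of_nonneg_left h4 hβ0.le
    linarith
  · intro F'' hF'' hz'' β' c' hβ'
    obtain rfl := B.model.disjoint F' hF' F'' hF'' z' hz' hz''
    have := ((hβ.mul ha).uniq (hβ'.congr (by group) rfl rfl)).1
    rw [← this]
    nlinarith

/-- `g` moves points of the collar to the left and the earthquake preserves this order. -/
theorem side_of_mem_collar (B : BasedModel κ δ H St A g h E F₀ z₀ k b) {z : ℍ}
    (hz : z ∈ collar κ δ) :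
    k * ((A F₀)⁻¹ • E z).re + b < ((A F₀)⁻¹ • E z).re := by
  rw [← B.re_smul (B.model.collar_subset hz)]
  have hgz := B.model.smul_mem_collar hz
  obtain ⟨F, hF, hzF⟩ := B.model.cover _ (B.model.collar_subset hgz)
  obtain ⟨β, c, -, hβ, -⟩ := B.exists_affine hF hzF hgz
  refine (B.re_lt_re hF hzF hgz hz ?_ hβ).1
  rw [(B.model.isAffine z).1, add_zero]
  exact hz.1

theorem vline_side (B : BasedModel κ δ H St A g h E F₀ z₀ k b) {v : ℝ} (hv : vline v ∈ St) :
    κ * v < v :=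
  B.model.side _ (B.model.subset _ hv (show vpt v 1 one_pos ∈ vline v from rfl))

theorem vline_affine (B : BasedModel κ δ H St A g h E F₀ z₀ k b) {v : ℝ} (hv : vline v ∈ St) :
    ∃ β c, 0 < β ∧ IsAffine ((A F₀)⁻¹ * A (vline v)) β c ∧ ∀ w ∈ vline v,
      ((A F₀)⁻¹ • E w).re = β * w.re + c ∧ ((A F₀)⁻¹ • E w).im = β * w.im := by
  obtain ⟨y, hy, hyN⟩ := exists_vpt_mem_collar B.model.δ_pos (B.vline_side hv)
  exact B.exists_affine hv (show vpt v y hy ∈ vline v from rfl) (hyN y hy le_rfl)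

theorem vline_zpow_mem (B : BasedModel κ δ H St A g h E F₀ z₀ k b) {v : ℝ} (hv : vline v ∈ St)
    (n : ℤ) : vline (κ ^ n * v) ∈ St := by
  have e : g ^ n • vline v = vline (κ ^ n * v) := by
    rw [(B.model.isAffine.zpow n).smul_vline, add_zero]
  rw [← e]
  clear e
  induction n using Int.induction_on with
  | zero => simpa using hv
  | succ n ih => rw [add_comm, zpow_add, zpow_one, mul_smul]; exact B.model.smul_mem _ ih
  | pred n ih =>
    rw [sub_eq_add_neg, add_comm, zpow_add, zpow_neg_one, mul_smul]
    exact B.model.inv_smul_mem _ ih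

/-- The earthquake does not move points across the image of a vertical leaf. -/
theorem re_vline (B : BasedModel κ δ H St A g h E F₀ z₀ k b) {v : ℝ} (hv : vline v ∈ St)
    {u z : ℍ} (hu : u.re = v) (hz : z ∈ H) :
    (z.re ≤ v → ((A F₀)⁻¹ • E z).re ≤ ((A F₀)⁻¹ • E u).re) ∧
      (v ≤ z.re → ((A F₀)⁻¹ • E u).re ≤ ((A F₀)⁻¹ • E z).re) := by
  obtain ⟨β, c, hβ0, hβ, hβ'⟩ := B.vline_affine hv
  by_cases hzv : z.re = v
  · rw [(hβ' z hzv).1, (hβ' u hu).1, hzv, hu]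
    exact ⟨fun _ => le_rfl, fun _ => le_rfl⟩
  obtain ⟨F, hF, hzF⟩ := B.model.cover z hz
  have hne : vline v ≠ F := by rintro rfl; exact hzv hzF
  -- The stratum of `z` need not reach the collar, so the comparison need not be affine; only the
  -- barrier property of the vertical leaf is available.
  have key : 0 ≤ (z.re - v) * ((((A (vline v))⁻¹ * A F) • z).re - v) := by
    rcases B.model.comparison _ hv _ hF hne with hT | hT
    · exact hT.mul_nonneg hzF hzv
    · rw [hT, inv_mul_cancel, one_smul, ← sq]; exact sq_nonneg _
  have e : (A F₀)⁻¹ • E z = ((A F₀)⁻¹ * A (vline v)) • (((A (vline v))⁻¹ * A F) • z) := by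
    rw [B.E_eq F hF z hzF, smul_smul, smul_smul]; congr 1; group
  rw [(hβ' u hu).1, e, (hβ _).1, hu]
  set x := (((A (vline v))⁻¹ * A F) • z).re
  constructor
  · intro hle
    have : x ≤ v := by
      by_contra! h
      have : z.re < v := lt_of_le_of_ne hle hzv
      nlinarith
    nlinarith
  · intro hle
    have : v ≤ x := by
      by_contra! h
      have : v < z.re := lt_of_le_of_ne hle (Ne.symm hzv)
      nlinarith
    nlinarith

/-- If there are vertical leaves, the image of the earthquake lies on one side of the axis of the
new holonomy. -/
theorem side_image (B : BasedModel κ δ H St A g h E F₀ z₀ k b) {v : ℝ} (hv : vline v ∈ St)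
    {z : ℍ} (hz : z ∈ H) :
    k * ((A F₀)⁻¹ • E z).re + b < ((A F₀)⁻¹ • E z).re := by
  obtain ⟨n, hn1, hn2⟩ := exists_zpow_strip B.model.isAffine.pos B.model.ne_one (B.vline_side hv)
    (B.model.side z hz)
  have key : ∀ n : ℤ, ∃ u : ℍ, u.re = κ ^ n * v ∧ u ∈ collar κ δ := fun n => by
    obtain ⟨y, hy, hyN⟩ := exists_vpt_mem_collar B.model.δ_pos
      (B.vline_side (B.vline_zpow_mem hv n))
    exact ⟨_, rfl, hyN y hy le_rfl⟩
  obtain ⟨u, hu, huN⟩ := key n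
  obtain ⟨u', hu', huN'⟩ := key (n + 1)
  have h1 := (B.re_vline (B.vline_zpow_mem hv n) hu hz).1 hn2.le
  have h2 := (B.re_vline (B.vline_zpow_mem hv (n + 1)) hu' hz).2 hn1
  have h3 := B.side_of_mem_collar huN
  have h4 := B.side_of_mem_collar huN'
  -- The condition `k x + b < x` describes a half-line, and the image of `z` lies between those of
  -- two translated leaves; the sign of `1 - k` selects which of the two bounds to use.
  rcases le_total k 1 with hk | hk
  · nlinarith
  · nlinarith

end BasedModel

/-! ### Reversing the axis, and a criterion for spiralling -/

/-- The reversal of the imaginary axis. -/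
def flip : SL(2, ℝ) := ⟨!![0, -1; 1, 0], by simp⟩

/-- The horizontal translation `z ↦ z + x`. -/
def horTrans (x : ℝ) : SL(2, ℝ) := ⟨!![1, x; 0, 1], by simp⟩

/-- The homothety `z ↦ y z`. -/
def homothety (y : ℝ) (hy : 0 < y) : SL(2, ℝ) :=
  ⟨!![√y, 0; 0, 1 / √y], by
    have := Real.sqrt_pos.2 hy
    rw [Matrix.det_fin_two_of]; field_simp; ring⟩

theorem flip_entries : flip 0 0 = 0 ∧ flip 0 1 = -1 ∧ flip 1 0 = 1 ∧ flip 1 1 = 0 :=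
  ⟨rfl, rfl, rfl, rfl⟩

theorem horTrans_entries (x : ℝ) : horTrans x 0 0 = 1 ∧ horTrans x 0 1 = x ∧
    horTrans x 1 0 = 0 ∧ horTrans x 1 1 = 1 :=
  ⟨rfl, rfl, rfl, rfl⟩

theorem homothety_entries (y : ℝ) (hy : 0 < y) : homothety y hy 0 0 = √y ∧
    homothety y hy 0 1 = 0 ∧ homothety y hy 1 0 = 0 ∧ homothety y hy 1 1 = 1 / √y :=
  ⟨rfl, rfl, rfl, rfl⟩

theorem horTrans_isAffine (x : ℝ) : IsAffine (toPSL (horTrans x)) 1 x := fun z => by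
  obtain ⟨r, i, -⟩ := smul_coords (horTrans x) z
  obtain ⟨e1, e2, e3, e4⟩ := horTrans_entries x
  rw [den, e1, e2, e3, e4] at r
  rw [den, e3, e4] at i
  rw [toPSL_smul]
  constructor <;> linarith

theorem homothety_isAffine (y : ℝ) (hy : 0 < y) : IsAffine (toPSL (homothety y hy)) y 0 :=
    fun z => by
  obtain ⟨r, i, -⟩ := smul_coords (homothety y hy) z
  obtain ⟨e1, e2, e3, e4⟩ := homothety_entries y hy
  have hs := Real.sqrt_pos.2 hy
  have hs2 := Real.sq_sqrt hy.le
  have hs1 : √y * (1 / √y) = 1 := by field_simp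
  have hs3 : (1 / √y) ^ 2 = 1 / y := by rw [div_pow, hs2, one_pow]
  rw [den, e1, e2, e3, e4, hs3, hs1] at r
  rw [den, e3, e4, hs3] at i
  rw [toPSL_smul]
  generalize homothety y hy • z = w at *
  have hy1 : y * (1 / y) = 1 := by field_simp
  constructor
  · linear_combination y * r - w.re * hy1
  · linear_combination y * i - w.im * hy1

theorem flip_coords (z : ℍ) : (flip • z).re * nsq z = -z.re ∧ (flip • z).im * nsq z = z.im ∧
    nsq (flip • z) * nsq z = 1 := by
  obtain ⟨r, i, n⟩ := smul_coords flip z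
  obtain ⟨e1, e2, e3, e4⟩ := flip_entries
  rw [den, e1, e2, e3, e4] at r
  rw [den, e3, e4] at i
  rw [den, e1, e2, e3, e4] at n
  refine ⟨by linarith, by linarith, by linarith⟩

theorem nsq_pos (z : ℍ) : 0 < nsq z := (sq_nonneg _).trans_lt (re_sq_lt_nsq z)

theorem flip_flip (z : ℍ) : flip • flip • z = z := by
  obtain ⟨r, i, n⟩ := flip_coords z
  obtain ⟨r', i', n'⟩ := flip_coords (flip • z)
  have h1 := nsq_pos (flip • z)
  have h2 := nsq_pos z
  apply UpperHalfPlane.ext_re_im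
  · apply mul_right_cancel₀ h1.ne'
    rw [r']
    apply mul_right_cancel₀ h2.ne'
    linear_combination -r - z.re * n
  · apply mul_right_cancel₀ h1.ne'
    rw [i']
    apply mul_right_cancel₀ h2.ne'
    linear_combination i - z.im * n

theorem flip_inv_smul (z : ℍ) : flip⁻¹ • z = flip • z := by
  rw [inv_smul_eq_iff, flip_flip]

/-- The reversal of the imaginary axis conjugates `z ↦ k z` to `z ↦ z / k`. -/
theorem IsAffine.conj_flip {q : PSL2R} {k : ℝ} (h : IsAffine q k 0) :
    IsAffine ((toPSL flip)⁻¹ * q * toPSL flip) k⁻¹ 0 := fun z => by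
  have e : ((toPSL flip)⁻¹ * q * toPSL flip) • z = flip • (q • (flip • z)) := by
    rw [mul_smul, mul_smul, ← toPSL_inv, toPSL_smul, toPSL_smul, flip_inv_smul]
  have hk := h.pos
  obtain ⟨r, i, n⟩ := flip_coords z
  obtain ⟨r', i', -⟩ := flip_coords (q • (flip • z))
  obtain ⟨r2, i2⟩ := h (flip • z)
  rw [h.nsq_smul, r2] at r'
  rw [h.nsq_smul, i2] at i'
  have h1 := nsq_pos (flip • z)
  have h2 := nsq_pos z
  rw [e]
  generalize flip • (q • (flip • z)) = w at *
  generalize flip • z = u at *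
  have hkk : k⁻¹ * k = 1 := inv_mul_cancel₀ hk.ne'
  have hne : k ^ 2 * nsq u * nsq z ≠ 0 := by positivity
  constructor
  · apply mul_right_cancel₀ hne
    linear_combination (nsq z) * r' - k * r - (k ^ 2 * k⁻¹ * z.re) * n - k * z.re * hkk
  · apply mul_right_cancel₀ hne
    linear_combination (nsq z) * i' + k * i - (k ^ 2 * k⁻¹ * z.im) * n - k * z.im * hkk

theorem flip_smul_vpt (y : ℝ) (hy : 0 < y) : flip • vpt 0 y hy = vpt 0 y⁻¹ (inv_pos.2 hy) := by
  obtain ⟨r, i, -⟩ := flip_coords (vpt 0 y hy)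
  rw [vpt_nsq] at r i
  have hy2 : (0 : ℝ) ^ 2 + y ^ 2 ≠ 0 := by positivity
  apply UpperHalfPlane.ext_re_im
  · apply mul_right_cancel₀ hy2
    rw [r, vpt_re, vpt_re]; ring
  · apply mul_right_cancel₀ hy2
    rw [i, vpt_im, vpt_im]; field_simp; ring

theorem side_mul_flip (P : SL(2, ℝ)) (z : ℍ) : side (P * flip) z = -side P z := by
  obtain ⟨e1, e2, e3, e4⟩ := flip_entries
  simp only [side, Matrix.SpecialLinearGroup.coe_mul, Matrix.mul_apply, Fin.sum_univ_two,
    e1, e2, e3, e4]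
  ring

theorem line_mul_flip (P : SL(2, ℝ)) : line (P * flip) = line P := by
  ext z
  rw [mem_line, mem_line, side_mul_flip, neg_eq_zero]

theorem axisPoint_eq (P : SL(2, ℝ)) (t : ℝ) : axisPoint P t = P • vpt 0 _ (Real.exp_pos t) := rfl

theorem axisPoint_mul_flip (P : SL(2, ℝ)) (t : ℝ) : axisPoint (P * flip) t = axisPoint P (-t) := by
  rw [axisPoint_eq, axisPoint_eq, mul_smul, flip_smul_vpt]
  congr 1
  refine UpperHalfPlane.ext_re_im ?_ ?_
  · rfl
  · rw [vpt_im, vpt_im, Real.exp_neg]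

theorem side_pos_iff (P : SL(2, ℝ)) (z : ℍ) : 0 < side P z ↔ 0 < (P⁻¹ • z).re := by
  rw [← re_inv_smul]
  exact mul_pos_iff_of_pos_right (den_pos _ _)

theorem line_eq (P : SL(2, ℝ)) : line P = {z | (P⁻¹ • z).re = 0} := by
  ext z
  rw [mem_line, ← re_inv_smul, mul_eq_zero_iff_right (den_pos _ _).ne']
  rfl

/-- A small neighbourhood of a geodesic is contained in a cone. -/
theorem exists_infDist_line (P : SL(2, ℝ)) {ε₀ : ℝ} (hε : 0 < ε₀) :
    ∃ ε > 0, ∀ z : ℍ, Metric.infDist z (line P) < ε →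
      |(P⁻¹ • z).re| < ε₀ * (P⁻¹ • z).im := by
  -- The Euclidean distance to a point at hyperbolic distance `d` is at most `im * (exp d - 1)`.
  refine ⟨Real.log (1 + ε₀), Real.log_pos (by linarith), fun z hz => ?_⟩
  have hne : (line P).Nonempty := range_nonempty _
  rw [Metric.infDist_lt_iff hne] at hz
  obtain ⟨_, ⟨t, rfl⟩, hd⟩ := hz
  rw [axisPoint_eq, ← dist_smul P⁻¹, inv_smul_smul, dist_comm] at hd
  have h1 := UpperHalfPlane.dist_coe_le (vpt 0 _ (Real.exp_pos t)) (P⁻¹ • z)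
  have h2 : |(P⁻¹ • z).re| ≤ dist ((vpt 0 _ (Real.exp_pos t) : ℍ) : ℂ) ((P⁻¹ • z : ℍ) : ℂ) := by
    rw [Complex.dist_eq]
    refine le_trans (le_of_eq ?_) (Complex.abs_re_le_norm _)
    simp
  have h3 : Real.exp (dist (vpt 0 _ (Real.exp_pos t)) (P⁻¹ • z)) < 1 + ε₀ := by
    rw [← Real.lt_log_iff_exp_lt (by linarith)]; exact hd
  have := (P⁻¹ • z).im_pos
  nlinarith

/-- A geodesic ending at the positive end of the axis is asymptotic to it. -/
theorem tendsto_infDist_atTop {P : SL(2, ℝ)} {l : Set ℍ} {v : ℝ}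
    (hl : ∀ y (hy : 0 < y), P • vpt v y hy ∈ l) :
    Tendsto (fun t => Metric.infDist (axisPoint P t) l) atTop (𝓝 0) := by
  have h0 : Tendsto (fun t => |v| * Real.exp (-t)) atTop (𝓝 0) := by
    simpa using (Real.tendsto_exp_neg_atTop_nhds_zero).const_mul |v|
  refine squeeze_zero (fun t => Metric.infDist_nonneg) (fun t => ?_) h0
  refine (Metric.infDist_le_dist_of_mem (hl _ (Real.exp_pos t))).trans ?_
  rw [axisPoint_eq, dist_smul]
  refine (UpperHalfPlane.dist_le_dist_coe_div_sqrt _ _).trans (le_of_eq ?_)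
  rw [vpt_im, vpt_im, Real.sqrt_mul_self (Real.exp_pos t).le, Complex.dist_eq_re_im, Real.exp_neg]
  simp only [UpperHalfPlane.coe_re, UpperHalfPlane.coe_im, vpt_re, vpt_im, sub_self]
  rw [zero_pow two_ne_zero, add_zero, Real.sqrt_sq_eq_abs, zero_sub, abs_neg, div_eq_mul_inv]

/-- The boundary axis of a set on one side of the axis of an isometry. -/
theorem isBoundaryAxis_of_affine {P : SL(2, ℝ)} {K : Set ℍ} {h : PSL2R} {k : ℝ}
    (hk : IsAffine ((toPSL P)⁻¹ * h * toPSL P) k 0)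
    (hside : ∀ z ∈ K, k * (P⁻¹ • z).re < (P⁻¹ • z).re)
    (hcl : ∀ y (hy : 0 < y), P • vpt 0 y hy ∈ closure K) :
    (1 < k → IsBoundaryAxis K h P) ∧ (k < 1 → IsBoundaryAxis K h (P * flip)) := by
  have hfr : line P ⊆ frontier K := by
    rintro z hz
    refine ⟨?_, fun hz' => ?_⟩
    · obtain ⟨t, rfl⟩ := hz
      exact hcl _ _
    · have := hside z (interior_subset hz')
      rw [line_eq] at hz
      rw [hz, mul_zero] at this
      exact lt_irrefl _ this
  refine ⟨fun hk1 => ⟨?_, hfr, Real.log k, Real.log_pos hk1, ?_⟩,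
    fun hk1 => ⟨?_, by rwa [line_mul_flip], -Real.log k,
      neg_pos.2 (Real.log_neg hk.pos hk1), ?_⟩⟩
  · intro z hz
    have := hside z hz
    show (P⁻¹ • z).re < 0
    nlinarith
  · rw [translatesAlong_iff, Real.exp_log hk.pos]
    exact hk
  · intro z hz
    have := hside z hz
    rw [mem_leftSide, side_mul_flip, neg_lt_zero, side_pos_iff]
    nlinarith
  · rw [translatesAlong_iff, Real.exp_neg, Real.exp_log hk.pos]
    refine hk.conj_flip.congr ?_ rfl rfl
    apply psl_ext
    intro z
    simp only [mul_smul, ← toPSL_inv, toPSL_smul, mul_inv_rev]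

/-- If the leaves are vertical in the coordinates `P` or stay away from the axis, and some of them
is vertical, then the lamination spirals towards the end of the axis of which the vertical
geodesics emanate. -/
theorem spirals_of_vertical {P : SL(2, ℝ)} {K : Set ℍ} {h : PSL2R} {k : ℝ} {L : Set (Set ℍ)}
    (hk : IsAffine ((toPSL P)⁻¹ * h * toPSL P) k 0)
    (hside : ∀ z ∈ K, k * (P⁻¹ • z).re < (P⁻¹ • z).re)
    (hcl : ∀ y (hy : 0 < y), P • vpt 0 y hy ∈ closure K)
    (hl : ∃ l ∈ L, ∃ v, ∀ y (hy : 0 < y), P • vpt v y hy ∈ l)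
    {ε₀ : ℝ} (hε₀ : 0 < ε₀)
    (hL : ∀ l ∈ L, (∃ v, ∀ y (hy : 0 < y), P • vpt v y hy ∈ l) ∨
      ∀ z ∈ l, ε₀ * (P⁻¹ • z).im ≤ |(P⁻¹ • z).re|) :
    (1 < k → SpiralsPositively K L h) ∧ (k < 1 → SpiralsNegatively K L h) := by
  obtain ⟨hb1, hb2⟩ := isBoundaryAxis_of_affine hk hside hcl
  obtain ⟨l₀, hl₀, v, hv⟩ := hl
  obtain ⟨ε, hε, hnear⟩ := exists_infDist_line P hε₀
  have hall : ∀ l ∈ L, (∃ z ∈ l, Metric.infDist z (line P) < ε) →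
      Tendsto (fun t => Metric.infDist (axisPoint P t) l) atTop (𝓝 0) := by
    rintro l hl ⟨z, hz, hzε⟩
    rcases hL l hl with ⟨v, hv⟩ | hfar
    · exact tendsto_infDist_atTop hv
    · exact absurd (hnear z hzε) (not_lt.2 (hfar z hz))
  refine ⟨fun hk1 => ⟨P, hb1 hk1, ⟨l₀, hl₀, tendsto_infDist_atTop hv⟩, ε, hε, hall⟩,
    fun hk1 => ⟨P * flip, hb2 hk1, ⟨l₀, hl₀, ?_⟩, ε, hε, fun l hl hz => ?_⟩⟩
  · simp only [axisPoint_mul_flip]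
    exact (tendsto_infDist_atTop hv).comp tendsto_neg_atBot_atTop
  · simp only [axisPoint_mul_flip]
    rw [line_mul_flip] at hz
    exact (hall l hl hz).comp tendsto_neg_atBot_atTop

theorem smul_line (M D : SL(2, ℝ)) : M • line D = line (M * D) := by
  ext z
  rw [mem_smul_set_iff_inv_smul_mem, line_eq, line_eq]
  simp only [mem_ofPred_eq, mul_inv_rev, mul_smul]

/-- A geodesic in a vertical strip is vertical or has bounded height. -/
theorem line_in_strip {D : SL(2, ℝ)} {p q : ℝ} (h : ∀ z ∈ line D, p ≤ z.re ∧ z.re ≤ q) :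
    (∃ x, line D = vline x) ∨ ∀ z ∈ line D, z.im ≤ q - p := by
  have hdis := side_discr D
  have hmem : ∀ z, z ∈ line D ↔ (D 0 0 * D 1 1 + D 0 1 * D 1 0) * z.re
      - (D 1 0 * D 1 1) * nsq z - (D 0 0 * D 0 1) = 0 := fun z => mem_line
  generalize D 0 0 * D 1 1 + D 0 1 * D 1 0 = β at *
  generalize D 1 0 * D 1 1 = α at *
  generalize D 0 0 * D 0 1 = c at *
  by_cases hα : α = 0
  · left
    subst hα
    have hβ : β ≠ 0 := by rintro rfl; norm_num at hdis
    refine ⟨c / β, ?_⟩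
    ext z
    rw [hmem, mem_vline, eq_div_iff hβ]
    constructor <;> intro h <;> linarith
  · right
    set r := 1 / (2 * |α|) with hr
    set x₀ := β / (2 * α) with hx₀
    have hα' : 0 < |α| := abs_pos.2 hα
    have hr0 : 0 < r := by positivity
    have hr2 : r ^ 2 = 1 / (4 * α ^ 2) := by rw [hr, div_pow, mul_pow, sq_abs]; norm_num
    have hcirc : ∀ z, z ∈ line D ↔ (z.re - x₀) ^ 2 + z.im ^ 2 = r ^ 2 := by
      intro z
      rw [hmem, hr2, hx₀, nsq]
      have e : (z.re - β / (2 * α)) ^ 2 + z.im ^ 2 - 1 / (4 * α ^ 2)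
          = (-1 / α) * (β * z.re - α * (z.re ^ 2 + z.im ^ 2) - c) := by
        field_simp
        linear_combination (4 : ℝ) * hdis
      rw [← sub_eq_zero (b := 1 / (4 * α ^ 2)), e, mul_eq_zero]
      simp [hα]
    -- The ends of the semicircle are not in `ℍ`; its points at abscissas `x₀ ± r / 2` already show
    -- that the strip has width at least `r`.
    have hpt : ∀ s : ℝ, s ^ 2 = 1 / 4 → p ≤ x₀ + s * r ∧ x₀ + s * r ≤ q := by
      intro s hs
      have hy : 0 < √3 / 2 * r := by positivity
      refine h (vpt (x₀ + s * r) _ hy) ((hcirc _).2 ?_)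
      have h3 := Real.sq_sqrt (show (0 : ℝ) ≤ 3 by norm_num)
      rw [vpt_re, vpt_im]
      linear_combination r ^ 2 * hs + r ^ 2 / 4 * h3
    intro z hz
    have h1 := (hcirc z).1 hz
    have h2 := (hpt (1 / 2) (by norm_num)).2
    have h3 := (hpt (-1 / 2) (by norm_num)).1
    have : z.im ≤ r := abs_le_of_sq_le_sq' (by nlinarith [sq_nonneg (z.re - x₀)]) hr0.le |>.2
    linarith

theorem continuous_vpt {y : ℝ} (hy : 0 < y) : Continuous fun x => vpt x y hy := by
  apply Continuous.upperHalfPlaneMk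
  have : (fun x : ℝ => (⟨x, y⟩ : ℂ)) = fun x : ℝ => (x : ℂ) + y * Complex.I := by
    funext x
    apply Complex.ext <;> simp
  rw [this]
  fun_prop

theorem continuous_axisPoint (D : SL(2, ℝ)) : Continuous (axisPoint D) := by
  have h1 : Continuous fun t => vpt 0 (Real.exp t) (Real.exp_pos t) :=
    (UpperHalfPlane.isometry_vertical_line 0).continuous
  exact h1.const_smul D

theorem lt_of_forall_ne {f : ℝ → ℝ} (hf : Continuous f) {v : ℝ} (hne : ∀ t, f t ≠ v) {t₀ : ℝ} :
    (f t₀ < v → ∀ t, f t < v) ∧ (v < f t₀ → ∀ t, v < f t) := by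
  constructor
  · intro h0 t
    by_contra! h
    obtain ⟨s, hs⟩ := mem_range_of_exists_le_of_exists_ge hf ⟨t₀, h0.le⟩ ⟨t, h⟩
    exact hne s hs
  · intro h0 t
    by_contra! h
    obtain ⟨s, hs⟩ := mem_range_of_exists_le_of_exists_ge hf ⟨t, h⟩ ⟨t₀, h0.le⟩
    exact hne s hs

/-! ### The image surface: length, axis, leaves, cusp -/

namespace BasedModel

variable {κ δ : ℝ} {H : Set ℍ} {St : Set (Set ℍ)} {A : Set ℍ → PSL2R} {g h : PSL2R}
  {E : ℍ → ℍ} {F₀ : Set ℍ} {z₀ : ℍ} {k b : ℝ}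

theorem ray_mem_image (B : BasedModel κ δ H St A g h E F₀ z₀ k b) (y : ℝ) (hy : 0 < y)
    (hy0 : z₀.im ≤ y) : A F₀ • vpt z₀.re y hy ∈ E '' H := by
  have := B.model.ray_vpt B.mem_strata B.mem B.mem_collar y hy hy0
  exact ⟨_, B.model.subset _ B.mem_strata this, B.E_eq _ B.mem_strata _ this⟩

theorem boundaryLength_eq (B : BasedModel κ δ H St A g h E F₀ z₀ k b) :
    boundaryLength (E '' H) h = |Real.log k| :=
  B.conj.boundaryLength_eq B.ray_mem_image

/-- The axis of the new holonomy is in the closure of the image of the earthquake. -/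
theorem axis_mem_closure (B : BasedModel κ δ H St A g h E F₀ z₀ k b) (hk : k ≠ 1) {w₀ : ℝ}
    (hw₀ : k * w₀ + b = w₀) (y : ℝ) (hy : 0 < y) :
    A F₀ • vpt w₀ y hy ∈ closure (E '' H) := by
  have hk0 := B.conj.pos
  -- `h` or its inverse contracts towards `w₀`. Its powers push the ray over `z₀` onto rays that
  -- start lower and lower and approach the axis, so they eventually contain points at the given
  -- height.
  obtain ⟨ε, r, hr0, hr1, hr⟩ : ∃ (ε : ℤ) (r : ℝ), 0 < r ∧ r < 1 ∧
      IsAffine ((A F₀)⁻¹ * h ^ ε * A F₀) r (w₀ * (1 - r)) := by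
    rcases lt_or_gt_of_ne hk with h1 | h1
    · exact ⟨1, k, hk0, h1, B.conj.congr (by rw [zpow_one]) rfl (by linarith)⟩
    · refine ⟨-1, k⁻¹, inv_pos.2 hk0, inv_lt_one_of_one_lt₀ h1, B.conj.inv.congr (by group) rfl ?_⟩
      field_simp
      linarith
  have hpow : ∀ n : ℕ, IsAffine ((A F₀)⁻¹ * (h ^ ε) ^ n * A F₀) (r ^ n) (w₀ * (1 - r ^ n)) := by
    intro n
    induction n with
    | zero => exact IsAffine.one.congr (by group) (by simp) (by simp)
    | succ n ih =>
      refine (ih.mul hr).congr ?_ (pow_succ _ _).symm (by ring)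
      rw [pow_succ]; group
  have hmem : ∀ᶠ n : ℕ in atTop,
      A F₀ • vpt (w₀ + r ^ n * (z₀.re - w₀)) y hy ∈ E '' H := by
    have h0 : Tendsto (fun n : ℕ => r ^ n * z₀.im) atTop (𝓝 0) := by
      simpa using (tendsto_pow_atTop_nhds_zero_of_lt_one hr0.le hr1).mul_const z₀.im
    filter_upwards [h0.eventually_lt_const hy] with n hn
    have hrn : 0 < r ^ n := pow_pos hr0 n
    have hy' : 0 < y / r ^ n := by positivity
    have h1 := B.ray_mem_image _ hy' (by rw [le_div_iff₀ hrn]; linarith)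
    have h2 := B.zpow_smul_mem_image (ε * n) h1
    have e : h ^ (ε * n) • (A F₀ • vpt z₀.re _ hy')
        = A F₀ • vpt (w₀ + r ^ n * (z₀.re - w₀)) y hy := by
      rw [zpow_mul, zpow_natCast, ← inv_smul_eq_iff, smul_smul, smul_smul]
      apply UpperHalfPlane.ext_re_im
      · rw [(hpow n _).1, vpt_re, vpt_re]; ring
      · rw [(hpow n _).2, vpt_im, vpt_im]; field_simp
    rwa [e] at h2
  refine mem_closure_of_tendsto ?_ hmem
  obtain ⟨Q, hQ⟩ := exists_eq_toPSL (A F₀)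
  have hc : Continuous fun x => A F₀ • vpt x y hy := by
    rw [hQ]; exact (continuous_vpt hy).const_smul Q
  have h0 : Tendsto (fun n : ℕ => w₀ + r ^ n * (z₀.re - w₀)) atTop (𝓝 w₀) := by
    simpa using ((tendsto_pow_atTop_nhds_zero_of_lt_one hr0.le hr1).mul_const
      (z₀.re - w₀)).const_add w₀
  exact (hc.tendsto w₀).comp h0

/-- The image of a leaf is vertical, or bounded away from the axis of the new holonomy. -/
theorem image_leaf (B : BasedModel κ δ H St A g h E F₀ z₀ k b) {w₀ : ℝ}
    (hw₀ : k * w₀ + b = w₀) {v : ℝ} (hv : vline v ∈ St) {l : Set ℍ} (hl : l ∈ St)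
    (hgeo : IsGeodesic l) :
    (∃ x, ∀ y (hy : 0 < y), A F₀ • vpt x y hy ∈ E '' l) ∨
      ∀ w ∈ E '' l, min 1 k * ((A F₀)⁻¹ • w).im ≤ |k - 1| * |((A F₀)⁻¹ • w).re - w₀| := by
  obtain ⟨D, rfl⟩ := hgeo
  obtain ⟨M, hM⟩ := exists_eq_toPSL ((A F₀)⁻¹ * A (line D))
  have himg : ∀ z ∈ line D, (A F₀)⁻¹ • E z = M • z := by
    intro z hz
    rw [B.E_eq _ hl z hz, smul_smul, hM, toPSL_smul]
  have hvert : ∀ x, M • line D = vline x →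
      ∃ x, ∀ y (hy : 0 < y), A F₀ • vpt x y hy ∈ E '' line D := by
    intro x hx
    refine ⟨x, fun y hy => ?_⟩
    have h1 : vpt x y hy ∈ M • line D := by rw [hx]; rfl
    obtain ⟨z, hz, hz'⟩ := h1
    refine ⟨z, hz, ?_⟩
    rw [← inv_smul_eq_iff, himg z hz]
    exact hz'
  have hvline : ∀ v', line D = vline v' →
      ∃ x, ∀ y (hy : 0 < y), A F₀ • vpt x y hy ∈ E '' line D := by
    intro v' hv'
    rw [hv'] at hl hM hvert
    obtain ⟨β, c, -, hβ, -⟩ := B.vline_affine hl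
    rw [hM] at hβ
    rw [hv']
    exact hvert _ (hβ.smul_vline v')
  have hzD : axisPoint D 0 ∈ line D := ⟨0, rfl⟩
  obtain ⟨n, hn1, hn2⟩ := exists_zpow_strip B.model.isAffine.pos B.model.ne_one (B.vline_side hv)
    (B.model.side _ (B.model.subset _ hl hzD))
  have hv1 := B.vline_zpow_mem hv n
  have hv2 := B.vline_zpow_mem hv (n + 1)
  by_cases e1 : line D = vline (κ ^ n * v)
  · exact Or.inl (hvline _ e1)
  by_cases e2 : line D = vline (κ ^ (n + 1) * v)
  · exact Or.inl (hvline _ e2)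
  have hcont : Continuous fun t => (axisPoint D t).re :=
    UpperHalfPlane.continuous_re.comp (continuous_axisPoint D)
  have hne1 : ∀ t, (axisPoint D t).re ≠ κ ^ n * v := fun t ht =>
    e1 (B.model.disjoint _ hl _ hv1 (axisPoint D t) ⟨t, rfl⟩ ht)
  have hne2 : ∀ t, (axisPoint D t).re ≠ κ ^ (n + 1) * v := fun t ht =>
    e2 (B.model.disjoint _ hl _ hv2 (axisPoint D t) ⟨t, rfl⟩ ht)
  have hlt1 := (lt_of_forall_ne hcont hne1).1 hn2
  have hlt2 := (lt_of_forall_ne hcont hne2).2 (lt_of_le_of_ne hn1 (hne2 0).symm)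
  obtain ⟨y, hy, huN⟩ := exists_vpt_mem_collar B.model.δ_pos (B.vline_side hv1)
  replace huN := huN y hy le_rfl
  set u := vpt (κ ^ n * v) y hy with hu
  have hgu : (g • u).re = κ ^ (n + 1) * v := by
    rw [(B.model.isAffine u).1, hu, vpt_re, zpow_add_one₀ B.model.isAffine.pos.ne']; ring
  have hφ := B.side_of_mem_collar huN
  have hφg := B.re_smul (B.model.collar_subset huN)
  set φ := ((A F₀)⁻¹ • E u).re with hφdef
  have hstrip : ∀ z ∈ line D, k * φ + b ≤ (M • z).re ∧ (M • z).re ≤ φ := by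
    rintro z hz
    have hzH := B.model.subset _ hl hz
    obtain ⟨t, rfl⟩ := hz
    rw [← himg _ ⟨t, rfl⟩, ← hφg]
    exact ⟨(B.re_vline hv2 hgu hzH).2 (hlt2 t).le, (B.re_vline hv1 rfl hzH).1 (hlt1 t).le⟩
  have hstrip' : ∀ z ∈ line (M * D), k * φ + b ≤ z.re ∧ z.re ≤ φ := by
    rw [← smul_line]
    rintro _ ⟨z, hz, rfl⟩
    exact hstrip z hz
  -- The image lies in a strip between an image leaf and its translate by `h`. If it is not
  -- vertical, its height is at most the width of the strip, which is comparable to the distance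
  -- from the fixed point `w₀`.
  rcases line_in_strip hstrip' with ⟨x, hx⟩ | him
  · left
    exact hvert x (by rw [smul_line, hx])
  · right
    rintro _ ⟨z, hz, rfl⟩
    rw [himg z hz]
    have h1 := him (M • z) (by rw [← smul_line]; exact smul_mem_smul_set hz)
    obtain ⟨h2, h3⟩ := hstrip z hz
    have hip := (M • z).im_pos
    generalize (M • z).im = i at *
    generalize (M • z).re = x at *
    have hk0 := B.conj.pos
    clear_value φ
    obtain ⟨η, rfl⟩ : ∃ η, φ = w₀ + η := ⟨φ - w₀, by ring⟩
    obtain ⟨ξ, rfl⟩ : ∃ ξ, x = w₀ + ξ := ⟨x - w₀, by ring⟩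
    rw [add_sub_cancel_left]
    have h1' : i ≤ (1 - k) * η := by linarith
    have h2' : k * η ≤ ξ := by linarith
    have h3' : ξ ≤ η := by linarith
    have hη : 0 < (1 - k) * η := by linarith
    rcases lt_or_ge k 1 with hk1 | hk1
    · have hη0 : 0 < η := by nlinarith
      have hξ : 0 < ξ := by nlinarith
      rw [min_eq_right hk1.le, abs_of_neg (by linarith), abs_of_pos hξ]
      nlinarith
    · have hη0 : η < 0 := by nlinarith
      rw [min_eq_left hk1, abs_of_nonneg (by linarith), abs_of_neg (by linarith)]
      nlinarith

/-- Translating the fixed point `w₀` of `h` to `0` makes the new axis the imaginary axis. Image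
leaves are vertical or stay outside a cone around it, so `spirals_of_vertical` applies. -/
theorem spirals (B : BasedModel κ δ H St A g h E F₀ z₀ k b) (hk : k ≠ 1) {L : Set (Set ℍ)}
    (hL : L ⊆ St) (hgeo : ∀ l ∈ L, IsGeodesic l) (hv : ∃ v, vline v ∈ L) :
    (1 < k → SpiralsPositively (E '' H) (imageLeaves E L) h) ∧
      (k < 1 → SpiralsNegatively (E '' H) (imageLeaves E L) h) := by
  obtain ⟨v, hv⟩ := hv
  have hk0 := B.conj.pos
  have hk1 : 1 - k ≠ 0 := sub_ne_zero.2 (Ne.symm hk)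
  have hk2 : 0 < |k - 1| := abs_pos.2 (sub_ne_zero.2 hk)
  obtain ⟨Q, hQ⟩ := exists_eq_toPSL (A F₀)
  obtain ⟨w₀, hw₀⟩ : ∃ w₀, k * w₀ + b = w₀ := ⟨b / (1 - k), by field_simp; ring⟩
  have hU := horTrans_isAffine w₀
  have hP : toPSL (Q * horTrans w₀) = A F₀ * toPSL (horTrans w₀) := by
    rw [hQ]; apply psl_ext; intro z; simp only [mul_smul, toPSL_smul]
  have hPinv : ∀ z : ℍ, ((Q * horTrans w₀)⁻¹ • z).re = ((A F₀)⁻¹ • z).re - w₀ ∧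
      ((Q * horTrans w₀)⁻¹ • z).im = ((A F₀)⁻¹ • z).im := by
    intro z
    rw [← toPSL_smul, toPSL_inv, hP, mul_inv_rev, mul_smul, (hU.inv _).1, (hU.inv _).2]
    constructor
    · simp only [inv_one, one_mul, div_one]; ring
    · simp only [inv_one, one_mul]
  have hPv : ∀ x y (hy : 0 < y), (Q * horTrans w₀) • vpt x y hy = A F₀ • vpt (x + w₀) y hy := by
    intro x y hy
    rw [← toPSL_smul, hP, mul_smul]
    congr 1
    apply UpperHalfPlane.ext_re_im
    · rw [(hU _).1, vpt_re, vpt_re]; ring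
    · rw [(hU _).2, vpt_im, vpt_im, one_mul]
  have hvl : ∀ l : Set ℍ, (∃ x, ∀ y (hy : 0 < y), A F₀ • vpt x y hy ∈ l) →
      ∃ x, ∀ y (hy : 0 < y), (Q * horTrans w₀) • vpt x y hy ∈ l := by
    rintro l ⟨x, hx⟩
    refine ⟨x - w₀, fun y hy => ?_⟩
    rw [hPv, sub_add_cancel]
    exact hx y hy
  refine spirals_of_vertical (P := Q * horTrans w₀) (k := k) ?_ ?_ ?_ ?_
    (ε₀ := min 1 k / |k - 1|) (by positivity) ?_
  · rw [hP]
    refine ((hU.inv.mul B.conj).mul hU).congr (by group) (by ring) ?_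
    field_simp
    linarith
  · rintro _ ⟨z, hz, rfl⟩
    have := B.side_image (hL hv) hz
    rw [(hPinv _).1]
    linarith
  · intro y hy
    rw [hPv]
    have := B.axis_mem_closure hk hw₀ y hy
    convert this using 3
    ring
  · refine ⟨E '' vline v, ⟨_, hv, rfl⟩, hvl _ ?_⟩
    obtain ⟨β, c, hβ0, -, hβ⟩ := B.vline_affine (hL hv)
    refine ⟨β * v + c, fun y hy => ⟨vpt v (y / β) (by positivity), rfl, ?_⟩⟩
    rw [← inv_smul_eq_iff]
    obtain ⟨h1, h2⟩ := hβ (vpt v (y / β) (by positivity)) rfl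
    apply UpperHalfPlane.ext_re_im
    · rw [h1]; rfl
    · rw [h2, vpt_im, vpt_im]; field_simp
  · rintro _ ⟨l, hl, rfl⟩
    rcases B.image_leaf hw₀ (hL hv) (hL hl) (hgeo l hl) with h1 | h1
    · exact Or.inl (hvl _ h1)
    · right
      intro w hw
      rw [(hPinv w).1, (hPinv w).2, div_mul_eq_mul_div, div_le_iff₀ hk2, mul_comm _ |k - 1|]
      exact h1 w hw

/-- A parabolic has translation length `0`, whereas `h` has translation length `|log k|`. -/
theorem not_hasCusp (B : BasedModel κ δ H St A g h E F₀ z₀ k b) {K : Set ℍ} (hc : HasCusp K h) :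
    k = 1 := by
  obtain ⟨P, c, -, hP, -⟩ := hc
  have h1 : IsAffine ((toPSL P)⁻¹ * h * toPSL P) 1 c := by
    intro z
    rw [mul_smul, mul_smul, toPSL_smul, hP, ← toPSL_smul, inv_smul_smul]
    simp [add_comm]
  have h2 := h1.translationLength_eq
  rw [B.conj.translationLength_eq, Real.log_one, abs_zero, abs_eq_zero] at h2
  rcases Real.log_eq_zero.1 h2 with h | h | h
  · exact absurd h B.conj.pos.ne'
  · exact h
  · linarith [B.conj.pos]

/-- If the new holonomy is parabolic, then the image of the earthquake contains a horoball. -/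
theorem hasCusp (B : BasedModel κ δ H St A g h E F₀ z₀ k b) (hk : k = 1) :
    HasCusp (E '' H) h := by
  subst hk
  obtain ⟨Q, hQ⟩ := exists_eq_toPSL (A F₀)
  have hκ := B.model.isAffine.pos
  have hz₀ := B.mem_collar
  have hb : b < 0 := by
    have := B.side_of_mem_collar hz₀
    linarith
  set φ : ℍ → ℝ := fun z => ((A F₀)⁻¹ • E z).re with hφ
  set t₀ := z₀.re with ht₀
  have ht : κ * t₀ < t₀ := hz₀.1
  obtain ⟨y1, hy1, hN1⟩ := exists_vpt_mem_collar B.model.δ_pos ht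
  have hκt : κ * (κ * t₀) < κ * t₀ := mul_lt_mul_of_pos_left ht hκ
  obtain ⟨y2, hy2, hN2⟩ := exists_vpt_mem_collar B.model.δ_pos hκt
  set Y₁ := max y1 y2 with hY₁
  have hY0 : 0 < Y₁ := lt_max_of_lt_left hy1
  have hN : ∀ t ∈ Icc (κ * t₀) t₀, ∀ y (hy : 0 < y), Y₁ ≤ y → vpt t y hy ∈ collar κ δ := by
    intro t ht' y hy hyY
    have h1 := (hN1 y hy ((le_max_left _ _).trans hyY)).2
    have h2 := (hN2 y hy ((le_max_right _ _).trans hyY)).2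
    have hside : κ * t < t := by
      rcases lt_or_ge κ 1 with h | h
      · have : 0 < t₀ := by nlinarith
        have : 0 < t := by nlinarith [ht'.1]
        nlinarith
      · have : t₀ < 0 := by nlinarith
        have h3 : t < 0 := by linarith [ht'.2]
        have : κ ≠ 1 := B.model.ne_one
        have : 1 < κ := lt_of_le_of_ne h (Ne.symm this)
        nlinarith
    refine ⟨hside, ?_⟩
    rw [vpt_re, vpt_nsq] at h1 h2 ⊢
    have hδ := B.model.δ_pos
    -- For `δ < 1` the collar condition at a fixed height bounds `|t|`, so it follows from the two
    -- ends of the interval; for `δ ≥ 1` it always holds.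
    rcases lt_or_ge δ 1 with hδ1 | hδ1
    · have h3 : t ^ 2 ≤ max (t₀ ^ 2) ((κ * t₀) ^ 2) := by
        rcases le_total 0 t with h0 | h0
        · exact le_max_of_le_left (pow_le_pow_left₀ h0 ht'.2 2)
        · apply le_max_of_le_right
          nlinarith [ht'.1]
      rcases le_max_iff.1 h3 with h4 | h4 <;> nlinarith
    · have : 0 < y ^ 2 := by positivity
      nlinarith [sq_nonneg t]
  have hleft : κ * t₀ ∈ Icc (κ * t₀) t₀ := ⟨le_rfl, ht.le⟩
  have hright : t₀ ∈ Icc (κ * t₀) t₀ := ⟨ht.le, le_rfl⟩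
  have hNY := fun t ht => hN t ht Y₁ hY0 le_rfl
  obtain ⟨F₁, hF₁, hz₁⟩ := B.model.cover _ (B.model.collar_subset (hNY _ hleft))
  obtain ⟨β₁, c₁, hβ₁, haff₁, -⟩ := B.exists_affine hF₁ hz₁ (hNY _ hleft)
  have hβle : ∀ t ∈ Icc (κ * t₀) t₀, ∀ F ∈ St, vpt t Y₁ hY0 ∈ F → ∀ β c,
      IsAffine ((A F₀)⁻¹ * A F) β c → β ≤ β₁ := by
    intro t ht F hF hzF β c hβ
    rcases ht.1.eq_or_lt with e | hlt
    · subst e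
      obtain rfl := B.model.disjoint F hF F₁ hF₁ _ hzF hz₁
      exact (hβ.uniq haff₁).1.le
    · exact (B.re_lt_re hF₁ hz₁ (hNY _ hleft) (hNY _ ht) hlt haff₁).2.2 F hF hzF β c hβ
  -- The dilation factor is largest at the left end of the period. This bounds the slope of the
  -- abscissa of the image by `β₁`, so it is continuous and takes all values over one period of `h`.
  have hlip : LipschitzOnWith (Real.toNNReal β₁) (fun t => φ (vpt t Y₁ hY0))
      (Icc (κ * t₀) t₀) := by
    have key : ∀ t ∈ Icc (κ * t₀) t₀, ∀ t' ∈ Icc (κ * t₀) t₀, t < t' →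
        |φ (vpt t Y₁ hY0) - φ (vpt t' Y₁ hY0)| ≤ β₁ * |t - t'| := by
      intro t ht t' ht' hlt
      obtain ⟨F, hF, hzF⟩ := B.model.cover _ (B.model.collar_subset (hNY _ ht))
      obtain ⟨β, c, hβ0, hβ, -⟩ := B.exists_affine hF hzF (hNY _ ht)
      obtain ⟨h1, h2, -⟩ := B.re_lt_re hF hzF (hNY _ ht) (hNY _ ht') hlt hβ
      have h3 := hβle t ht F hF hzF β c hβ
      rw [vpt_re, vpt_re] at h2
      rw [abs_sub_comm, abs_sub_comm t, abs_of_pos (sub_pos.2 h1), abs_of_pos (sub_pos.2 hlt)]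
      exact h2.trans (mul_le_mul_of_nonneg_right h3 (sub_pos.2 hlt).le)
    refine LipschitzOnWith.of_dist_le_mul fun t ht t' ht' => ?_
    rw [Real.dist_eq, Real.dist_eq, Real.coe_toNNReal _ hβ₁.le]
    rcases lt_trichotomy t t' with hlt | rfl | hlt
    · exact key t ht t' ht' hlt
    · simp
    · rw [abs_sub_comm, abs_sub_comm t]
      exact key t' ht' t ht hlt
  have hend : φ (vpt (κ * t₀) Y₁ hY0) = φ (vpt t₀ Y₁ hY0) + b := by
    have h1 := B.re_smul (B.model.collar_subset (hNY _ hright))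
    rw [one_mul] at h1
    simp only [hφ]
    rw [← h1]
    have hgY : 0 < κ * Y₁ := by positivity
    have e : g • vpt t₀ Y₁ hY0 = vpt (κ * t₀) (κ * Y₁) hgY := by
      apply UpperHalfPlane.ext_re_im
      · rw [(B.model.isAffine _).1, vpt_re, vpt_re, add_zero]
      · rw [(B.model.isAffine _).2, vpt_im, vpt_im]
    rw [e]
    have hmN : vpt (κ * t₀) (κ * Y₁) hgY ∈ collar κ δ := by
      rw [← e]; exact B.model.smul_mem_collar (hNY _ hright)
    have hgF : vpt (κ * t₀) (κ * Y₁) hgY ∈ F₁ := by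
      obtain ⟨F, hF, hzF⟩ := B.model.cover _ (B.model.collar_subset hmN)
      have hp : 0 < max Y₁ (κ * Y₁) := lt_max_of_lt_left hY0
      have h3 := B.model.ray_vpt hF₁ hz₁ (hNY _ hleft) _ hp (le_max_left _ _)
      have h4 := B.model.ray_vpt hF hzF hmN _ hp (le_max_right _ _)
      rwa [B.model.disjoint F₁ hF₁ F hF _ h3 h4]
    obtain ⟨β, c, -, -, hβ⟩ := B.exists_affine hF₁ hz₁ (hNY _ hleft)
    rw [(hβ _ hz₁).1, (hβ _ hgF).1]
    rfl
  have hY : 0 < β₁ * Y₁ := by positivity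
  have hball : ∀ w : ℍ, β₁ * Y₁ < w.im → A F₀ • w ∈ E '' H := by
    intro w hw
    -- Since `b < 0`, a power of `h` brings the abscissa of `w` into the period just covered. The
    -- image of the ray found there contains every height above `β₁ * Y₁`.
    obtain ⟨n, hn, -⟩ := existsUnique_add_zsmul_mem_Ioc (neg_pos.2 hb) w.re
      (φ (vpt t₀ Y₁ hY0) + b)
    rw [zsmul_eq_mul] at hn
    have hn' : w.re + n * -b ∈ Icc (φ (vpt (κ * t₀) Y₁ hY0)) (φ (vpt t₀ Y₁ hY0)) := by
      rw [hend]
      exact ⟨hn.1.le, by linarith [hn.2]⟩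
    obtain ⟨t, ht, hte⟩ := intermediate_value_Icc ht.le hlip.continuousOn hn'
    obtain ⟨F, hF, hzF⟩ := B.model.cover _ (B.model.collar_subset (hNY _ ht))
    obtain ⟨β, c, hβ0, haff, hβ⟩ := B.exists_affine hF hzF (hNY _ ht)
    have hle := hβle t ht F hF hzF β c haff
    have hy : 0 < w.im / β := div_pos w.im_pos hβ0
    have hyY : Y₁ ≤ w.im / β := by
      rw [le_div_iff₀ hβ0]
      nlinarith
    have hpF := B.model.ray_vpt hF hzF (hNY _ ht) _ hy hyY
    rw [vpt_re] at hpF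
    have h1 : E (vpt t (w.im / β) hy) ∈ E '' H := ⟨_, B.model.subset _ hF hpF, rfl⟩
    have h2 := B.zpow_smul_mem_image n h1
    have hpow : IsAffine ((A F₀)⁻¹ * h ^ n * A F₀) 1 (n * b) := by
      rw [inv_mul_zpow_mul]
      have hadd : ∀ j : ℕ, IsAffine (((A F₀)⁻¹ * h * A F₀) ^ j) 1 (j * b) := by
        intro j
        induction j with
        | zero => exact IsAffine.one.congr (by simp) rfl (by simp)
        | succ j ih =>
          rw [pow_succ]
          exact (ih.mul B.conj).congr rfl (by ring) (by push_cast; ring)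
      cases n with
      | ofNat j => simpa using hadd j
      | negSucc j =>
        rw [zpow_negSucc]
        exact (hadd (j + 1)).inv.congr rfl (by simp) (by push_cast; ring)
    have e : h ^ n • E (vpt t (w.im / β) hy) = A F₀ • w := by
      rw [← inv_smul_eq_iff]
      have e1 : (A F₀)⁻¹ • h ^ n • E (vpt t (w.im / β) hy)
          = ((A F₀)⁻¹ * h ^ n * A F₀) • ((A F₀)⁻¹ • E (vpt t (w.im / β) hy)) := by
        rw [smul_smul, smul_smul]; congr 1; group
      rw [e1]
      have e2 : φ (vpt t Y₁ hY0) = β * t + c := (hβ _ hzF).1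
      replace hte : φ (vpt t Y₁ hY0) = w.re + n * -b := hte
      obtain ⟨e3, e4⟩ := hβ _ hpF
      apply UpperHalfPlane.ext_re_im
      · rw [(hpow _).1, e3, vpt_re]
        linarith
      · rw [(hpow _).2, e4, vpt_im]
        field_simp
    rwa [e] at h2
  have hS := homothety_isAffine _ hY
  have hsm : ∀ z : ℍ, (Q * homothety _ hY) • z = A F₀ • (toPSL (homothety _ hY) • z) := by
    intro z
    rw [hQ, mul_smul]; rfl
  refine ⟨Q * homothety _ hY, b / (β₁ * Y₁), div_ne_zero hb.ne hY.ne', fun z => ?_, fun z hz => ?_⟩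
  · rw [hsm, hsm, ← inv_smul_eq_iff, smul_smul, smul_smul]
    apply UpperHalfPlane.ext_re_im
    · rw [(B.conj _).1, (hS _).1, (hS _).1, UpperHalfPlane.vadd_re]
      field_simp
      ring
    · rw [(B.conj _).2, (hS _).2, (hS _).2, UpperHalfPlane.vadd_im]
      ring
  · rw [hsm]
    apply hball
    rw [(hS _).2]
    nlinarith

end BasedModel

/-! ### From an earthquake to its collar model -/

theorem toPSL_smul_set (P : SL(2, ℝ)) (S : Set ℍ) : toPSL P • S = P • S := rfl

theorem psl_smul_connectedComponentIn (q : PSL2R) {S : Set ℍ} {x : ℍ} (hx : x ∈ S) :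
    q • connectedComponentIn S x = connectedComponentIn (q • S) (q • x) := by
  obtain ⟨P, rfl⟩ := exists_eq_toPSL q
  exact (Homeomorph.smul P).image_connectedComponentIn hx

theorem translationLength_conj (p q : PSL2R) :
    translationLength (p⁻¹ * q * p) = translationLength q := by
  unfold translationLength
  rw [← (MulAction.surjective p).iInf_comp (g := fun z : ℍ => dist z (q • z))]
  refine iInf_congr fun z => ?_
  calc dist z ((p⁻¹ * q * p) • z) = dist (p • z) (p • ((p⁻¹ * q * p) • z)) := (psl_dist p _ _).symm
    _ = dist (p • z) (q • p • z) := by rw [mul_smul, mul_smul, smul_inv_smul]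

theorem geodConvex_preimage {H : Set ℍ} (hH : GeodConvex H) (P : SL(2, ℝ)) :
    GeodConvex ((fun z => P • z) ⁻¹' H) :=
  fun _ hx _ hy _ hz => hH _ hx _ hy (smul_mem_segment.2 hz)

theorem TranslatesRight.preimage {q : PSL2R} {P : SL(2, ℝ)} {F F' : Set ℍ}
    (h : TranslatesRight q (P • F) (P • F')) :
    TranslatesRight ((toPSL P)⁻¹ * q * toPSL P) F F' := by
  obtain ⟨C, s, hs, hq, h1, h2⟩ := h
  have e : ∀ z : ℍ, (P⁻¹ * C)⁻¹ • z = C⁻¹ • (P • z) := by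
    intro z
    rw [mul_inv_rev, inv_inv, mul_smul]
  refine ⟨P⁻¹ * C, s, hs, ?_, fun z hz => ?_, fun z hz => ?_⟩
  · intro z
    rw [e, mul_smul, mul_smul, ← toPSL_inv]
    simp only [toPSL_smul, mul_smul, smul_inv_smul]
    exact hq z
  · show 0 ≤ ((P⁻¹ * C)⁻¹ • z).re
    rw [e]
    exact h1 (smul_mem_smul_set hz)
  · show ((P⁻¹ * C)⁻¹ • z).re ≤ 0
    rw [e]
    exact h2 (smul_mem_smul_set hz)

theorem IsStratum.subset {H : Set ℍ} {L : Set (Set ℍ)} (hL : IsGeodesicLamination H L)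
    {F : Set ℍ} (hF : IsStratum H L F) : F ⊆ H := by
  rcases hF with hF | ⟨x, -, rfl⟩
  · exact hL.subset F hF
  · exact (connectedComponentIn_subset _ _).trans sdiff_subset

theorem IsStratum.eq_of_mem {H : Set ℍ} {L : Set (Set ℍ)} (hL : IsGeodesicLamination H L)
    {F F' : Set ℍ} (hF : IsStratum H L F) (hF' : IsStratum H L F') {z : ℍ} (hz : z ∈ F)
    (hz' : z ∈ F') : F = F' := by
  rcases hF with hF | ⟨x, -, rfl⟩ <;> rcases hF' with hF' | ⟨x', -, rfl⟩
  · by_contra hne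
    exact disjoint_left.1 (hL.disjoint hF hF' hne) hz hz'
  · exact absurd ⟨F, hF, hz⟩ (connectedComponentIn_subset _ _ hz').2
  · exact absurd ⟨F', hF', hz'⟩ (connectedComponentIn_subset _ _ hz).2
  · rw [connectedComponentIn_eq hz, connectedComponentIn_eq hz']

theorem IsStratum.exists_mem {H : Set ℍ} (L : Set (Set ℍ)) {z : ℍ} (hz : z ∈ H) :
    ∃ F, IsStratum H L F ∧ z ∈ F := by
  by_cases h : z ∈ ⋃₀ L
  · obtain ⟨l, hl, hzl⟩ := h
    exact ⟨l, Or.inl hl, hzl⟩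
  · exact ⟨_, Or.inr ⟨z, ⟨hz, h⟩, rfl⟩, mem_connectedComponentIn ⟨hz, h⟩⟩

theorem IsStratum.smul {H : Set ℍ} {L : Set (Set ℍ)} {q : PSL2R} (hH : q • H = H)
    (hL : ∀ l ∈ L, q • l ∈ L) (hL' : ∀ l ∈ L, q⁻¹ • l ∈ L) {F : Set ℍ}
    (hF : IsStratum H L F) : IsStratum H L (q • F) := by
  rcases hF with hF | ⟨x, hx, rfl⟩
  · exact Or.inl (hL F hF)
  · have hU : q • ⋃₀ L = ⋃₀ L := by
      apply Subset.antisymm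
      · rintro _ ⟨z, ⟨l, hl, hz⟩, rfl⟩
        exact ⟨_, hL l hl, smul_mem_smul_set hz⟩
      · rintro z ⟨l, hl, hz⟩
        rw [mem_smul_set_iff_inv_smul_mem]
        exact ⟨_, hL' l hl, smul_mem_smul_set hz⟩
    have hS : q • (H \ ⋃₀ L) = H \ ⋃₀ L := by rw [smul_set_sdiff, hH, hU]
    refine Or.inr ⟨q • x, ?_, ?_⟩
    · rw [← hS]; exact smul_mem_smul_set hx
    · rw [psl_smul_connectedComponentIn q hx, hS]

/-- Near the axis, the leaves are vertical in the coordinates `P`. -/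
def VerticalNear (P : SL(2, ℝ)) (κ δ : ℝ) (L : Set (Set ℍ)) : Prop :=
  ∀ l ∈ L, ∀ z ∈ collar κ δ, P • z ∈ l → l = P • vline z.re

/-- A stratum that contains a point of the collar contains the vertical ray above it. -/
theorem IsStratum.ray {H : Set ℍ} {L : Set (Set ℍ)} {P : SL(2, ℝ)} {κ δ : ℝ}
    (hδ : 0 < δ) (hN : ∀ z ∈ collar κ δ, P • z ∈ H) (hV : VerticalNear P κ δ L)
    {F : Set ℍ} (hF : IsStratum H L F) {z : ℍ} (hz : P • z ∈ F) (hzN : z ∈ collar κ δ)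
    {w : ℍ} (hre : w.re = z.re) (him : z.im ≤ w.im) : P • w ∈ F := by
  rcases hF with hF | ⟨x, hx, rfl⟩
  · rw [hV F hF z hzN hz]
    exact smul_mem_smul_set hre
  · set R : Set ℍ := (fun t => vpt z.re (Real.exp t) (Real.exp_pos t)) '' Ici (Real.log z.im)
    have hR : IsPreconnected R :=
      isPreconnected_Ici.image _
        (UpperHalfPlane.isometry_vertical_line z.re).continuous.continuousOn
    have hmem : ∀ u : ℍ, u.re = z.re → z.im ≤ u.im → u ∈ R := fun u h1 h2 =>
      ⟨Real.log u.im, Real.log_le_log z.im_pos h2, UpperHalfPlane.ext_re_im h1.symm (by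
        rw [vpt_im, Real.exp_log u.im_pos])⟩
    have hR' : IsPreconnected ((fun u => P • u) '' R) :=
      hR.image _ (continuous_const_smul P).continuousOn
    -- A leaf meeting the ray would be the whole vertical geodesic through `z`, and `z` is off the
    -- lamination.
    have hsub : (fun u => P • u) '' R ⊆ H \ ⋃₀ L := by
      rintro _ ⟨_, ⟨t, ht, rfl⟩, rfl⟩
      have ht' : z.im ≤ Real.exp t := (Real.log_le_iff_le_exp z.im_pos).1 ht
      have huN : vpt z.re (Real.exp t) (Real.exp_pos t) ∈ collar κ δ := by
        refine ⟨hzN.1, ?_⟩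
        have h1 := hzN.2
        have h2 := z.im_pos
        rw [vpt_re, vpt_nsq]
        unfold nsq at h1
        have h3 : z.im ^ 2 ≤ Real.exp t ^ 2 := pow_le_pow_left₀ h2.le ht' 2
        nlinarith
      refine ⟨hN _ huN, ?_⟩
      rintro ⟨l, hl, hul⟩
      have e := hV l hl _ huN hul
      refine (connectedComponentIn_subset _ _ hz).2 ⟨l, hl, ?_⟩
      rw [e]
      exact smul_mem_smul_set (show z ∈ vline _ from rfl)
    have := hR'.subset_connectedComponentIn (x := P • z) ⟨z, hmem z rfl le_rfl, rfl⟩ hsub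
    rw [connectedComponentIn_eq hz]
    exact this ⟨w, hmem w hre him, rfl⟩

/-- The collar model of an earthquake near a boundary geodesic in suitable coordinates `P`. -/
theorem collarModel {H : Set ℍ} {L : Set (Set ℍ)} (hL : IsGeodesicLamination H L)
    {g h : PSL2R} (hgH : g • H = H) (hgL : ∀ l ∈ L, g • l ∈ L) (hgL' : ∀ l ∈ L, g⁻¹ • l ∈ L)
    {E : ℍ → ℍ} {A : Set ℍ → PSL2R} (hE : IsRightEarthquake H L E A)
    (hEg : ∀ x ∈ H, E (g • x) = h • E x) {P : SL(2, ℝ)} {κ δ : ℝ} (hκ : κ ≠ 1) (hδ : 0 < δ)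
    (hg : IsAffine ((toPSL P)⁻¹ * g * toPSL P) κ 0)
    (hside : ∀ z, P • z ∈ H → κ * z.re < z.re) (hN : ∀ z ∈ collar κ δ, P • z ∈ H)
    (hV : VerticalNear P κ δ L) :
    CollarModel κ δ ((fun z => P • z) ⁻¹' H) {F | IsStratum H L (P • F)}
      (fun F => A (P • F) * toPSL P) ((toPSL P)⁻¹ * g * toPSL P) h := by
  have hPg : ∀ F : Set ℍ, P • (((toPSL P)⁻¹ * g * toPSL P) • F) = g • (P • F) := by
    intro F
    rw [← toPSL_smul_set, ← toPSL_smul_set, smul_smul, smul_smul]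
    congr 1; group
  have hPg' : ∀ F : Set ℍ, P • (((toPSL P)⁻¹ * g * toPSL P)⁻¹ • F) = g⁻¹ • (P • F) := by
    intro F
    rw [← toPSL_smul_set, ← toPSL_smul_set, smul_smul, smul_smul]
    congr 1; group
  have hgH' : g⁻¹ • H = H := by
    rw [inv_smul_eq_iff, hgH]
  refine ⟨hκ, hδ, hg, hside, hN, ?_, ?_, ?_, ?_, ?_, ?_, ?_, ?_⟩
  · intro z hz
    obtain ⟨F, hF, hzF⟩ := IsStratum.exists_mem L (show P • z ∈ H from hz)
    refine ⟨P⁻¹ • F, ?_, ?_⟩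
    · show IsStratum H L (P • P⁻¹ • F)
      rwa [smul_inv_smul]
    · rwa [mem_smul_set_iff_inv_smul_mem, inv_inv]
  · intro F hF F' hF' z hz hz'
    have := hF.eq_of_mem hL hF' (smul_mem_smul_set (a := P) hz) (smul_mem_smul_set hz')
    exact smul_left_cancel P this
  · intro F hF z hz
    exact hF.subset hL (smul_mem_smul_set hz)
  · intro F hF z hz hzN w hre him
    have := hF.ray hδ hN hV (smul_mem_smul_set hz) hzN hre him
    exact (smul_mem_smul_set_iff).1 this
  · intro F hF
    show IsStratum H L _
    rw [hPg]
    exact hF.smul hgH hgL hgL'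
  · intro F hF
    show IsStratum H L _
    rw [hPg']
    exact hF.smul hgH' hgL' (by simpa using hgL)
  · intro F hF F' hF' hne
    have hne' : P • F ≠ P • F' := fun e => hne (smul_left_cancel P e)
    rcases hE.comparison _ _ hF hF' hne' with h1 | ⟨h1, -⟩
    · left
      have := h1.preimage
      convert this using 1
      group
    · right
      simp only [h1]
  · intro F hF x hx
    have h1 : P • x ∈ P • F := smul_mem_smul_set hx
    have h2 := hE.eqOn _ hF _ h1
    have h3 := hE.eqOn _ (hF.smul hgH hgL hgL') _ (smul_mem_smul_set (a := g) h1)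
    have e : P • (((toPSL P)⁻¹ * g * toPSL P) • x) = g • (P • x) := by
      rw [mul_smul, mul_smul, ← toPSL_smul P, smul_inv_smul, toPSL_smul]
    simp only [hPg]
    rw [hEg _ (hF.subset hL h1)] at h3
    rw [mul_smul (A _) (toPSL P), mul_smul (A _) (toPSL P), toPSL_smul, toPSL_smul, e, ← h2, h3]

/-- What an earthquake does to a boundary component near which the leaves are vertical in the
coordinates `P`. -/
theorem earthquake_near_boundary {H : Set ℍ} {L : Set (Set ℍ)} (hL : IsGeodesicLamination H L)
    {g h : PSL2R} (hgH : g • H = H) (hgL : ∀ l ∈ L, g • l ∈ L) (hgL' : ∀ l ∈ L, g⁻¹ • l ∈ L)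
    {μ : Set ℍ → Measure ℍ} {E : ℍ → ℍ} (hE : IsRightEarthquakeAlong H L μ E)
    (hEg : ∀ x ∈ H, E (g • x) = h • E x) {P : SL(2, ℝ)} {κ δ : ℝ} (hκ : κ ≠ 1) (hδ : 0 < δ)
    (hg : IsAffine ((toPSL P)⁻¹ * g * toPSL P) κ 0)
    (hside : ∀ z, P • z ∈ H → κ * z.re < z.re) (hN : ∀ z ∈ collar κ δ, P • z ∈ H)
    (hV : VerticalNear P κ δ L) :
    ∃ m, 0 ≤ m ∧
      (∀ x ∈ H \ ⋃₀ L, P⁻¹ • x ∈ collar κ δ →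
        μ (segment x (g • x)) univ = ENNReal.ofReal m) ∧
      boundaryLength (E '' H) h = |Real.log κ + m| ∧
      ((∃ v, P • vline v ∈ L) →
        (1 < κ * Real.exp m → SpiralsPositively (E '' H) (imageLeaves E L) h) ∧
        (κ * Real.exp m < 1 → SpiralsNegatively (E '' H) (imageLeaves E L) h)) ∧
      (HasCusp (E '' H) h ↔ κ * Real.exp m = 1) := by
  obtain ⟨A, hEA, hμ⟩ := hE
  have M := collarModel hL hgH hgL hgL' hEA hEg hκ hδ hg hside hN hV
  obtain ⟨m, hm0, hm⟩ := M.exists_mass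
  obtain ⟨z₀, hz₀⟩ := M.exists_mem_collar
  obtain ⟨F₀, hF₀, hzF₀⟩ := M.cover _ (M.collar_subset hz₀)
  obtain ⟨b, hb⟩ := hm F₀ hF₀ z₀ hzF₀ hz₀
  have B : BasedModel κ δ ((fun z => P • z) ⁻¹' H) {F | IsStratum H L (P • F)}
      (fun F => A (P • F) * toPSL P) ((toPSL P)⁻¹ * g * toPSL P) h (fun z => E (P • z))
      F₀ z₀ (κ * Real.exp m) b := by
    refine ⟨M, fun F hF x hx => ?_, hF₀, hzF₀, hz₀, hb⟩
    show E (P • x) = _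
    rw [mul_smul, toPSL_smul]
    exact hEA.eqOn _ hF _ (smul_mem_smul_set hx)
  have himg : (fun z => E (P • z)) '' ((fun z => P • z) ⁻¹' H) = E '' H := by
    ext w
    constructor
    · rintro ⟨z, hz, rfl⟩
      exact ⟨_, hz, rfl⟩
    · rintro ⟨z, hz, rfl⟩
      exact ⟨P⁻¹ • z, by simpa using hz, by simp⟩
  have himL : imageLeaves (fun z => E (P • z)) {l | P • l ∈ L} = imageLeaves E L := by
    have e : ∀ l : Set ℍ, (fun z => E (P • z)) '' l = E '' (P • l) := fun l => by
      rw [← image_smul, image_image]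
    ext w
    constructor
    · rintro ⟨l, hl, rfl⟩
      exact ⟨_, hl, (e l).symm⟩
    · rintro ⟨l, hl, rfl⟩
      refine ⟨P⁻¹ • l, ?_, ?_⟩
      · show P • P⁻¹ • l ∈ L
        rwa [smul_inv_smul]
      · simp only
        rw [e, smul_inv_smul]
  have hκ0 := hg.pos
  refine ⟨m, hm0, ?_, ?_, ?_, ?_⟩
  · rintro x hx hxN
    have hgx : g • x ∈ H \ ⋃₀ L := by
      refine ⟨by rw [← hgH]; exact smul_mem_smul_set hx.1, ?_⟩
      rintro ⟨l, hl, hxl⟩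
      exact hx.2 ⟨_, hgL' l hl, by rwa [mem_smul_set_iff_inv_smul_mem, inv_inv]⟩
    have hPgx : ((toPSL P)⁻¹ * g * toPSL P) • (P⁻¹ • x) = P⁻¹ • (g • x) := by
      rw [mul_smul, mul_smul, toPSL_smul, smul_inv_smul, ← toPSL_inv, toPSL_smul]
    have hne : x ≠ g • x := by
      intro e
      have h1 := hxN.1
      have h2 := (hg (P⁻¹ • x)).1
      rw [hPgx, ← e] at h2
      linarith
    -- All shear sums agree, so the infimum that defines the mass is taken over a singleton.
    have hsum : ∀ S ∈ shearSums H L A x (g • x), S = m := by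
      rintro S ⟨k, p, F, hp0, hpk, hp, hd, rfl⟩
      have := M.sum_translationLength hm hxN (k := k) (p := fun i => P⁻¹ • p i)
        (F := fun i => P⁻¹ • F i) (by simp only [hp0]) (by simp only [hpk, hPgx]) ?_ ?_
      · rw [← this]
        refine Finset.sum_congr rfl fun i _ => ?_
        simp only [smul_inv_smul]
        rw [← translationLength_conj (toPSL P) ((A (F i))⁻¹ * A (F (i + 1)))]
        simp only [mul_inv_rev, mul_assoc]
      · intro i hi
        obtain ⟨h1, h2, h3⟩ := hp i hi
        refine ⟨?_, ?_, smul_mem_smul_set h3⟩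
        · rw [hPgx]
          exact smul_mem_segment.2 h1
        · show IsStratum H L (P • P⁻¹ • F i)
          rwa [smul_inv_smul]
      · intro i hi
        simp only [dist_smul]
        exact hd i hi
    have hnonempty : (shearSums H L A x (g • x)).Nonempty := by
      obtain ⟨F, hF, hxF⟩ := IsStratum.exists_mem L hx.1
      have hsx : x ∈ segment x (g • x) := by
        show dist _ _ + dist _ _ = dist _ _
        simp
      have hsgx : g • x ∈ segment x (g • x) := by
        show dist _ _ + dist _ _ = dist _ _
        simp
      refine ⟨_, 1, fun i => if i = 0 then x else g • x, fun i => if i = 0 then F else g • F,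
        by simp, by simp, ?_, ?_, rfl⟩
      · intro i _
        by_cases h0 : i = 0
        · simp only [h0, if_true]
          exact ⟨hsx, hF, hxF⟩
        · simp only [h0, if_false]
          exact ⟨hsgx, hF.smul hgH hgL hgL', smul_mem_smul_set hxF⟩
      · intro i hi
        obtain rfl : i = 0 := by omega
        simp
    rw [hμ x hx _ hgx hne, (eq_singleton_iff_nonempty_unique_mem.2 ⟨hnonempty, hsum⟩),
      csInf_singleton]
  · rw [← himg, B.boundaryLength_eq, Real.log_mul hκ0.ne' (Real.exp_pos m).ne', Real.log_exp]
  · rintro ⟨v, hv⟩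
    rw [← himg, ← himL]
    have hsp : κ * Real.exp m ≠ 1 → _ := fun hk => B.spirals hk (L := {l | P • l ∈ L})
      (fun l hl => Or.inl hl) (fun l hl => ?_) ⟨v, hv⟩
    · exact ⟨fun h1 => (hsp h1.ne').1 h1, fun h1 => (hsp h1.ne).2 h1⟩
    · obtain ⟨C, hC⟩ := hL.isGeodesic _ hl
      exact ⟨P⁻¹ * C, by rw [← smul_line, ← hC, inv_smul_smul]⟩
  · rw [← himg]
    exact ⟨B.not_hasCusp, B.hasCusp⟩

/-! ### Leaves close to a boundary geodesic -/

/-- A geodesic on one side of the imaginary axis that does not cross its image under `z ↦ κ z`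
and comes close to the imaginary axis is asymptotic to it. -/
theorem asymptotic_of_disjoint {κ δ : ℝ} (hκ1 : κ ≠ 1) (hδ : δ * (κ + 1) ^ 2 ≤ 4 * κ)
    {q : PSL2R} (hq : IsAffine q κ 0) {D : SL(2, ℝ)} (hside : ∀ z ∈ line D, κ * z.re < z.re)
    (hdisj : q • line D = line D ∨ Disjoint (q • line D) (line D))
    {z : ℍ} (hz : z ∈ line D) (hzN : z ∈ collar κ δ) :
    D 1 0 * D 1 1 = 0 ∨ D 0 0 * D 0 1 = 0 := by
  have hκ := hq.pos
  have hdiscr := side_discr D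
  have hmem : ∀ z, z ∈ line D ↔ (D 0 0 * D 1 1 + D 0 1 * D 1 0) * z.re
      - (D 1 0 * D 1 1) * nsq z - (D 0 0 * D 0 1) = 0 := fun z => mem_line
  generalize D 0 0 * D 1 1 + D 0 1 * D 1 0 = β at *
  generalize D 1 0 * D 1 1 = α at *
  generalize D 0 0 * D 0 1 = c at *
  by_contra! hne
  obtain ⟨hα, hc⟩ := hne
  have hq' := hq.inv
  -- The product of the end points is `c / α`. If it is negative, the geodesic crosses the imaginary
  -- axis.
  rcases lt_or_gt_of_ne (mul_ne_zero hα hc) with h | h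
  · have hY : (0 : ℝ) ^ 2 < -c / α := by
      have : -c / α = -(α * c) / α ^ 2 := by field_simp
      rw [this, zero_pow two_ne_zero]
      have := sq_pos_of_ne_zero hα
      apply div_pos <;> linarith
    obtain ⟨w, hw1, hw2⟩ := exists_re_nsq hY
    have := hside w ((hmem w).2 (by rw [hw1, hw2]; field_simp; ring))
    rw [hw1] at this
    linarith
  · have hβ2 : 0 < β ^ 2 := by rw [hdiscr]; nlinarith
    have hβ : β ≠ 0 := fun h => by simp [h] at hβ2
    -- The test compares the ratio of the end points with `κ`. In the first case the geodesic
    -- crosses its image, at the point with `re = (κ + 1) c / β` and `nsq = κ c / α`.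
    rcases lt_or_ge ((κ - 1) ^ 2 * (α * c)) κ with h1 | h1
    · have hY : ((κ + 1) * c / β) ^ 2 < κ * c / α := by
        have e1 : κ * c / α = κ * (α * c) * (1 + 4 * α * c) / (α ^ 2 * β ^ 2) := by
          rw [← hdiscr]; field_simp
        have e2 : ((κ + 1) * c / β) ^ 2 = (κ + 1) ^ 2 * (α * c) ^ 2 / (α ^ 2 * β ^ 2) := by
          field_simp
        have hα2 := sq_pos_of_ne_zero hα
        rw [e1, e2]
        apply div_lt_div_of_pos_right _ (by positivity)
        nlinarith [mul_lt_mul_of_pos_right h1 h]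
      obtain ⟨w, hw1, hw2⟩ := exists_re_nsq hY
      have hwl : w ∈ line D := (hmem w).2 (by rw [hw1, hw2]; field_simp; ring)
      have hwq : w ∈ q • line D := by
        rw [mem_smul_set_iff_inv_smul_mem, hmem, (hq'.congr rfl rfl (by simp)).nsq_smul, (hq' w).1,
          hw1, hw2]
        field_simp; ring
      rcases hdisj with h2 | h2
      · have h3 : q • w ∈ line D := by rw [← h2]; exact smul_mem_smul_set hwl
        rw [hmem, hq.nsq_smul, (hq w).1, hw1, hw2] at h3
        have h4 : c * ((κ - 1) ^ 2 * (κ + 1)) = 0 := by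
          field_simp at h3
          linear_combination (-1 : ℝ) * h3
        have h5 : κ - 1 ≠ 0 := sub_ne_zero.2 hκ1
        have h6 : κ + 1 ≠ 0 := by positivity
        exact mul_ne_zero hc (mul_ne_zero (pow_ne_zero 2 h5) h6) h4
      · exact disjoint_left.1 h2 hwq hwl
    -- When the ends are this close together, every point satisfies `re ^ 2 / nsq ≥ 4 α c / β ^ 2 ≥
    -- 4 κ / (κ + 1) ^ 2`, so the geodesic misses the collar.
    · have h2 := (hmem z).1 hz
      have h3 := hzN.2
      have hN := nsq_pos z
      have h4 : β ^ 2 * z.re ^ 2 = (α * nsq z + c) ^ 2 := by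
        rw [← mul_pow]; congr 1; linarith
      have h5 : 4 * (α * c) * nsq z ≤ β ^ 2 * z.re ^ 2 := by
        rw [h4]; nlinarith [sq_nonneg (α * nsq z - c)]
      have h6 : β ^ 2 * z.re ^ 2 < β ^ 2 * (δ * nsq z) := mul_lt_mul_of_pos_left h3 hβ2
      have h7 : 4 * (α * c) < β ^ 2 * δ := by
        by_contra! h8
        nlinarith [mul_le_mul_of_nonneg_right h8 hN.le]
      rw [hdiscr] at h7
      have h9 : (1 + 4 * α * c) * (δ * (κ + 1) ^ 2) ≤ (1 + 4 * α * c) * (4 * κ) :=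
        mul_le_mul_of_nonneg_left hδ (by nlinarith)
      have h10 := mul_lt_mul_of_pos_right h7 (show 0 < (κ + 1) ^ 2 by positivity)
      nlinarith

theorem line_eq_vline {D : SL(2, ℝ)} (h : D 1 0 * D 1 1 = 0) {z : ℍ} (hz : z ∈ line D) :
    line D = vline z.re := by
  have hdiscr := side_discr D
  rw [h] at hdiscr
  have hβ : D 0 0 * D 1 1 + D 0 1 * D 1 0 ≠ 0 := fun e => by rw [e] at hdiscr; norm_num at hdiscr
  ext w
  rw [mem_line, side, h] at *
  rw [mem_vline]
  constructor
  · intro hw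
    apply mul_left_cancel₀ hβ
    linarith
  · intro hw
    rw [hw]; linarith

theorem line_eq_flip_vline {D : SL(2, ℝ)} (h : D 0 0 * D 0 1 = 0) :
    ∃ w, line D = flip • vline w := by
  have hdiscr := side_discr D
  rw [h] at hdiscr
  have hβ : D 0 0 * D 1 1 + D 0 1 * D 1 0 ≠ 0 := fun e => by rw [e] at hdiscr; norm_num at hdiscr
  refine ⟨-(D 1 0 * D 1 1) / (D 0 0 * D 1 1 + D 0 1 * D 1 0), ?_⟩
  ext z
  obtain ⟨r, -, -⟩ := flip_coords z
  rw [mem_smul_set_iff_inv_smul_mem, flip_inv_smul, mem_vline, mem_line, side, h, eq_div_iff hβ]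
  constructor
  · intro e
    apply mul_right_cancel₀ (nsq_pos z).ne'
    linear_combination (D 0 0 * D 1 1 + D 0 1 * D 1 0) * r - e
  · intro e
    linear_combination (D 0 0 * D 1 1 + D 0 1 * D 1 0) * r - nsq z * e

/-! ### Charts at a boundary geodesic -/

/-- In the coordinates `P`, the imaginary axis is a boundary geodesic of `H`, translated by
`g` by the factor `κ`, and the collar `collar κ δ` is contained in `H`. -/
structure BoundaryChart (H : Set ℍ) (g : PSL2R) (P : SL(2, ℝ)) (κ δ : ℝ) : Prop where
  ne_one : κ ≠ 1
  δ_pos : 0 < δ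
  isAffine : IsAffine ((toPSL P)⁻¹ * g * toPSL P) κ 0
  side : ∀ z, P • z ∈ H → κ * z.re < z.re
  collar_subset : ∀ z ∈ collar κ δ, P • z ∈ H
  closure : ∀ y (hy : 0 < y), P • vpt 0 y hy ∈ closure H

theorem flip_mem_collar {κ δ : ℝ} (hκ : 0 < κ) {z : ℍ} :
    flip • z ∈ collar κ δ ↔ z ∈ collar κ⁻¹ δ := by
  obtain ⟨r, -, n⟩ := flip_coords z
  have hN := nsq_pos z
  have h1 : (flip • z).re = -z.re / nsq z := by rw [eq_div_iff hN.ne', r]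
  have h2 : nsq (flip • z) = 1 / nsq z := by rw [eq_div_iff hN.ne', n]
  show _ ∧ _ ↔ _ ∧ _
  rw [h1, h2]
  apply and_congr
  · rw [← mul_div_assoc, div_lt_div_iff_of_pos_right hN, inv_mul_lt_iff₀ hκ]
    constructor <;> intro h <;> linarith
  · rw [div_pow, neg_sq, div_lt_iff₀ (by positivity)]
    have : δ * (1 / nsq z) * nsq z ^ 2 = δ * nsq z := by field_simp
    rw [this]

namespace BoundaryChart

variable {H : Set ℍ} {g : PSL2R} {P : SL(2, ℝ)} {κ δ : ℝ}

/-- Reduces leaves ending at `0` to vertical ones, so that negative spiralling becomes the vertical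
case with factor less than `1`. -/
theorem flip_chart (B : BoundaryChart H g P κ δ) : BoundaryChart H g (P * flip) κ⁻¹ δ := by
  have hκ := B.isAffine.pos
  refine ⟨fun h => B.ne_one (by simpa using h), B.δ_pos, ?_, ?_, ?_, ?_⟩
  · refine B.isAffine.conj_flip.congr ?_ rfl rfl
    have : toPSL (P * flip) = toPSL P * toPSL flip := psl_ext fun z => by
      rw [mul_smul, toPSL_smul, toPSL_smul, toPSL_smul, mul_smul]
    rw [this]; group
  · intro z hz
    rw [mul_smul] at hz
    have h1 := B.side _ hz
    obtain ⟨r, -, -⟩ := flip_coords z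
    have h2 := mul_lt_mul_of_pos_right h1 (nsq_pos z)
    rw [mul_assoc, r] at h2
    rw [inv_mul_lt_iff₀ hκ]
    linarith
  · intro z hz
    rw [mul_smul]
    exact B.collar_subset _ ((flip_mem_collar hκ).2 hz)
  · intro y hy
    rw [mul_smul, flip_smul_vpt]
    exact B.closure _ _

theorem side_inv (B : BoundaryChart H g P κ δ) {z : ℍ} (hz : z ∈ H) :
    κ * (P⁻¹ • z).re < (P⁻¹ • z).re := B.side _ (by rwa [smul_inv_smul])

/-- The points of `H` close to the boundary geodesic belong to the collar. -/
theorem exists_infDist (B : BoundaryChart H g P κ δ) :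
    ∃ ε > 0, ∀ z ∈ H, Metric.infDist z (line P) < ε →
      P⁻¹ • z ∈ collar κ δ ∧ |(P⁻¹ • z).re| < √δ * (P⁻¹ • z).im := by
  have hs := Real.sqrt_pos.2 B.δ_pos
  obtain ⟨ε, hε, h⟩ := exists_infDist_line P hs
  refine ⟨ε, hε, fun z hz hzε => ⟨⟨B.side_inv hz, ?_⟩, h z hzε⟩⟩
  have h1 := pow_lt_pow_left₀ (h z hzε) (abs_nonneg _) two_ne_zero
  rw [sq_abs, mul_pow, Real.sq_sqrt B.δ_pos.le] at h1
  unfold nsq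
  nlinarith [sq_nonneg (P⁻¹ • z).re, B.δ_pos]

theorem isBoundaryAxis (B : BoundaryChart H g P κ δ) :
    (1 < κ → IsBoundaryAxis H g P) ∧ (κ < 1 → IsBoundaryAxis H g (P * flip)) :=
  isBoundaryAxis_of_affine B.isAffine (fun _ hz => B.side_inv hz) B.closure

theorem hasBoundaryMass (B : BoundaryChart H g P κ δ) {L : Set (Set ℍ)} {μ : Set ℍ → Measure ℍ}
    {m : ℝ} (hm0 : 0 ≤ m) (hm : ∀ x ∈ H \ ⋃₀ L, P⁻¹ • x ∈ collar κ δ →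
      μ (HypEarthquake.segment x (g • x)) univ = ENNReal.ofReal m) : HasBoundaryMass H L μ g m := by
  obtain ⟨ε, hε, h⟩ := B.exists_infDist
  refine ⟨hm0, ?_⟩
  rcases lt_or_gt_of_ne B.ne_one with hκ | hκ
  · refine ⟨_, B.isBoundaryAxis.2 hκ, ε, hε, fun x hx hxε => hm x hx (h x hx.1 ?_).1⟩
    rwa [line_mul_flip] at hxε
  · exact ⟨_, B.isBoundaryAxis.1 hκ, ε, hε, fun x hx hxε => hm x hx (h x hx.1 hxε).1⟩

theorem boundaryLength_eq (B : BoundaryChart H g P κ δ) :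
    boundaryLength H g = |Real.log κ| := by
  have hv : ∃ v : ℝ, κ * v < v := by
    rcases lt_or_gt_of_ne B.ne_one with hκ | hκ
    · exact ⟨1, by linarith⟩
    · exact ⟨-1, by linarith⟩
  obtain ⟨v, hv⟩ := hv
  obtain ⟨y₀, -, hy₀⟩ := exists_vpt_mem_collar B.δ_pos hv
  exact B.isAffine.boundaryLength_eq (x := v) (y₀ := y₀)
    fun y hy h => B.collar_subset _ (hy₀ y hy h)

/-- A leaf asymptotic to the boundary geodesic enters the collar. -/
theorem exists_mem_collar (B : BoundaryChart H g P κ δ) {l : Set ℍ} (hl : l ⊆ H)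
    (hne : l.Nonempty) {F : Filter ℝ} [F.NeBot]
    (ht : Tendsto (fun t => Metric.infDist (axisPoint P t) l) F (𝓝 0)) :
    ∀ᶠ t in F, ∃ z ∈ l, dist (axisPoint P t) z < 1 ∧
      P⁻¹ • z ∈ collar κ δ ∧ |(P⁻¹ • z).re| < √δ * (P⁻¹ • z).im := by
  obtain ⟨ε, hε, h⟩ := B.exists_infDist
  filter_upwards [ht.eventually (gt_mem_nhds (lt_min one_pos hε))] with t hts
  obtain ⟨z, hz, hd⟩ := (Metric.infDist_lt_iff hne).1 hts
  refine ⟨z, hz, hd.trans_le (min_le_left _ _), h z (hl hz) ?_⟩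
  rw [dist_comm] at hd
  exact (Metric.infDist_le_dist_of_mem (mem_range_self t)).trans_lt (hd.trans_le (min_le_right _ _))

variable {L : Set (Set ℍ)}

/-- If the leaves near the boundary geodesic are vertical, no leaf is asymptotic to it
downwards. -/
theorem not_tendsto_atBot (B : BoundaryChart H g P κ δ) (hV : VerticalNear P κ δ L)
    {l : Set ℍ} (hlL : l ∈ L) (hl : l ⊆ H) (hne : l.Nonempty) :
    ¬ Tendsto (fun t => Metric.infDist (axisPoint P t) l) atBot (𝓝 0) := by
  intro ht
  have hev := B.exists_mem_collar hl hne ht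
  obtain ⟨t₀, z₀, hz₀, -, hzN₀, -⟩ := hev.exists
  set v := (P⁻¹ • z₀).re with hv
  have hre : ∀ z ∈ l, (P⁻¹ • z).re = v := fun z hz => by
    have e := hV l hlL _ hzN₀ (by rwa [smul_inv_smul])
    rw [e, mem_smul_set_iff_inv_smul_mem] at hz
    exact hz
  have hlim : Tendsto (fun t => √δ * (Real.exp t * Real.exp 1)) atBot (𝓝 0) := by
    simpa using (Real.tendsto_exp_atBot.mul_const (Real.exp 1)).const_mul √δ
  have hle : |v| ≤ 0 := by
    -- All points of the leaf have abscissa `v`, yet those near the axis at height `exp t` have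
    -- abscissa bounded by a multiple of `exp t`; letting `t → -∞` gives `v = 0`.
    refine ge_of_tendsto hlim (hev.mono ?_)
    rintro t ⟨z, hz, hd, -, hzs⟩
    rw [hre z hz] at hzs
    have hd' : dist (P⁻¹ • z) (vpt 0 _ (Real.exp_pos t)) < 1 := by
      rw [← dist_smul P, smul_inv_smul, dist_comm]; exact hd
    have him := UpperHalfPlane.im_le_im_mul_exp_dist (P⁻¹ • z) (vpt 0 _ (Real.exp_pos t))
    rw [vpt_im] at him
    refine hzs.le.trans (mul_le_mul_of_nonneg_left (him.trans ?_) (Real.sqrt_nonneg δ))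
    exact mul_le_mul_of_nonneg_left (Real.exp_le_exp.2 hd'.le) (Real.exp_pos t).le
  have := hzN₀.1
  rw [← hv, abs_nonpos_iff.1 hle] at this
  linarith

/-- If the leaves near the boundary geodesic are vertical, and there are such leaves, then the
lamination spirals around the boundary geodesic. -/
theorem spirals (B : BoundaryChart H g P κ δ) (hV : VerticalNear P κ δ L)
    (hv : ∃ v, P • vline v ∈ L) (hL : ∀ l ∈ L, l ⊆ H) :
    (1 < κ → SpiralsPositively H L g) ∧ (κ < 1 → SpiralsNegatively H L g) := by
  obtain ⟨v, hv⟩ := hv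
  refine spirals_of_vertical B.isAffine (fun _ hz => B.side_inv hz) B.closure
    ⟨_, hv, v, fun y hy => smul_mem_smul_set (show vpt v y hy ∈ vline v from rfl)⟩
    (Real.sqrt_pos.2 B.δ_pos) fun l hl => ?_
  by_cases h : ∃ z ∈ l, P⁻¹ • z ∈ collar κ δ
  · obtain ⟨z, hz, hzN⟩ := h
    left
    refine ⟨(P⁻¹ • z).re, fun y hy => ?_⟩
    rw [hV l hl _ hzN (by rwa [smul_inv_smul])]
    exact smul_mem_smul_set (show vpt _ y hy ∈ vline _ from rfl)
  · right
    intro z hz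
    have h1 : δ * nsq (P⁻¹ • z) ≤ (P⁻¹ • z).re ^ 2 := by
      by_contra! h2
      exact h ⟨z, hz, B.side_inv (hL l hl hz), h2⟩
    refine (pow_le_pow_iff_left₀ (mul_nonneg (Real.sqrt_nonneg δ) (P⁻¹ • z).im_pos.le)
      (abs_nonneg _) two_ne_zero).1 ?_
    rw [sq_abs, mul_pow, Real.sq_sqrt B.δ_pos.le]
    unfold nsq at h1
    nlinarith [sq_nonneg (P⁻¹ • z).re, B.δ_pos]

end BoundaryChart

/-! ### Uniqueness of the axis, and the dichotomy for spiralling -/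

/-- The axis of a translation is unique up to reparametrisation. -/
theorem IsAffine.axisPoint_eq {g : PSL2R} {P P₁ : SL(2, ℝ)} {κ κ₁ : ℝ} (hκ : 1 < κ) (hκ₁ : 1 < κ₁)
    (h : IsAffine ((toPSL P)⁻¹ * g * toPSL P) κ 0)
    (h₁ : IsAffine ((toPSL P₁)⁻¹ * g * toPSL P₁) κ₁ 0) :
    ∃ τ, ∀ t, axisPoint P₁ t = axisPoint P (t + τ) := by
  obtain ⟨M, rfl⟩ : ∃ M, P₁ = P * M := ⟨P⁻¹ * P₁, by group⟩
  set q := (toPSL P)⁻¹ * g * toPSL P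
  set q₁ := (toPSL (P * M))⁻¹ * g * toPSL (P * M)
  have e : ∀ z : ℍ, q • (M • z) = M • (q₁ • z) := fun z => by
    simp only [q, q₁, mul_smul, ← toPSL_inv, toPSL_smul, mul_inv_rev, smul_inv_smul]
  have hdet := det_eq_one M
  have hden : ∀ y (hy : 0 < y), κ₁ * (M 1 0 ^ 2 * y ^ 2 + M 1 1 ^ 2)
      = κ * (M 1 0 ^ 2 * (κ₁ ^ 2 * y ^ 2) + M 1 1 ^ 2) := fun y hy => by
    obtain ⟨-, i, -⟩ := smul_coords M (vpt 0 y hy)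
    obtain ⟨-, i', -⟩ := smul_coords M (q₁ • vpt 0 y hy)
    have hd := den_pos M (vpt 0 y hy)
    have hd' := den_pos M (q₁ • vpt 0 y hy)
    rw [← e, (h _).2, (h₁ _).2, vpt_im] at i'
    rw [vpt_im] at i
    have e1 : den M (vpt 0 y hy) = M 1 0 ^ 2 * y ^ 2 + M 1 1 ^ 2 := by
      simp [den]
    have e2 : den M (q₁ • vpt 0 y hy) = M 1 0 ^ 2 * (κ₁ ^ 2 * y ^ 2) + M 1 1 ^ 2 := by
      rw [den, h₁.nsq_smul, (h₁ _).1]; simp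
    rw [← e1, ← e2]
    apply mul_left_cancel₀ (M • vpt 0 y hy).im_pos.ne'
    linear_combination κ₁ * i - i'
  -- `M` conjugates one dilation to the other. If it did not fix the attracting end `∞`, the factors
  -- would be inverse to each other, but both exceed `1`.
  have hc : M 1 0 = 0 := by
    have h1 := hden 1 one_pos
    have h2 := hden 2 two_pos
    have h3 : M 1 0 ^ 2 * (κ₁ * (1 - κ * κ₁)) = 0 := by linear_combination (h2 - h1) / 3
    have h4 : κ₁ * (1 - κ * κ₁) ≠ 0 := by
      have : 1 - κ * κ₁ < 0 := by nlinarith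
      exact mul_ne_zero (by linarith) this.ne
    simpa [h4] using h3
  rw [hc] at hdet
  have hd0 : M 1 1 ≠ 0 := fun h0 => by rw [h0] at hdet; norm_num at hdet
  have hb : M 0 1 = 0 := by
    obtain ⟨r, -, -⟩ := smul_coords M (vpt 0 1 one_pos)
    obtain ⟨r', -, -⟩ := smul_coords M (q₁ • vpt 0 1 one_pos)
    rw [← e, (h _).1] at r'
    simp only [den, hc, h₁.nsq_smul, (h₁ _).1, vpt_re, vpt_nsq] at r r'
    have h1 : M 0 1 * M 1 1 * (κ - 1) = 0 := by linear_combination r' - κ * r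
    have h2 : κ - 1 ≠ 0 := by linarith
    simpa [h2, hd0] using h1
  refine ⟨-Real.log (M 1 1 ^ 2), fun t => ?_⟩
  rw [HypEarthquake.axisPoint_eq, HypEarthquake.axisPoint_eq, mul_smul]
  congr 1
  obtain ⟨r, i, -⟩ := smul_coords M (vpt 0 _ (Real.exp_pos t))
  have hd2 : (0 : ℝ) < M 1 1 ^ 2 := by positivity
  simp only [den, hc, hb, vpt_re, vpt_im] at r i
  apply UpperHalfPlane.ext_re_im
  · rw [vpt_re]
    apply mul_right_cancel₀ hd2.ne'
    linear_combination r
  · rw [vpt_im, Real.exp_add, Real.exp_neg, Real.exp_log hd2, ← div_eq_mul_inv, eq_div_iff hd2.ne']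
    linear_combination i

theorem SpiralsPositively.exists_tendsto {H : Set ℍ} {L : Set (Set ℍ)} {g : PSL2R} {P : SL(2, ℝ)}
    {κ : ℝ} (hκ : 1 < κ) (h : IsAffine ((toPSL P)⁻¹ * g * toPSL P) κ 0)
    (hs : SpiralsPositively H L g) :
    ∃ l ∈ L, Tendsto (fun t => Metric.infDist (axisPoint P t) l) atTop (𝓝 0) := by
  obtain ⟨C, ⟨-, -, s, hs, hC⟩, ⟨l, hl, ht⟩, -⟩ := hs
  obtain ⟨τ, hτ⟩ := (translatesAlong_iff.1 hC).axisPoint_eq (Real.one_lt_exp_iff.2 hs) hκ h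
  refine ⟨l, hl, ?_⟩
  simp only [hτ]
  exact ht.comp (tendsto_atTop_add_const_right _ τ tendsto_id)

theorem SpiralsNegatively.exists_tendsto {H : Set ℍ} {L : Set (Set ℍ)} {g : PSL2R} {P : SL(2, ℝ)}
    {κ : ℝ} (hκ : 1 < κ) (h : IsAffine ((toPSL P)⁻¹ * g * toPSL P) κ 0)
    (hs : SpiralsNegatively H L g) :
    ∃ l ∈ L, Tendsto (fun t => Metric.infDist (axisPoint P t) l) atBot (𝓝 0) := by
  obtain ⟨C, ⟨-, -, s, hs, hC⟩, ⟨l, hl, ht⟩, -⟩ := hs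
  obtain ⟨τ, hτ⟩ := (translatesAlong_iff.1 hC).axisPoint_eq (Real.one_lt_exp_iff.2 hs) hκ h
  refine ⟨l, hl, ?_⟩
  simp only [hτ]
  exact ht.comp (tendsto_atBot_add_const_right _ τ tendsto_id)

/-- A geodesic boundary component has a chart. -/
theorem IsBoundaryAxis.exists_chart {H : Set ℍ} (hne : H.Nonempty) (ho : IsOpen H)
    (hc : GeodConvex H) {g : PSL2R} (hgH : g • H = H) {C : SL(2, ℝ)} (hC : IsBoundaryAxis H g C) :
    ∃ κ δ : ℝ, 1 < κ ∧ δ * (κ + 1) ^ 2 ≤ 4 * κ ∧ BoundaryChart H g C κ δ := by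
  obtain ⟨hleft, hfr, s, hs, ht⟩ := hC
  rw [translatesAlong_iff] at ht
  have hκ := Real.one_lt_exp_iff.2 hs
  generalize Real.exp s = κ at *
  have hside : ∀ z : ℍ, C • z ∈ H → z.re < 0 := fun z hz => by
    have : (C⁻¹ • C • z).re < 0 := hleft hz
    rwa [inv_smul_smul] at this
  have hcl : ∀ y (hy : 0 < y), C • vpt 0 y hy ∈ closure H := fun y hy =>
    frontier_subset_closure (hfr (by rw [line_eq, mem_ofPred_eq, inv_smul_smul, vpt_re]))
  have hpre : ∀ z, ((toPSL C)⁻¹ * g * toPSL C) • z ∈ (fun z => C • z) ⁻¹' H ↔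
      z ∈ (fun z => C • z) ⁻¹' H := fun z => by
    show C • _ ∈ H ↔ C • z ∈ H
    rw [mul_smul, mul_smul, ← toPSL_smul C, smul_inv_smul, toPSL_smul]
    nth_rw 1 [← hgH]
    exact smul_mem_smul_set_iff
  obtain ⟨x, hx⟩ := hne
  obtain ⟨δ, hδ, h⟩ := exists_collar (σ := -1) ⟨C⁻¹ • x, by simpa using hx⟩
    (ho.preimage (continuous_const_smul C)) (geodConvex_preimage hc C) hκ ht hpre
    (fun z hz => by have := hside z hz; linarith)
    (fun y hy => by
      have := (Homeomorph.smul C).preimage_closure H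
      exact (Set.ext_iff.1 this _).1 (hcl y hy))
  -- The collar is shrunk to the size that `asymptotic_of_disjoint` requires.
  have h4 : (0 : ℝ) < 4 * κ / (κ + 1) ^ 2 := by positivity
  refine ⟨κ, min δ (4 * κ / (κ + 1) ^ 2), hκ, ?_, hκ.ne', lt_min hδ h4, ht, fun z hz => ?_,
    fun z hz => h z ?_ ?_, hcl⟩
  · exact (le_div_iff₀ (by positivity)).1 (min_le_right _ _)
  · have := hside z hz
    nlinarith
  · have := hz.1
    nlinarith
  · exact hz.2.trans_le (mul_le_mul_of_nonneg_right (min_le_left _ _) (nsq_pos z).le)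

/-- Each leaf entering the collar ends at `∞` or at `0`, and leaves of both kinds would intersect
after translation. The first alternative includes the case of no leaves near the axis, which is why
only the second provides a leaf. -/
theorem verticalNear_dichotomy {H : Set ℍ} {L : Set (Set ℍ)} (hL : IsGeodesicLamination H L)
    {g : PSL2R} (hgL : ∀ l ∈ L, g • l ∈ L) (hgL' : ∀ l ∈ L, g⁻¹ • l ∈ L) {P : SL(2, ℝ)}
    {κ δ : ℝ} (hκ : 1 < κ) (hδ : δ * (κ + 1) ^ 2 ≤ 4 * κ) (B : BoundaryChart H g P κ δ) :
    VerticalNear P κ δ L ∨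
      VerticalNear (P * flip) κ⁻¹ δ L ∧ ∃ w, (P * flip) • vline w ∈ L := by
  have hκ0 := B.isAffine.pos
  have hclass : ∀ l ∈ L, ∀ z ∈ collar κ δ, P • z ∈ l →
      l = P • vline z.re ∨ ∃ w, l = (P * flip) • vline w := by
    intro l hl z hz hzl
    obtain ⟨C, hC⟩ := hL.isGeodesic l hl
    have hlD : l = P • line (P⁻¹ * C) := by rw [smul_line, hC, mul_inv_cancel_left]
    generalize P⁻¹ * C = D at hlD
    have hzD : z ∈ line D := by
      rw [hlD] at hzl
      exact smul_mem_smul_set_iff.1 hzl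
    have hq : P • ((toPSL P)⁻¹ * g * toPSL P) • line D = g • l := by
      rw [← toPSL_smul_set, hlD, ← toPSL_smul_set P (line D), smul_smul, smul_smul]
      congr 1; group
    have := asymptotic_of_disjoint B.ne_one hδ B.isAffine (D := D) (fun w hw => B.side w
      (hL.subset l hl (by rw [hlD]; exact smul_mem_smul_set hw))) ?_ hzD hz
    · rcases this with h | h
      · left
        rw [hlD, line_eq_vline h hzD]
      · right
        obtain ⟨w, hw⟩ := line_eq_flip_vline h
        exact ⟨w, by rw [hlD, hw, mul_smul]⟩
    · by_cases he : g • l = l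
      · left
        apply smul_left_cancel P
        rw [hq, he, hlD]
      · right
        have := hL.disjoint (hgL l hl) hl he
        rw [← disjoint_smul_set (a := P), hq, ← hlD]
        exact this
  by_cases hV : VerticalNear P κ δ L
  · exact Or.inl hV
  right
  unfold VerticalNear at hV
  push Not at hV
  obtain ⟨l₀, hl₀, z₀, hz₀, hzl₀, hne⟩ := hV
  obtain ⟨w, rfl⟩ := (hclass l₀ hl₀ z₀ hz₀ hzl₀).resolve_left hne
  have hw : 0 < w := by
    have := B.flip_chart.side (vpt w 1 one_pos)
      (hL.subset _ hl₀ (smul_mem_smul_set (show vpt w 1 one_pos ∈ vline w from rfl)))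
    rw [vpt_re, inv_mul_lt_iff₀ hκ0] at this
    nlinarith
  have hnone : ∀ v, P • vline v ∉ L := by
    intro v hv
    have hv0 : v < 0 := by
      have := B.side (vpt v 1 one_pos)
        (hL.subset _ hv (smul_mem_smul_set (show vpt v 1 one_pos ∈ vline v from rfl)))
      rw [vpt_re] at this
      nlinarith
    have hpow : ∀ n : ℕ, P • vline (κ⁻¹ ^ n * v) ∈ L := by
      intro n
      induction n with
      | zero => simpa using hv
      | succ n ih =>
        have h1 := hgL' _ ih
        have h2 : g⁻¹ • P • vline (κ⁻¹ ^ n * v)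
            = P • ((toPSL P)⁻¹ * g * toPSL P)⁻¹ • vline (κ⁻¹ ^ n * v) := by
          rw [← toPSL_smul_set, ← toPSL_smul_set, smul_smul, smul_smul]
          congr 1; group
        rw [h2, B.isAffine.inv.smul_vline] at h1
        convert h1 using 3
        ring
    have hvw : 0 < -v * w := mul_pos (neg_pos.2 hv0) hw
    -- The leaf ending at `0` is the semicircle from `-1 / w` to `0`. A high enough power of `g⁻¹`
    -- brings the vertical leaf between these abscissas, where it must cross the semicircle.
    obtain ⟨n, hn⟩ := exists_pow_lt_of_lt_one (inv_pos.2 hvw) (inv_lt_one_of_one_lt₀ hκ)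
    have hL' := hpow n
    have hx0 : κ⁻¹ ^ n * v < 0 := mul_neg_of_pos_of_neg (by positivity) hv0
    have hxw : -(κ⁻¹ ^ n * v) * w < 1 := by
      have h1 := mul_lt_mul_of_pos_right hn hvw
      rw [inv_mul_cancel₀ hvw.ne'] at h1
      linarith
    generalize κ⁻¹ ^ n * v = x at *
    obtain ⟨z, hz1, hz2⟩ := exists_re_nsq (x := x) (Y := -x / w) (by
      rw [lt_div_iff₀ hw]; nlinarith)
    have hzf : ∀ z : ℍ, z ∈ flip • vline w ↔ w * nsq z = -z.re := fun z => by
      obtain ⟨r, -, -⟩ := flip_coords z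
      rw [mem_smul_set_iff_inv_smul_mem, flip_inv_smul, mem_vline, ← r]
      exact ⟨fun h => by rw [h], fun h => (mul_right_cancel₀ (nsq_pos z).ne' h).symm⟩
    have heq : P • vline x = P • flip • vline w := by
      by_contra hne
      rw [mul_smul] at hl₀
      refine disjoint_left.1 (hL.disjoint hL' hl₀ hne) (smul_mem_smul_set (a := P) hz1)
        (smul_mem_smul_set ((hzf z).2 ?_))
      rw [hz1, hz2]; field_simp
    have heq' := smul_left_cancel P heq
    have h1 := (hzf (vpt x 1 one_pos)).1 (heq' ▸ rfl)
    have h2 := (hzf (vpt x 2 two_pos)).1 (heq' ▸ rfl)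
    rw [vpt_re, vpt_nsq] at h1 h2
    nlinarith
  refine ⟨fun l hl z hz hzl => ?_, w, hl₀⟩
  rw [mul_smul] at hzl
  rcases hclass l hl _ ((flip_mem_collar hκ0).2 hz) hzl with h | ⟨w', h⟩
  · exact absurd (h ▸ hl) (hnone _)
  · rw [h] at hzl ⊢
    rw [← mul_smul, smul_mem_smul_set_iff] at hzl
    rw [show z.re = w' from hzl]

end HypEarthquake

end

/-- `H / ρ(G)` is an admissible surface with a geodesic boundary component (with positive
generator `γ`) of length `a`, `(L, μ)` is a measured geodesic lamination on it, and
`E '' H / ρ'(G)` is the surface obtained by the right earthquake along `(L, μ)`. -/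
theorem mainTheorem7 {G : Type*} [Group G] (ρ ρ' : G →* PSL2R) (H : Set ℍ)
    (hH : IsAdmissible ρ H)
    (γ : G) (hγ : IsGeodesicBoundaryComponent ρ H γ)
    (L : Set (Set ℍ)) (μ : Set ℍ → MeasureTheory.Measure ℍ)
    (hL : IsMeasuredLamination ρ H L μ)
    (E : ℍ → ℍ) (hE : IsRightEarthquakeAlong H L μ E)
    (hρ' : ∀ g : G, ∀ x ∈ H, E (ρ g • x) = ρ' g • E x)
    (a a' : ℝ) (ha : a = boundaryLength H (ρ γ)) (ha' : a' = boundaryLength (E '' H) (ρ' γ)) :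
    ∃ m : ℝ, HasBoundaryMass H L μ (ρ γ) m ∧
      ((SpiralsPositively H L (ρ γ) → a' = a + m) ∧
        (SpiralsNegatively H L (ρ γ) → a' = |a - m|)) ∧
      ((SpiralsPositively H L (ρ γ) →
          SpiralsPositively (E '' H) (imageLeaves E L) (ρ' γ)) ∧
        (SpiralsNegatively H L (ρ γ) → m < a →
          SpiralsNegatively (E '' H) (imageLeaves E L) (ρ' γ)) ∧
        (SpiralsNegatively H L (ρ γ) → a < m →
          SpiralsPositively (E '' H) (imageLeaves E L) (ρ' γ))) ∧
      (HasCusp (E '' H) (ρ' γ) ↔ SpiralsNegatively H L (ρ γ) ∧ m = a) := by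
  obtain ⟨C, hC, -⟩ := hγ
  have hgL := hL.invariant γ
  have hgL' : ∀ l ∈ L, (ρ γ)⁻¹ • l ∈ L := fun l hl => by
    rw [← map_inv]; exact hL.invariant γ⁻¹ l hl
  have hlam := hL.lamination
  have hne : ∀ l ∈ L, l.Nonempty := fun l hl => by
    obtain ⟨D, rfl⟩ := hlam.isGeodesic l hl
    exact range_nonempty _
  obtain ⟨κ, δ, hκ, hδ, B⟩ :=
    hC.exists_chart hH.nonempty hH.isOpen hH.convex (hH.invariant γ)
  have hκ0 : 0 < κ := by linarith
  have hlog : 0 < Real.log κ := Real.log_pos hκ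
  have ha2 : a = Real.log κ := by rw [ha, B.boundaryLength_eq, abs_of_pos hlog]
  subst ha'
  rcases verticalNear_dichotomy hlam hgL hgL' hκ hδ B with hV | ⟨hV, hw⟩
  · obtain ⟨m, hm0, hm, hlen, hsp, hcusp⟩ := earthquake_near_boundary hlam (hH.invariant γ) hgL hgL'
      hE (hρ' γ) B.ne_one B.δ_pos B.isAffine B.side B.collar_subset hV
    have hneg : ¬ SpiralsNegatively H L (ρ γ) := fun h => by
      obtain ⟨l, hl, ht⟩ := h.exists_tendsto hκ B.isAffine
      exact B.not_tendsto_atBot hV hl (hlam.subset l hl) (hne l hl) ht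
    -- Shearing can only increase a factor that already exceeds `1`, so a cusp cannot arise here.
    have hkm : 1 < κ * Real.exp m := by nlinarith [Real.add_one_le_exp m]
    refine ⟨m, B.hasBoundaryMass hm0 hm, ⟨fun _ => ?_, fun h => absurd h hneg⟩,
      ⟨fun h => ?_, fun h => absurd h hneg, fun h => absurd h hneg⟩,
      fun h => absurd (hcusp.1 h) hkm.ne', fun h => absurd h.1 hneg⟩
    · rw [hlen, ha2, abs_of_nonneg (by positivity)]
    · obtain ⟨l, hl, ht⟩ := h.exists_tendsto hκ B.isAffine
      obtain ⟨-, z, hz, -, hzN, -⟩ := (B.exists_mem_collar (hlam.subset l hl) (hne l hl) ht).exists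
      exact (hsp ⟨_, hV l hl _ hzN (by rwa [smul_inv_smul]) ▸ hl⟩).1 hkm
  · have B' := B.flip_chart
    obtain ⟨m, hm0, hm, hlen, hsp, hcusp⟩ := earthquake_near_boundary hlam (hH.invariant γ) hgL hgL'
      hE (hρ' γ) B'.ne_one B'.δ_pos B'.isAffine B'.side B'.collar_subset hV
    have hpos : ¬ SpiralsPositively H L (ρ γ) := fun h => by
      obtain ⟨l, hl, ht⟩ := h.exists_tendsto hκ B.isAffine
      refine B'.not_tendsto_atBot hV hl (hlam.subset l hl) (hne l hl) ?_
      simp only [axisPoint_mul_flip]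
      exact ht.comp tendsto_neg_atBot_atTop
    have hneg := (B'.spirals hV hw hlam.subset).2 (inv_lt_one_of_one_lt₀ hκ)
    have hexp : κ = Real.exp a := by rw [ha2, Real.exp_log hκ0]
    -- In the reversed chart the old factor is `exp (-a)`, so the sign of `m - a` decides between
    -- the two directions of spiralling and the cusp.
    have hkm : κ⁻¹ * Real.exp m = Real.exp (m - a) := by
      rw [hexp, ← Real.exp_neg, ← Real.exp_add]
      congr 1; ring
    rw [hkm] at hsp hcusp
    refine ⟨m, B'.hasBoundaryMass hm0 hm, ⟨fun h => absurd h hpos, fun _ => ?_⟩,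
      ⟨fun h => absurd h hpos, fun _ h => (hsp hw).2 (Real.exp_lt_one_iff.2 (by linarith)),
        fun _ h => (hsp hw).1 (Real.one_lt_exp_iff.2 (by linarith))⟩, ?_⟩
    · rw [hlen, Real.log_inv, ← ha2, abs_sub_comm]
      congr 1; ring
    · rw [hcusp, Real.exp_eq_one_iff, sub_eq_zero]
      exact ⟨fun h => ⟨hneg, h⟩, fun h => h.2⟩
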